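/- Let $\Gamma\subset SL(2,\mathbb C)$ be a finite subgroup, $N=|\Gamma|$, let $L=\mathbb C^2$ be its tautological representation and $R_0,\dots,R_{d-1}$ a complete list of its irreducible complex representations up to isomorphism, with $R_0$ trivial. The McKay graph of $\Gamma$ (an affine Dynkin graph) has vertices $0,\dots,d-1$, and its number of oriented edges from $k$ to $l$ is the multiplicity of $R_l$ in $R_k\otimes L$; let $H$ be the set of all oriented edges, write $h:out(h)\to in(h)$ and $\bar h$ for the reversed edge, choose an orientation $H=\Omega\sqcup\overline\Omega$ of the graph, and put $\varepsilon=1$ on $\Omega$, $\varepsilon=-1$ on $\overline\Omega$. *Quiver varieties.* For $v,w\in\mathbb Z_{\ge0}^d$ let $V_k=\mathbb C^{v_k}$, $W_k=\mathbb C^{w_k}$ with the standard hermitian products. For $\zeta_{\mathbb C}\in\mathbb C^d$ and $\zeta_{\mathbb R}\in\mathbb R^d$, regarded as the central elements of the group algebras of $\Gamma$ that act on $R_k$ as multiplication by $\zeta_{\mathbb C}^k$ and $\zeta_{\mathbb R}^k$, let $\mathfrak M^\Gamma_\zeta(v,w)$ be the quotient by $\prod_kU(V_k)$ of the set of all families $B_h:V_{out(h)}\to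 V_{in(h)}$, $i_k:W_k\to V_k$, $j_k:V_k\to W_k$ such that for every $k$ $$\sum_{in(h)=k}\varepsilon(h)B_hB_{\bar h}+i_kj_k=-(\dim R_k)\,\zeta_{\mathbb C}^k,$$ $$\tfrac{\sqrt{-1}}2\Big(\sum_{in(h)=k}\big(B_hB_h^\dagger-B_{\bar h}^\dagger B_{\bar h}\big)+i_ki_k^\dagger-j_k^\dagger j_k\Big)=-\sqrt{-1}\,(\dim R_k)\,\zeta_{\mathbb R}^k .$$ It carries the algebraic structure of the Kähler quotient: call a solution $x$ of the first equation semistable if the closure of its orbit under $\prod_kGL(V_k)$ contains solutions of both equations, and send $x$ to the $\prod_kU(V_k)$-orbit of these; then $\mathfrak M^\Gamma_\zeta(v,w)$ has the quotient of the Zariski topology of the semistable locus, and its regular functions are those whose pullbacks to the semistable locus are regular. *Calogero–Moser spaces.* For $\tau\in\mathbb C\setminus\{0\}$ and $r\ge0$ let $\mathcal{CM}_r$ be the variety $$\{(B_1,B_2,i,j)\in\mathfrak{gl}_r(\mathbb C)^2\oplus\mathrm{Hom}(\mathbb C,\mathbb C^r)\oplus\mathrm{Hom}(\mathbb C^r,\mathbb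 C)\ :\ [B_1,B_2]+ij=-\tau\}/GL_r(\mathbb C).$$ An element $\gamma\in\Gamma$ acts on it by sending the class of $(B_1,B_2,i,j)$ to the class of $(B_1^\gamma,B_2^\gamma,i,j)$, $B_s^\gamma=\sum_t\gamma_{ts}B_t$. At a point fixed by $\Gamma$ there are unique $g_\gamma\in GL_r(\mathbb C)$ with $g_\gamma\cdot(B_1,B_2,i,j)=(B_1^\gamma,B_2^\gamma,i,j)$, and $\gamma\mapsto g_\gamma$ is a representation of $\Gamma$ on $\mathbb C^r$. For $v\in\mathbb Z^d_{\ge0}$ let $(\mathcal{CM}_r)^\Gamma_v$ be the locally closed subvariety of those fixed points for which this representation is isomorphic to $\bigoplus_kR_k^{\oplus v_k}$. *Statement.* Let $v^0=(\dim R_0,\dots,\dim R_{d-1})$ and $w^0=(1,0,\dots,0)$. For every $\tau\in\mathbb C\setminus\{0\}$, every integer $n\ge0$ and every $\zeta_{\mathbb R}\in\mathbb R^d$, the variety $(\mathcal{CM}_{nN})^\Gamma_{nv^0}$ is isomorphic, as a complex algebraic variety, to the quiver variety $\mathfrak M^\Gamma_\zeta(nv^0,w^0)$ with $\zeta_{\mathbb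 C}=(\tau,\dots,\tau)$ and real parameter $\zeta_{\mathbb R}$. -/

import Mathlib

open scoped MatrixGroups Topology

noncomputable section

/-! ### Spaces with regular functions (classical complex varieties) -/

/-- A set with a topology and a notion of regular function: `regular U f` says that `U` is open and
that the restriction of `f` to `U` is a regular function (the values of `f` outside `U` are
irrelevant). Classical complex algebraic varieties, with their Zariski topology and their sheaf of
regular functions, are spaces of this kind. -/
structure SpaceWithFunctions (M : Type) where
  top : TopologicalSpace M
  regular : Set M → (M → ℂ) → Prop

/-- Isomorphism of spaces with functions: a homeomorphism which identifies the regular functions.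
Between algebraic varieties this is an isomorphism of algebraic varieties. -/
def SpaceWithFunctions.Isomorphic {M N : Type}
    (A : SpaceWithFunctions M) (B : SpaceWithFunctions N) : Prop :=
  ∃ e : M ≃ N,
    (∀ U : Set M, IsOpen[A.top] U ↔ IsOpen[B.top] (e '' U)) ∧
    ∀ (U : Set M) (f : M → ℂ), A.regular U f ↔ B.regular (e '' U) (f ∘ e.symm)

/-- The structure induced on a subset `Y` (a subvariety with its reduced structure): the subspace
topology, and the functions which are locally restrictions of regular functions. -/
def SpaceWithFunctions.restrict {M : Type} (A : SpaceWithFunctions M) (Y : Set M) :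
    SpaceWithFunctions Y where
  top := TopologicalSpace.induced Subtype.val A.top
  regular U f :=
    IsOpen[TopologicalSpace.induced Subtype.val A.top] U ∧
    ∀ y ∈ U, ∃ (O : Set M) (F : M → ℂ), y.1 ∈ O ∧ A.regular O F ∧
      ∀ z ∈ U, z.1 ∈ O → f z = F z.1

/-- The algebra of polynomial functions on a complex vector space. -/
def polynomialFunctionAlgebra (E : Type) [AddCommGroup E] [Module ℂ E] : Subalgebra ℂ (E → ℂ) :=
  Algebra.adjoin ℂ {f | ∃ φ : Module.Dual ℂ E, f = fun x => φ x}

/-- The Zariski topology of a complex vector space. -/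
abbrev zariskiTopology (E : Type) [AddCommGroup E] [Module ℂ E] : TopologicalSpace E :=
  TopologicalSpace.generateFrom {U | ∃ P ∈ polynomialFunctionAlgebra E, U = {x | P x ≠ 0}}

/-- The quotient structure for a map `π` from a subset `S` of a complex vector space:
`U` is open iff `π⁻¹(U)` is Zariski open in `S`, and `f` is regular on the open set `U`
iff `f ∘ π` is a regular function on `π⁻¹(U)`, i.e. locally a quotient of two polynomials. -/
def SpaceWithFunctions.ofQuotient {E : Type} [AddCommGroup E] [Module ℂ E] {M : Type}
    (S : Set E) (π : S → M) : SpaceWithFunctions M where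
  top := TopologicalSpace.coinduced π
    (TopologicalSpace.induced Subtype.val (zariskiTopology E))
  regular U f :=
    IsOpen[TopologicalSpace.coinduced π
      (TopologicalSpace.induced Subtype.val (zariskiTopology E))] U ∧
    ∀ x : S, π x ∈ U → ∃ P ∈ polynomialFunctionAlgebra E, ∃ Q ∈ polynomialFunctionAlgebra E,
      Q x.1 ≠ 0 ∧ ∀ y : S, π y ∈ U → Q y.1 ≠ 0 → f (π y) = P y.1 / Q y.1

/-! ### Quiver varieties of an oriented graph

The graph has vertices `0, …, d - 1`; an orientation of it is given by the numbers `m k l` of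
chosen arrows from `k` to `l`. The set `H` of edges with all orientations consists of these
arrows `a` and of their reverses. The spaces `V_k`, `W_k` are `ℂ^(v k)`, `ℂ^(w k)` with their
standard hermitian inner products. -/

namespace QuiverVariety

variable {d : ℕ}

/-- The vector space `𝐌(v, w)`: a point is a quadruple `(B, B', i, j)`, where for each chosen
arrow `a : k → l` one has `B a : V_k → V_l` and, for the reversed arrow, `B' a : V_l → V_k`, and
where `i k : W_k → V_k`, `j k : V_k → W_k`. -/
abbrev Space (m : Fin d → Fin d → ℕ) (v w : Fin d → ℕ) : Type :=
  (∀ k l, Fin (m k l) → Matrix (Fin (v l)) (Fin (v k)) ℂ) ×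
  (∀ k l, Fin (m k l) → Matrix (Fin (v k)) (Fin (v l)) ℂ) ×
  (∀ k, Matrix (Fin (v k)) (Fin (w k)) ℂ) ×
  (∀ k, Matrix (Fin (w k)) (Fin (v k)) ℂ)

variable {m : Fin d → Fin d → ℕ} {v w : Fin d → ℕ}

/-- The action of `∏ GL(V_k)`. -/
def act (g : ∀ k, GL (Fin (v k)) ℂ) (x : Space m v w) : Space m v w :=
  (fun k l a => (g l).1 * x.1 k l a * (g k)⁻¹.1,
   fun k l a => (g k).1 * x.2.1 k l a * (g l)⁻¹.1,
   fun k => (g k).1 * x.2.2.1 k,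
   fun k => x.2.2.2 k * (g k)⁻¹.1)

/-- The complex moment map `∑_{in(h) = k} ε(h) B_h B_h̄ + i_k j_k`, with `ε = 1` on the chosen
arrows and `ε = -1` on their reverses. -/
def momentC (x : Space m v w) (k : Fin d) : Matrix (Fin (v k)) (Fin (v k)) ℂ :=
  (∑ l, ∑ a : Fin (m l k), x.1 l k a * x.2.1 l k a)
    - (∑ l, ∑ a : Fin (m k l), x.2.1 k l a * x.1 k l a)
    + x.2.2.1 k * x.2.2.2 k

open Matrix in
/-- The real moment map
`(√-1 / 2) (∑_{in(h) = k} (B_h B_h† - B_h̄† B_h̄) + i_k i_k† - j_k† j_k)`. -/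
def momentR (x : Space m v w) (k : Fin d) : Matrix (Fin (v k)) (Fin (v k)) ℂ :=
  (Complex.I / 2) •
    ((∑ l, ∑ a : Fin (m l k), (x.1 l k a * (x.1 l k a)ᴴ - (x.2.1 l k a)ᴴ * x.2.1 l k a))
      + (∑ l, ∑ a : Fin (m k l), (x.2.1 k l a * (x.2.1 k l a)ᴴ - (x.1 k l a)ᴴ * x.1 k l a))
      + x.2.2.1 k * (x.2.2.1 k)ᴴ - (x.2.2.2 k)ᴴ * x.2.2.2 k)

/-- The level set `μ_ℂ = -ζ_ℂ`. -/
def levelC (m : Fin d → Fin d → ℕ) (v w : Fin d → ℕ) (ζC : Fin d → ℂ) : Set (Space m v w) :=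
  {x | ∀ k, momentC x k = -(ζC k • (1 : Matrix (Fin (v k)) (Fin (v k)) ℂ))}

/-- The level set `μ = (μ_ℝ, μ_ℂ) = -ζ`; a real number `r` is identified with the element
`√-1 r` of the centre of the Lie algebra `𝔲(V_k)`. -/
def level (m : Fin d → Fin d → ℕ) (v w : Fin d → ℕ) (ζC : Fin d → ℂ) (ζR : Fin d → ℝ) :
    Set (Space m v w) :=
  {x | x ∈ levelC m v w ζC ∧
    ∀ k, momentR x k = -((Complex.I * (ζR k : ℂ)) • (1 : Matrix (Fin (v k)) (Fin (v k)) ℂ))}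

/-- Two points of the level set are equivalent if they are in one orbit of `∏ U(V_k)`. -/
def unitarySetoid (m : Fin d → Fin d → ℕ) (v w : Fin d → ℕ) (ζC : Fin d → ℂ)
    (ζR : Fin d → ℝ) : Setoid (level m v w ζC ζR) where
  r x y := ∃ g : ∀ k, GL (Fin (v k)) ℂ,
    (∀ k, (g k).1 ∈ Matrix.unitaryGroup (Fin (v k)) ℂ) ∧ act g x.1 = y.1
  iseqv :=
    { refl := fun x => ⟨fun _ => 1, fun _ => one_mem _, by simp [act]⟩
      symm := by
        rintro x y ⟨g, hg, h⟩
        refine ⟨fun k => (g k)⁻¹, fun k => ?_, ?_⟩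
        · have h1 : (g k).1 * star (g k).1 = 1 := (Matrix.mem_unitaryGroup_iff).1 (hg k)
          have h2 : (g k)⁻¹.1 = star (g k).1 := Units.inv_eq_of_mul_eq_one_right h1
          rw [h2]
          exact Unitary.star_mem (hg k)
        · rw [← h]
          simp [act, Matrix.mul_assoc]
      trans := by
        rintro x y z ⟨g, hg, h⟩ ⟨g', hg', h'⟩
        refine ⟨fun k => g' k * g k, fun k => mul_mem (hg' k) (hg k), ?_⟩
        rw [← h', ← h]
        simp [act, Matrix.mul_assoc] }

end QuiverVariety

open QuiverVariety in
/-- The quiver variety `𝔐_ζ(v, w) = μ⁻¹(-ζ) / ∏ U(V_k)` as a set. -/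
def QuiverVariety {d : ℕ} (m : Fin d → Fin d → ℕ) (v w : Fin d → ℕ)
    (ζC : Fin d → ℂ) (ζR : Fin d → ℝ) : Type :=
  Quotient (unitarySetoid m v w ζC ζR)

namespace QuiverVariety

variable {d : ℕ} (m : Fin d → Fin d → ℕ) (v w : Fin d → ℕ) (ζC : Fin d → ℂ) (ζR : Fin d → ℝ)

/-- The points of `μ_ℂ⁻¹(-ζ_ℂ)` which are semistable with respect to `ζ_ℝ`: those for which the
closure of the orbit under `∏ GL(V_k)` meets the real level set. -/
def semistable : Set (Space m v w) :=
  {x | x ∈ levelC m v w ζC ∧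
    ∃ y : level m v w ζC ζR, y.1 ∈ closure (Set.range fun g => act g x)}

/-- The projection from the semistable locus to the quiver variety: a semistable point goes to
the `∏ U(V_k)`-orbit in which the closure of its `∏ GL(V_k)`-orbit meets the real level set. -/
def proj (x : semistable m v w ζC ζR) : QuiverVariety m v w ζC ζR :=
  Quotient.mk _ x.2.2.choose

/-- The quiver variety as an algebraic variety: the Kähler quotient `μ⁻¹(-ζ) / ∏ U(V_k)` of
`μ_ℂ⁻¹(-ζ_ℂ)` is its quotient in the sense of geometric invariant theory, i.e. it has the
quotient topology and the invariant regular functions of the semistable locus. -/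
def variety : SpaceWithFunctions (QuiverVariety m v w ζC ζR) :=
  SpaceWithFunctions.ofQuotient (semistable m v w ζC ζR) (proj m v w ζC ζR)

end QuiverVariety

/-! ### The McKay graph -/

/-- The representation on `ℂ^n` given by invertible matrices. -/
def matrixRep {G : Type} [Group G] {n : ℕ} (g : G →* GL (Fin n) ℂ) :
    Representation ℂ G (Fin n → ℂ) :=
  (Matrix.toLinAlgEquiv' : Matrix (Fin n) (Fin n) ℂ ≃ₐ[ℂ] _).toAlgHom.toMonoidHom.comp
    ((Units.coeHom _).comp g)

/-- The tautological representation `L` of a subgroup of `SL(2, ℂ)`. -/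
def tautologicalRep (Γ : Subgroup SL(2, ℂ)) : Representation ℂ Γ (Fin 2 → ℂ) :=
  matrixRep (Matrix.SpecialLinearGroup.toGL.comp Γ.subtype)

/-- A complete list `R_0, …, R_{d-1}` of the irreducible complex representations of a finite
group, each isomorphism class occurring exactly once, starting with the trivial one. -/
structure IrrepList (G : Type) [Group G] (d : ℕ) [NeZero d] where
  /-- `deg k = dim R_k` -/
  deg : Fin d → ℕ
  rep : ∀ k, Representation ℂ G (Fin (deg k) → ℂ)
  irreducible : ∀ k, (rep k).IsIrreducible
  trivial_zero : Nonempty ((rep 0).Equiv (Representation.trivial ℂ G ℂ))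
  pairwise : ∀ k l, Nonempty ((rep k).Equiv (rep l)) → k = l
  complete : ∀ (r : ℕ) (ρ : Representation ℂ G (Fin r → ℂ)), ρ.IsIrreducible →
    ∃ k, Nonempty (ρ.Equiv (rep k))

/-- `m` is an orientation of the McKay graph of `Γ` (the affine Dynkin graph of `Γ`): the number
of all oriented edges from `k` to `l` (chosen arrows from `k` to `l` and reverses of chosen arrows
from `l` to `k`) is the multiplicity `a_{k,l}` of `R_l` in `R_k ⊗ L`. -/
def IsMcKayOrientation {Γ : Subgroup SL(2, ℂ)} {d : ℕ} [NeZero d] (R : IrrepList Γ d)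
    (m : Fin d → Fin d → ℕ) : Prop :=
  ∀ k l, m k l + m l k = Module.finrank ℂ
    (Representation.IntertwiningMap ((R.rep k).tprod (tautologicalRep Γ)) (R.rep l))

/-- The dimension vector `w^0 = (1, 0, …, 0)`. -/
def framingZero (d : ℕ) [NeZero d] : Fin d → ℕ := Pi.single 0 1

/-- The parameter of the graph which corresponds to the central element of the group algebra of
`Γ` acting on `R_k` as multiplication by `ζ k`, namely its trace on `R_k`. Indeed, the
endomorphism `[B, B] + ij` of `V = ⨁ V_k ⊗ R_k` acts on `V_k ⊗ R_k` as `(dim R_k)⁻¹` times the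
`k`-th component of the moment map of the graph, so that `[B, B] + ij = -ζ` means that the latter
is `-(dim R_k) ζ k`. -/
def graphParameter {K : Type} [Semiring K] {d : ℕ} (deg : Fin d → ℕ) (ζ : Fin d → K) : Fin d → K :=
  fun k => (deg k : K) * ζ k

/-- The quiver variety `𝔐^Γ_ζ(v, w)` for the affine Dynkin graph of `Γ`, with `ζ_ℂ` and `ζ_ℝ`
central elements of the complex and real group algebras of `Γ`, acting on `R_k` as multiplication
by `ζC k` and `ζR k`. -/
def mckayQuiverVariety {Γ : Subgroup SL(2, ℂ)} {d : ℕ} [NeZero d] (R : IrrepList Γ d)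
    (m : Fin d → Fin d → ℕ) (v w : Fin d → ℕ) (ζC : Fin d → ℂ) (ζR : Fin d → ℝ) :
    SpaceWithFunctions
      (QuiverVariety m v w (graphParameter R.deg ζC) (graphParameter R.deg ζR)) :=
  QuiverVariety.variety m v w (graphParameter R.deg ζC) (graphParameter R.deg ζR)

/-! ### Calogero–Moser spaces -/

namespace CalogeroMoser

/-- Quadruples `(B_1, B_2, i, j)` with `B_1, B_2 : ℂ^r → ℂ^r`, `i : ℂ → ℂ^r`, `j : ℂ^r → ℂ`. -/
abbrev Space (r : ℕ) : Type :=
  Matrix (Fin r) (Fin r) ℂ × Matrix (Fin r) (Fin r) ℂ ×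
  Matrix (Fin r) (Fin 1) ℂ × Matrix (Fin 1) (Fin r) ℂ

/-- The action of `GL_r`. -/
def act {r : ℕ} (g : GL (Fin r) ℂ) (x : Space r) : Space r :=
  (g.1 * x.1 * g⁻¹.1, g.1 * x.2.1 * g⁻¹.1, g.1 * x.2.2.1, x.2.2.2 * g⁻¹.1)

/-- The quadruples with `[B_1, B_2] + ij = -τ`. -/
def level (r : ℕ) (τ : ℂ) : Set (Space r) :=
  {x | x.1 * x.2.1 - x.2.1 * x.1 + x.2.2.1 * x.2.2.2
    = -(τ • (1 : Matrix (Fin r) (Fin r) ℂ))}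

/-- Two quadruples are equivalent if they are in one orbit of `GL_r`. -/
def orbitSetoid (r : ℕ) (τ : ℂ) : Setoid (level r τ) where
  r x y := ∃ g : GL (Fin r) ℂ, act g x.1 = y.1
  iseqv :=
    { refl := fun x => ⟨1, by simp [act]⟩
      symm := by
        rintro x y ⟨g, h⟩
        refine ⟨g⁻¹, ?_⟩
        rw [← h]
        simp [act, Matrix.mul_assoc]
      trans := by
        rintro x y z ⟨g, h⟩ ⟨g', h'⟩
        refine ⟨g' * g, ?_⟩
        rw [← h', ← h]
        simp [act, Matrix.mul_assoc] }

end CalogeroMoser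

open CalogeroMoser in
/-- The Calogero–Moser space `CM_r = {[B_1, B_2] + ij = -τ} / GL_r` as a set. -/
def CalogeroMoser (r : ℕ) (τ : ℂ) : Type := Quotient (orbitSetoid r τ)

namespace CalogeroMoser

/-- The class of a quadruple in the Calogero–Moser space. -/
def mk {r : ℕ} {τ : ℂ} (x : level r τ) : CalogeroMoser r τ := Quotient.mk _ x

/-- The Calogero–Moser space as an algebraic variety. -/
def variety (r : ℕ) (τ : ℂ) : SpaceWithFunctions (CalogeroMoser r τ) :=
  SpaceWithFunctions.ofQuotient (level r τ) mk

/-- The quadruple `(B^γ, i^γ, j^γ)` for `γ ∈ SL(2, ℂ)`. Here `B : ℂ^r ⊗ L → ℂ^r` is the map with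
`B (u ⊗ e_s) = B_s u`, and `B^γ = B ∘ (1 ⊗ γ)`, i.e. `B^γ_s = ∑_t γ_{t s} B_t`; moreover
`i^γ = i` and `j^γ = j`, since the framing `W` is the trivial representation. -/
def twist {r : ℕ} (γ : SL(2, ℂ)) (x : Space r) : Space r :=
  (γ.1 0 0 • x.1 + γ.1 1 0 • x.2.1, γ.1 0 1 • x.1 + γ.1 1 1 • x.2.1, x.2.2.1, x.2.2.2)

theorem twist_mem_level {r : ℕ} {τ : ℂ} (γ : SL(2, ℂ)) {x : Space r} (hx : x ∈ level r τ) :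
    twist γ x ∈ level r τ := by
  have hdet : γ.1 0 0 * γ.1 1 1 - γ.1 0 1 * γ.1 1 0 = 1 := by
    rw [← Matrix.det_fin_two]; exact γ.2
  have key : (twist γ x).1 * (twist γ x).2.1 - (twist γ x).2.1 * (twist γ x).1
      = (γ.1 0 0 * γ.1 1 1 - γ.1 0 1 * γ.1 1 0) • (x.1 * x.2.1 - x.2.1 * x.1) := by
    simp only [twist, add_mul, mul_add, smul_mul_assoc, mul_smul_comm]
    module
  rw [hdet, one_smul] at key
  have hx' : _ = _ := hx
  change (twist γ x).1 * (twist γ x).2.1 - (twist γ x).2.1 * (twist γ x).1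
    + x.2.2.1 * x.2.2.2 = _
  rw [key]
  exact hx'

theorem twist_act {r : ℕ} (γ : SL(2, ℂ)) (g : GL (Fin r) ℂ) (x : Space r) :
    twist γ (act g x) = act g (twist γ x) := by
  simp [twist, act, mul_add, add_mul]

/-- The action of `γ` on the Calogero–Moser space. -/
def gammaAct {r : ℕ} {τ : ℂ} (γ : SL(2, ℂ)) : CalogeroMoser r τ → CalogeroMoser r τ :=
  Quotient.map (fun x => ⟨twist γ x.1, twist_mem_level γ x.2⟩) (by
    rintro x y ⟨g, h⟩
    exact ⟨g, by rw [← twist_act, h]⟩)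

/-- The `Γ`-fixed locus. -/
def fixedLocus (Γ : Subgroup SL(2, ℂ)) (r : ℕ) (τ : ℂ) : Set (CalogeroMoser r τ) :=
  {p | ∀ γ ∈ Γ, gammaAct γ p = p}

/-- The part `(CM_r)^Γ_v` of the `Γ`-fixed locus: the fixed points with a representative
`(B, i, j)` for which the representation `γ ↦ g_γ` of `Γ` on `ℂ^r`, defined by the
equations `g_γ (B, i, j) = (B^γ, i^γ, j^γ)`, has class `v`, that is,
contains `R_k` with multiplicity `v k`. -/
def fixedLocusOfClass {Γ : Subgroup SL(2, ℂ)} {d : ℕ} [NeZero d] (R : IrrepList Γ d)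
    (r : ℕ) (τ : ℂ) (v : Fin d → ℕ) : Set (CalogeroMoser r τ) :=
  {p | p ∈ fixedLocus Γ r τ ∧ ∃ (x : level r τ) (g : Γ →* GL (Fin r) ℂ),
    mk x = p ∧ (∀ γ : Γ, act (g γ) x.1 = twist γ.1 x.1) ∧
    ∀ k, Module.finrank ℂ (Representation.IntertwiningMap (R.rep k) (matrixRep g)) = v k}

end CalogeroMoser

end

noncomputable section

/-! ### Rational functions and the Zariski topology. -/

section RationalFunctions

variable {E E' : Type} [AddCommGroup E] [Module ℂ E] [AddCommGroup E'] [Module ℂ E']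

/-! Both sides parametrise solutions of one quadratic equation, seen with and without the group.
Write `ℂ^r = ⨁ V_k ⊗ R_k` with the standard action of Γ. By Schur's lemma a quadruple `(B_1, B_2, i,
j)` that this action carries to its twists has, as blocks of `(B_1, B_2)`, elements of `Hom_Γ(R_k ⊗
L, R_l)`, a space with one basis vector per oriented edge from `k` to `l`, while `i` and `j` live at
the vertex 0 only. Such quadruples are therefore points of `𝐌(v, w^0)`, through the linear map
`toCM`. The symplectic form on `L` pairs the arrow spaces of opposite directions perfectly; in bases
where reversed edges are dual up to the sign ε (`exists_arrowBasis`), `[B_1, B_2] + ij` acts on `V_k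
⊗ R_k` as the moment map at `k` divided by `dim R_k`. So the two equations agree
(`toCM_mem_level_iff`).

The real parameter drops out because `ζ_ℂ` is generic: a nonzero dimension vector pairs with it to a
positive integer times τ. Hence the squared norm on an orbit grows at least quadratically in the
logarithm of the torus part (`exists_mul_norm_sq_le_normSq`). Orbits in the complex level set are
then closed, and a Kempf–Ness argument finds in each of them exactly one unitary orbit on the real
level, for every `ζ_ℝ`. The quiver variety is thus the set of `∏ GL(V_k)`-orbits in the whole
complex level set (`semistable_eq_levelC`, `proj_eq_proj_iff`).

On the Calogero–Moser side the framing vector is cyclic, by a trace argument on the quotient by the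
span of all words (`span_word_eq_top`), so `GL_r` acts freely. An element that joins two
Γ-equivariant quadruples must then commute with Γ, and so comes from `∏ GL(V_k)`. This gives the
bijection.

For the variety structures, one direction is linear. A local regular inverse needs an equivariant
representative depending rationally on the orbit: normalise by a basis of words, read off `g_γ` as a
polynomial in the normalised point, and average an intertwiner over Γ (`act_average`,
`average_normalize`). `isomorphic_of_rational_sections` turns such local sections into an
isomorphism. -/

theorem dual_mem_polynomialFunctionAlgebra (φ : Module.Dual ℂ E) :
    (fun x => φ x) ∈ polynomialFunctionAlgebra E :=
  Algebra.subset_adjoin ⟨φ, rfl⟩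

theorem isTopologicalBasis_zariski :
    @TopologicalSpace.IsTopologicalBasis E (zariskiTopology E)
      {U | ∃ P ∈ polynomialFunctionAlgebra E, U = {x | P x ≠ 0}} := by
  let _ := zariskiTopology E
  refine ⟨?_, ?_, rfl⟩
  · rintro _ ⟨P, hP, rfl⟩ _ ⟨Q, hQ, rfl⟩ x hx
    refine ⟨{x | (P * Q) x ≠ 0}, ⟨P * Q, mul_mem hP hQ, rfl⟩, ?_, ?_⟩
    · exact mul_ne_zero hx.1 hx.2
    · intro y hy
      exact ⟨left_ne_zero_of_mul (show P y * Q y ≠ 0 from hy),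
        right_ne_zero_of_mul (show P y * Q y ≠ 0 from hy)⟩
  · refine Set.eq_univ_of_forall fun x => ?_
    exact ⟨_, ⟨1, one_mem _, rfl⟩, by simp⟩

theorem isOpen_zariski_ne {P : E → ℂ} (hP : P ∈ polynomialFunctionAlgebra E) :
    IsOpen[zariskiTopology E] {x | P x ≠ 0} :=
  TopologicalSpace.isOpen_generateFrom_of_mem ⟨P, hP, rfl⟩

theorem exists_polynomial_ne_subset {W : Set E} (hW : IsOpen[zariskiTopology E] W) {x : E}
    (hx : x ∈ W) : ∃ P ∈ polynomialFunctionAlgebra E, P x ≠ 0 ∧ ∀ y, P y ≠ 0 → y ∈ W := by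
  let _ := zariskiTopology E
  obtain ⟨_, ⟨P, hP, rfl⟩, hxP, hPW⟩ :=
    (isTopologicalBasis_zariski (E := E)).exists_subset_of_mem_open hx hW
  exact ⟨P, hP, hxP, fun y hy => hPW hy⟩

/-- Functions which are on `D` a quotient of two polynomials whose denominator has no zero
in `D`. -/
def rationalOn (D : Set E) : Subalgebra ℂ (E → ℂ) where
  carrier := {f | ∃ P ∈ polynomialFunctionAlgebra E, ∃ Q ∈ polynomialFunctionAlgebra E,
    ∀ x ∈ D, Q x ≠ 0 ∧ f x = P x / Q x}
  mul_mem' := by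
    rintro f f' ⟨P, hP, Q, hQ, h⟩ ⟨P', hP', Q', hQ', h'⟩
    refine ⟨P * P', mul_mem hP hP', Q * Q', mul_mem hQ hQ', fun x hx => ?_⟩
    refine ⟨mul_ne_zero (h x hx).1 (h' x hx).1, ?_⟩
    simp only [Pi.mul_apply, (h x hx).2, (h' x hx).2]
    exact div_mul_div_comm _ _ _ _
  add_mem' := by
    rintro f f' ⟨P, hP, Q, hQ, h⟩ ⟨P', hP', Q', hQ', h'⟩
    refine ⟨P * Q' + Q * P', add_mem (mul_mem hP hQ') (mul_mem hQ hP'), Q * Q', mul_mem hQ hQ',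
      fun x hx => ?_⟩
    refine ⟨mul_ne_zero (h x hx).1 (h' x hx).1, ?_⟩
    simp only [Pi.mul_apply, Pi.add_apply, (h x hx).2, (h' x hx).2]
    exact div_add_div _ _ (h x hx).1 (h' x hx).1
  algebraMap_mem' := fun c =>
    ⟨algebraMap ℂ _ c, Subalgebra.algebraMap_mem _ c, 1, one_mem _, fun x _ => by simp⟩

theorem polynomialFunctionAlgebra_le_rationalOn (D : Set E) :
    polynomialFunctionAlgebra E ≤ rationalOn D :=
  fun P hP => ⟨P, hP, 1, one_mem _, fun x _ => by simp⟩

theorem rationalOn_mono {D D' : Set E} (h : D ⊆ D') : rationalOn D' ≤ rationalOn D :=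
  fun _ ⟨P, hP, Q, hQ, hf⟩ => ⟨P, hP, Q, hQ, fun x hx => hf x (h hx)⟩

theorem inv_mem_rationalOn {D : Set E} {f : E → ℂ} (hf : f ∈ rationalOn D)
    (h0 : ∀ x ∈ D, f x ≠ 0) : (fun x => (f x)⁻¹) ∈ rationalOn D := by
  obtain ⟨P, hP, Q, hQ, h⟩ := hf
  refine ⟨Q, hQ, P, hP, fun x hx => ⟨fun h1 => h0 x hx ?_, ?_⟩⟩
  · rw [(h x hx).2, h1, zero_div]
  · simp only [(h x hx).2, inv_div]

theorem isOpen_rationalOn_ne {D : Set E} (hD : IsOpen[zariskiTopology E] D) {f : E → ℂ}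
    (hf : f ∈ rationalOn D) : IsOpen[zariskiTopology E] {x | x ∈ D ∧ f x ≠ 0} := by
  obtain ⟨P, hP, Q, hQ, h⟩ := hf
  have : {x | x ∈ D ∧ f x ≠ 0} = D ∩ {x | P x ≠ 0} := by
    ext x
    refine and_congr_right fun hx => not_congr ?_
    rw [(h x hx).2, div_eq_zero_iff, or_iff_left (h x hx).1]
  rw [this]
  exact @IsOpen.inter _ (zariskiTopology E) _ _ hD (isOpen_zariski_ne hP)

/-- Maps whose coordinates are rational functions without poles in `D`. -/
def RationalMapOn (D : Set E) (σ : E → E') : Prop :=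
  ∀ φ : Module.Dual ℂ E', (fun x => φ (σ x)) ∈ rationalOn D

theorem RationalMapOn.comp_polynomial {D : Set E} {σ : E → E'} (hσ : RationalMapOn D σ)
    {P : E' → ℂ} (hP : P ∈ polynomialFunctionAlgebra E') :
    (fun x => P (σ x)) ∈ rationalOn D := by
  refine Algebra.adjoin_induction (p := fun P _ => (fun x => P (σ x)) ∈ rationalOn D)
    ?_ ?_ ?_ ?_ hP
  · rintro _ ⟨φ, rfl⟩
    exact hσ φ
  · exact fun c => Subalgebra.algebraMap_mem _ c
  · exact fun _ _ _ _ h h' => add_mem h h'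
  · exact fun _ _ _ _ h h' => mul_mem h h'

theorem LinearMap.rationalMapOn (Φ : E →ₗ[ℂ] E') (D : Set E) : RationalMapOn D Φ := fun φ =>
  polynomialFunctionAlgebra_le_rationalOn D (dual_mem_polynomialFunctionAlgebra (φ.comp Φ))

theorem LinearMap.comp_polynomial (Φ : E →ₗ[ℂ] E') {P : E' → ℂ}
    (hP : P ∈ polynomialFunctionAlgebra E') :
    (fun x => P (Φ x)) ∈ polynomialFunctionAlgebra E := by
  refine Algebra.adjoin_induction
    (p := fun P _ => (fun x => P (Φ x)) ∈ polynomialFunctionAlgebra E) ?_ ?_ ?_ ?_ hP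
  · rintro _ ⟨φ, rfl⟩
    exact dual_mem_polynomialFunctionAlgebra (φ.comp Φ)
  · exact fun c => Subalgebra.algebraMap_mem _ c
  · exact fun _ _ _ _ h h' => add_mem h h'
  · exact fun _ _ _ _ h h' => mul_mem h h'

theorem RationalMapOn.isOpen_preimage {D : Set E} (hD : IsOpen[zariskiTopology E] D)
    {σ : E → E'} (hσ : RationalMapOn D σ) {W : Set E'} (hW : IsOpen[zariskiTopology E'] W) :
    IsOpen[zariskiTopology E] {x | x ∈ D ∧ σ x ∈ W} := by
  let _ := zariskiTopology E
  refine isOpen_iff_forall_mem_open.2 fun x hx => ?_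
  obtain ⟨P, hP, hxP, hPW⟩ := exists_polynomial_ne_subset hW hx.2
  exact ⟨{y | y ∈ D ∧ P (σ y) ≠ 0}, fun y hy => ⟨hy.1, hPW _ hy.2⟩,
    isOpen_rationalOn_ne hD (hσ.comp_polynomial hP), hx.1, hxP⟩

end RationalFunctions

/-! ### Comparison of two quotients -/

section Comparison

variable {E₁ E₂ : Type} [AddCommGroup E₁] [Module ℂ E₁] [AddCommGroup E₂] [Module ℂ E₂]
  {M₁ M₂ : Type}

theorem isOpen_ofQuotient_iff (S : Set E₁) (π : S → M₁) (U : Set M₁) :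
    IsOpen[(SpaceWithFunctions.ofQuotient S π).top] U ↔
      ∃ W : Set E₁, IsOpen[zariskiTopology E₁] W ∧ ∀ x : S, π x ∈ U ↔ x.1 ∈ W := by
  let _ := zariskiTopology E₁
  refine Iff.trans isOpen_coinduced (Iff.trans isOpen_induced_iff ?_)
  refine exists_congr fun W => and_congr_right fun _ => ?_
  rw [Set.ext_iff]
  exact forall_congr' fun x => ⟨fun h => h.symm, fun h => h.symm⟩

/-- A linear map `Φ` which identifies the quotient `S₂ → M₂` with a subset `Y` of the quotient
`S₁ → M₁` induces an isomorphism of spaces with functions if it has, locally on `M₁`, an inverse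
given by invariant rational functions. -/
theorem isomorphic_of_rational_sections (S₁ : Set E₁) (S₂ : Set E₂) (π₁ : S₁ → M₁) (π₂ : S₂ → M₂)
    (hπ₁ : Function.Surjective π₁) (hπ₂ : Function.Surjective π₂) (Y : Set M₁)
    (Φ : E₂ →ₗ[ℂ] E₁) (hΦ : ∀ y ∈ S₂, Φ y ∈ S₁)
    (hY : ∀ y : S₂, π₁ ⟨Φ y, hΦ y y.2⟩ ∈ Y)
    (hinj : ∀ y y' : S₂, π₁ ⟨Φ y, hΦ y y.2⟩ = π₁ ⟨Φ y', hΦ y' y'.2⟩ ↔ π₂ y = π₂ y')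
    (hsurj : ∀ x : S₁, π₁ x ∈ Y → ∃ y : S₂, π₁ ⟨Φ y, hΦ y y.2⟩ = π₁ x)
    (hloc : ∀ y₀ : S₂, ∃ (D : Set E₁) (σ : E₁ → E₂), IsOpen[zariskiTopology E₁] D ∧ Φ y₀ ∈ D ∧
      RationalMapOn D σ ∧ (∀ x x' : S₁, π₁ x = π₁ x' → x.1 ∈ D → x'.1 ∈ D ∧ σ x = σ x') ∧
      ∀ x : S₁, x.1 ∈ D → π₁ x ∈ Y → ∃ h : σ x ∈ S₂, π₁ ⟨Φ (σ x), hΦ _ h⟩ = π₁ x) :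
    SpaceWithFunctions.Isomorphic ((SpaceWithFunctions.ofQuotient S₁ π₁).restrict Y)
      (SpaceWithFunctions.ofQuotient S₂ π₂) := by
  obtain ⟨e, he⟩ : ∃ e : Y ≃ M₂, ∀ y : S₂, e ⟨π₁ ⟨Φ y, hΦ y y.2⟩, hY y⟩ = π₂ y := by
    -- Representatives are chosen arbitrarily; `hinj` makes the result independent of the choice.
    let r : M₂ → S₂ := Function.surjInv hπ₂
    let F : M₂ → Y := fun p => ⟨π₁ ⟨Φ (r p), hΦ _ (r p).2⟩, hY _⟩
    have hF : ∀ y : S₂, F (π₂ y) = ⟨π₁ ⟨Φ y, hΦ y y.2⟩, hY y⟩ := fun y =>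
      Subtype.ext ((hinj _ _).2 (Function.surjInv_eq hπ₂ (π₂ y)))
    have hbij : Function.Bijective F := by
      constructor
      · intro p q hpq
        obtain ⟨y, rfl⟩ := hπ₂ p
        obtain ⟨y', rfl⟩ := hπ₂ q
        rw [hF, hF] at hpq
        exact (hinj _ _).1 (congrArg Subtype.val hpq)
      · rintro ⟨q, hq⟩
        obtain ⟨x, rfl⟩ := hπ₁ q
        obtain ⟨y, hy⟩ := hsurj x hq
        exact ⟨π₂ y, by rw [hF]; exact Subtype.ext hy⟩
    refine ⟨(Equiv.ofBijective F hbij).symm, fun y => ?_⟩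
    rw [← hF y]
    exact (Equiv.ofBijective F hbij).symm_apply_apply (π₂ y)
  have he' : ∀ (z : Y) (y : S₂), e z = π₂ y ↔ z.1 = π₁ ⟨Φ y, hΦ y y.2⟩ := fun z y => by
    rw [← he y, e.apply_eq_iff_eq]
    exact Subtype.ext_iff
  have hmem : ∀ (U : Set Y) (z : Y), e z ∈ e '' U ↔ z ∈ U := fun U z =>
    e.injective.mem_set_image
  -- a local section at a point `z` of `Y` and its values over `Y`
  have hsec : ∀ (D : Set E₁) (σ : E₁ → E₂),
      (∀ x : S₁, x.1 ∈ D → π₁ x ∈ Y → ∃ h : σ x ∈ S₂, π₁ ⟨Φ (σ x), hΦ _ h⟩ = π₁ x) →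
      ∀ (z : Y) (x : S₁), x.1 ∈ D → π₁ x = z.1 → ∃ h : σ x ∈ S₂, π₂ ⟨σ x, h⟩ = e z := by
    intro D σ hσ z x hx hxz
    obtain ⟨h, h'⟩ := hσ x hx (hxz ▸ z.2)
    exact ⟨h, ((he' z ⟨σ x, h⟩).2 (hxz.symm.trans h'.symm)).symm⟩
  have hopen : ∀ U : Set Y,
      IsOpen[((SpaceWithFunctions.ofQuotient S₁ π₁).restrict Y).top] U ↔
        IsOpen[(SpaceWithFunctions.ofQuotient S₂ π₂).top] (e '' U) := by
    intro U
    constructor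
    · rintro ⟨O, hO, rfl⟩
      obtain ⟨W, hW, hOW⟩ := (isOpen_ofQuotient_iff S₁ π₁ O).1 hO
      refine (isOpen_ofQuotient_iff S₂ π₂ _).2 ⟨{y | y ∈ Set.univ ∧ Φ y ∈ W},
        (Φ.rationalMapOn Set.univ).isOpen_preimage (@isOpen_univ _ (zariskiTopology E₂)) hW,
        fun y => ?_⟩
      rw [← he y, hmem]
      simpa using hOW ⟨Φ y, hΦ y y.2⟩
    · intro hU
      obtain ⟨W, hW, hUW⟩ := (isOpen_ofQuotient_iff S₂ π₂ _).1 hU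
      let _ := (SpaceWithFunctions.ofQuotient S₁ π₁).top
      change @IsOpen Y (TopologicalSpace.induced Subtype.val _) U
      refine isOpen_iff_forall_mem_open.2 fun z hz => ?_
      obtain ⟨y, hy⟩ := hπ₂ (e z)
      obtain ⟨D, σ, hD, hyD, hσ, hinv, hσY⟩ := hloc y
      -- Invariance of `D` and `σ` makes this locus saturated, so it is the full preimage of its
      -- image, which is therefore open in the quotient.
      obtain ⟨O, hO⟩ : ∃ O : Set M₁, ∀ x : S₁, π₁ x ∈ O ↔ x.1 ∈ {x | x ∈ D ∧ σ x ∈ W} := by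
        refine ⟨{p | ∃ x : S₁, π₁ x = p ∧ x.1 ∈ D ∧ σ x ∈ W}, fun x => ⟨?_, fun h => ⟨x, rfl, h⟩⟩⟩
        rintro ⟨x', h, h1, h2⟩
        obtain ⟨h3, h4⟩ := hinv x' x h h1
        exact ⟨h3, h4 ▸ h2⟩
      have hOo : IsOpen O := (isOpen_ofQuotient_iff S₁ π₁ O).2 ⟨_, hσ.isOpen_preimage hD hW, hO⟩
      refine ⟨Subtype.val ⁻¹' O, ?_, isOpen_induced hOo, ?_⟩
      · intro z' hz'
        obtain ⟨x, hx⟩ := hπ₁ z'.1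
        have hx' := (hO x).1 (hx ▸ hz')
        obtain ⟨h, h'⟩ := hsec D σ hσY z' x hx'.1 hx
        have := (hUW ⟨σ x, h⟩).2 hx'.2
        rwa [h', hmem] at this
      · have hzy := (he' z y).1 hy.symm
        change z.1 ∈ O
        rw [hzy]
        refine (hO _).2 ⟨hyD, ?_⟩
        obtain ⟨h, h'⟩ := hsec D σ hσY z ⟨Φ y, hΦ y y.2⟩ hyD hzy.symm
        exact (hUW ⟨_, h⟩).1 (by rw [h', hmem]; exact hz)
  refine ⟨e, hopen, fun U f => ?_⟩
  constructor
  · rintro ⟨hU, hf⟩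
    refine ⟨(hopen U).1 hU, fun y hy => ?_⟩
    rw [← he y, hmem] at hy
    obtain ⟨O, F, hyO, ⟨hOo, hF⟩, hfF⟩ := hf _ hy
    obtain ⟨P, hP, Q, hQ, hQy, hPQ⟩ := hF ⟨Φ y, hΦ y y.2⟩ hyO
    obtain ⟨W, hW, hOW⟩ := (isOpen_ofQuotient_iff S₁ π₁ O).1 hOo
    -- The formula `P / Q` holds only over `O`. Multiplying numerator and denominator by a `T` that
    -- vanishes off `W` confines the new formula to points over `O`.
    obtain ⟨T, hT, hyT, hTW⟩ := exists_polynomial_ne_subset hW ((hOW _).1 hyO)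
    refine ⟨fun y => (P * T) (Φ y), Φ.comp_polynomial (mul_mem hP hT),
      fun y => (Q * T) (Φ y), Φ.comp_polynomial (mul_mem hQ hT), mul_ne_zero hQy hyT,
      fun y' hy' hQ' => ?_⟩
    have hQ1 : Q (Φ y') ≠ 0 := left_ne_zero_of_mul hQ'
    have hT1 : T (Φ y') ≠ 0 := right_ne_zero_of_mul hQ'
    rw [← he y', hmem] at hy'
    have hO' := (hOW ⟨Φ y', hΦ y' y'.2⟩).2 (hTW _ hT1)
    have h1 := hPQ ⟨Φ y', hΦ y' y'.2⟩ hO' hQ1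
    have h2 := hfF _ hy' hO'
    rw [← he y', Function.comp_apply, e.symm_apply_apply, h2, h1]
    exact (mul_div_mul_right _ _ hT1).symm
  · rintro ⟨hU, hf⟩
    refine ⟨(hopen U).2 hU, fun z hz => ?_⟩
    obtain ⟨y, hy⟩ := hπ₂ (e z)
    obtain ⟨D, σ, hD, hyD, hσ, hinv, hσY⟩ := hloc y
    have hzy := (he' z y).1 hy.symm
    obtain ⟨h0, h0'⟩ := hsec D σ hσY z ⟨Φ y, hΦ y y.2⟩ hyD hzy.symm
    obtain ⟨P, hP, Q, hQ, hQy, hPQ⟩ := hf ⟨_, h0⟩ (by rw [h0', hmem]; exact hz)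
    let D' : Set E₁ := {x | x ∈ D ∧ Q (σ x) ≠ 0}
    have hD' : IsOpen[zariskiTopology E₁] D' :=
      isOpen_rationalOn_ne hD (hσ.comp_polynomial hQ)
    have hinv' : ∀ x x' : S₁, π₁ x = π₁ x' → x.1 ∈ D' → x'.1 ∈ D' ∧ σ x = σ x' := by
      intro x x' h hx
      obtain ⟨h1, h2⟩ := hinv x x' h hx.1
      exact ⟨⟨h1, h2 ▸ hx.2⟩, h2⟩
    obtain ⟨O, hO⟩ : ∃ O : Set M₁, ∀ x : S₁, π₁ x ∈ O ↔ x.1 ∈ D' := by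
      refine ⟨{p | ∃ x : S₁, π₁ x = p ∧ x.1 ∈ D'}, fun x => ⟨?_, fun h => ⟨x, rfl, h⟩⟩⟩
      rintro ⟨x', h, h1⟩
      exact (hinv' x' x h h1).1
    let r : M₁ → S₁ := Function.surjInv hπ₁
    -- The pullback of `f` through the section, evaluated at arbitrary representatives; over `D'` it
    -- does not depend on them.
    let F : M₁ → ℂ := fun p => P (σ (r p)) / Q (σ (r p))
    have hF : ∀ x : S₁, x.1 ∈ D' → F (π₁ x) = P (σ x) / Q (σ x) := by
      intro x hx
      have := (hinv' x (r (π₁ x)) (Function.surjInv_eq hπ₁ _).symm hx).2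
      simp only [F, ← this]
    refine ⟨O, F, ?_, ⟨(isOpen_ofQuotient_iff S₁ π₁ O).2 ⟨D', hD', hO⟩, fun x hx => ?_⟩, ?_⟩
    · rw [hzy]
      exact (hO _).2 ⟨hyD, hQy⟩
    · have hσ' : RationalMapOn D' σ := fun φ => rationalOn_mono (fun _ h => h.1) (hσ φ)
      have hr : (fun x => P (σ x) * (Q (σ x))⁻¹) ∈ rationalOn D' :=
        mul_mem (hσ'.comp_polynomial hP)
          (inv_mem_rationalOn (hσ'.comp_polynomial hQ) fun x hx => hx.2)
      obtain ⟨A, hA, B, hB, hAB⟩ := hr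
      refine ⟨A, hA, B, hB, (hAB x ((hO x).1 hx)).1, fun x' hx' _ => ?_⟩
      rw [hF x' ((hO x').1 hx'), ← (hAB x' ((hO x').1 hx')).2, div_eq_mul_inv]
    · intro z' hz' hzO
      obtain ⟨x, hx⟩ := hπ₁ z'.1
      have hxD : x.1 ∈ D' := (hO x).1 (hx ▸ hzO)
      obtain ⟨h, h'⟩ := hsec D σ hσY z' x hxD.1 hx
      have h1 := hPQ ⟨σ x, h⟩ (by rw [h', hmem]; exact hz') hxD.2
      rw [h', Function.comp_apply, e.symm_apply_apply] at h1
      rw [h1, ← hx, hF x hxD]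

end Comparison
end

noncomputable section

/-! ### Unitary matrices -/

section Unitary

open Matrix
open scoped ComplexOrder

/-- Entries of a unitary matrix have norm at most one, so the group is a closed subset of a
polydisc. -/
instance compactSpace_unitaryGroup (n : ℕ) : CompactSpace (unitaryGroup (Fin n) ℂ) := by
  refine isCompact_iff_compactSpace.1 (?_ : IsCompact
    ((unitaryGroup (Fin n) ℂ : Submonoid (Matrix (Fin n) (Fin n) ℂ)) :
      Set (Matrix (Fin n) (Fin n) ℂ)))
  have hc : IsCompact (Set.univ.pi fun _ : Fin n => Set.univ.pi fun _ : Fin n =>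
      Metric.closedBall (0 : ℂ) 1) :=
    isCompact_univ_pi fun _ => isCompact_univ_pi fun _ => isCompact_closedBall _ _
  refine hc.of_isClosed_subset ?_ fun A hA i _ j _ => ?_
  · have : ((unitaryGroup (Fin n) ℂ : Submonoid (Matrix (Fin n) (Fin n) ℂ)) :
        Set (Matrix (Fin n) (Fin n) ℂ)) = {A | A * star A = 1} := by
      ext A
      exact mem_unitaryGroup_iff
    rw [this]
    exact isClosed_eq (by fun_prop) continuous_const
  · simpa using entry_norm_bound_of_unitary hA i j

/-- The invertible diagonal matrix with entries `exp (l p)`. -/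
def expDiagonal {n : ℕ} (l : Fin n → ℝ) : GL (Fin n) ℂ where
  val := diagonal fun p => (Real.exp (l p) : ℂ)
  inv := diagonal fun p => (Real.exp (-l p) : ℂ)
  val_inv := by
    rw [diagonal_mul_diagonal, ← diagonal_one]
    congr 1
    funext p
    rw [← Complex.ofReal_mul, ← Real.exp_add, add_neg_cancel, Real.exp_zero, Complex.ofReal_one]
  inv_val := by
    rw [diagonal_mul_diagonal, ← diagonal_one]
    congr 1
    funext p
    rw [← Complex.ofReal_mul, ← Real.exp_add, neg_add_cancel, Real.exp_zero, Complex.ofReal_one]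

/-- Singular value decomposition. If `U` diagonalises `g† g` with eigenvalues `e p`, then `g U` has
orthogonal columns of lengths `√(e p) = exp (l p)`, and rescaling them gives a unitary matrix. This
lets every question on a `GL`-orbit be reduced to a torus, up to compact factors. -/
theorem exists_eq_unitary_mul_expDiagonal_mul_unitary {n : ℕ} (g : GL (Fin n) ℂ) :
    ∃ (u u' : unitaryGroup (Fin n) ℂ) (l : Fin n → ℝ),
      g = Unitary.toUnits u * expDiagonal l * Unitary.toUnits u' := by
  have hinj : Function.Injective g.1.mulVec := by
    intro x y h
    have := congrArg (fun z => g⁻¹.1.mulVec z) h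
    simpa [mulVec_mulVec] using this
  have hpos : (g.1ᴴ * g.1).PosDef := PosDef.conjTranspose_mul_self _ hinj
  let U := hpos.1.eigenvectorUnitary
  let e := hpos.1.eigenvalues
  have he : ∀ p, 0 < e p := hpos.eigenvalues_pos
  let l : Fin n → ℝ := fun p => Real.log (e p) / 2
  have hl : ∀ p, Real.exp (l p) * Real.exp (l p) = e p := fun p => by
    rw [← Real.exp_add, add_halves, Real.exp_log (he p)]
  have hspec : star U.1 * (g.1ᴴ * g.1) * U.1 = diagonal fun p => (e p : ℂ) := by
    have := hpos.1.conjStarAlgAut_star_eigenvectorUnitary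
    rw [Unitary.conjStarAlgAut_apply] at this
    rw [Unitary.coe_star, star_star] at this
    exact this
  have hUU : U.1 * star U.1 = 1 := mem_unitaryGroup_iff.1 U.2
  have hUU' : star U.1 * U.1 = 1 := mem_unitaryGroup_iff'.1 U.2
  let A : Matrix (Fin n) (Fin n) ℂ := g.1 * U.1 * (expDiagonal l)⁻¹.1
  have hstar : star (expDiagonal l)⁻¹.1 = (expDiagonal l)⁻¹.1 := by
    change (diagonal fun p => (Real.exp (-l p) : ℂ))ᴴ = diagonal fun p => (Real.exp (-l p) : ℂ)
    rw [diagonal_conjTranspose]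
    congr 1
    funext p
    exact Complex.conj_ofReal _
  have hA : A ∈ unitaryGroup (Fin n) ℂ := by
    rw [mem_unitaryGroup_iff']
    have h1 : star A * A = (expDiagonal l)⁻¹.1 * (star U.1 * (g.1ᴴ * g.1) * U.1) *
        (expDiagonal l)⁻¹.1 := by
      simp only [A, star_mul, hstar, mul_assoc]
      rfl
    have h2 : (diagonal fun p => (e p : ℂ)) = (expDiagonal l).1 * (expDiagonal l).1 := by
      change _ = diagonal (fun p => (Real.exp (l p) : ℂ)) * diagonal fun p => (Real.exp (l p) : ℂ)
      rw [diagonal_mul_diagonal]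
      congr 1
      funext p
      rw [← Complex.ofReal_mul, hl]
    rw [h1, hspec, h2]
    simp
  refine ⟨⟨A, hA⟩, star U, l, Units.ext ?_⟩
  change g.1 = A * (expDiagonal l).1 * star U.1
  have : A * (expDiagonal l).1 = g.1 * U.1 := by
    simp [A, mul_assoc]
  rw [this, mul_assoc, hUU, mul_one]

theorem norm_det_unitary {n : ℕ} (u : unitaryGroup (Fin n) ℂ) : ‖u.1.det‖ = 1 :=
  CStarRing.norm_of_mem_unitary (det_of_mem_unitary u.2)

theorem norm_det_expDiagonal {n : ℕ} (l : Fin n → ℝ) :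
    ‖(expDiagonal l).1.det‖ = Real.exp (∑ p, l p) := by
  change ‖(diagonal fun p => (Real.exp (l p) : ℂ)).det‖ = _
  rw [det_diagonal, norm_prod, Real.exp_sum]
  exact Finset.prod_congr rfl fun p _ => by simp

theorem sum_norm_sq_eq_trace {a b : ℕ} (A : Matrix (Fin a) (Fin b) ℂ) :
    ∑ p, ∑ q, ‖A p q‖ ^ 2 = (A * Aᴴ).trace.re := by
  simp only [trace, diag, mul_apply, conjTranspose_apply, Complex.re_sum]
  refine Finset.sum_congr rfl fun p _ => Finset.sum_congr rfl fun q _ => ?_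
  rw [← Complex.normSq_eq_norm_sq, RCLike.star_def, Complex.mul_conj, Complex.ofReal_re]

theorem sum_norm_sq_unitary_mul {a b : ℕ} (u : unitaryGroup (Fin a) ℂ)
    (A : Matrix (Fin a) (Fin b) ℂ) :
    ∑ p, ∑ q, ‖(u.1 * A) p q‖ ^ 2 = ∑ p, ∑ q, ‖A p q‖ ^ 2 := by
  rw [sum_norm_sq_eq_trace, sum_norm_sq_eq_trace, conjTranspose_mul, ← Matrix.mul_assoc,
    trace_mul_comm]
  have : u.1ᴴ * u.1 = 1 := mem_unitaryGroup_iff'.1 u.2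
  rw [← Matrix.mul_assoc, ← Matrix.mul_assoc, this, Matrix.one_mul]

theorem sum_norm_sq_mul_unitary {a b : ℕ} (u : unitaryGroup (Fin b) ℂ)
    (A : Matrix (Fin a) (Fin b) ℂ) :
    ∑ p, ∑ q, ‖(A * u.1) p q‖ ^ 2 = ∑ p, ∑ q, ‖A p q‖ ^ 2 := by
  rw [sum_norm_sq_eq_trace, sum_norm_sq_eq_trace, conjTranspose_mul]
  have : u.1 * u.1ᴴ = 1 := mem_unitaryGroup_iff.1 u.2
  rw [Matrix.mul_assoc, ← Matrix.mul_assoc u.1, this, Matrix.one_mul]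

end Unitary

/-! ### Matrix entries of a point of `𝐌(v, w)` -/

namespace QuiverVariety

variable {d : ℕ} {m : Fin d → Fin d → ℕ} {v w : Fin d → ℕ}

theorem act_mul (g h : ∀ k, GL (Fin (v k)) ℂ) (x : Space m v w) :
    act (g * h) x = act g (act h x) := by
  simp [act, Matrix.mul_assoc]

theorem act_one (x : Space m v w) : act 1 x = x := by
  simp [act]

theorem act_inv_act (g : ∀ k, GL (Fin (v k)) ℂ) (x : Space m v w) : act g⁻¹ (act g x) = x := by
  rw [← act_mul, inv_mul_cancel, act_one]

/-- The places of the matrix entries of a point. -/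
abbrev Coord (m : Fin d → Fin d → ℕ) (v w : Fin d → ℕ) : Type :=
  (Σ k l, Fin (m k l) × Fin (v l) × Fin (v k)) ⊕ (Σ k l, Fin (m k l) × Fin (v k) × Fin (v l)) ⊕
  (Σ k, Fin (v k) × Fin (w k)) ⊕ (Σ k, Fin (w k) × Fin (v k))

/-- The basis vectors of `⨁ V_k`, with one further element which stands for all of `⨁ W_k`. -/
abbrev Index (v : Fin d → ℕ) : Type := Option (Σ k, Fin (v k))

/-- The matrix entry at a place. -/
def entry (x : Space m v w) : Coord m v w → ℂ
  | .inl ⟨k, l, a, p, q⟩ => x.1 k l a p q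
  | .inr (.inl ⟨k, l, a, p, q⟩) => x.2.1 k l a p q
  | .inr (.inr (.inl ⟨k, p, f⟩)) => x.2.2.1 k p f
  | .inr (.inr (.inr ⟨k, f, p⟩)) => x.2.2.2 k f p

/-- The row index of a place. -/
def head : Coord m v w → Index v
  | .inl ⟨_, l, _, p, _⟩ => some ⟨l, p⟩
  | .inr (.inl ⟨k, _, _, p, _⟩) => some ⟨k, p⟩
  | .inr (.inr (.inl ⟨k, p, _⟩)) => some ⟨k, p⟩
  | .inr (.inr (.inr _)) => none

/-- The column index of a place. -/
def tail : Coord m v w → Index v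
  | .inl ⟨k, _, _, _, q⟩ => some ⟨k, q⟩
  | .inr (.inl ⟨_, l, _, _, q⟩) => some ⟨l, q⟩
  | .inr (.inr (.inl _)) => none
  | .inr (.inr (.inr ⟨k, _, p⟩)) => some ⟨k, p⟩

theorem ext_entry {x y : Space m v w} (h : ∀ c, entry x c = entry y c) : x = y := by
  refine Prod.ext ?_ (Prod.ext ?_ (Prod.ext ?_ ?_))
  · funext k l a
    ext p q
    exact h (.inl ⟨k, l, a, p, q⟩)
  · funext k l a
    ext p q
    exact h (.inr (.inl ⟨k, l, a, p, q⟩))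
  · funext k
    ext p f
    exact h (.inr (.inr (.inl ⟨k, p, f⟩)))
  · funext k
    ext f p
    exact h (.inr (.inr (.inr ⟨k, f, p⟩)))

/-- Weights of the basis vectors; the framing has weight zero. -/
def weight (l : ∀ k, Fin (v k) → ℝ) : Index v → ℝ
  | none => 0
  | some ⟨k, p⟩ => l k p

/-- The difference of the weights of the row and the column of a place. -/
def slope (l : ∀ k, Fin (v k) → ℝ) (c : Coord m v w) : ℝ := weight l (head c) - weight l (tail c)

theorem slope_smul (s : ℝ) (l : ∀ k, Fin (v k) → ℝ) (c : Coord m v w) :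
    slope (s • l) c = s * slope l c := by
  have h : ∀ i, weight (s • l) i = s * weight l i := by
    rintro (_ | ⟨k, p⟩)
    · exact (mul_zero s).symm
    · rfl
  rw [slope, slope, h, h, mul_sub]

theorem continuous_weight (i : Index v) :
    Continuous fun l : ∀ k, Fin (v k) → ℝ => weight l i := by
  rcases i with _ | ⟨k, p⟩
  · exact continuous_const
  · exact (continuous_apply p).comp (continuous_apply k)

theorem continuous_slope (c : Coord m v w) :
    Continuous fun l : ∀ k, Fin (v k) → ℝ => slope l c :=
  (continuous_weight _).sub (continuous_weight _)

/-- The positive diagonal element of `∏ GL(V_k)` with logarithm `l`. -/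
def torus (l : ∀ k, Fin (v k) → ℝ) : ∀ k, GL (Fin (v k)) ℂ := fun k => expDiagonal (l k)

/-- The elements of `∏ U(V_k)`. -/
abbrev UnitaryFamily (v : Fin d → ℕ) : Type := ∀ k, Matrix.unitaryGroup (Fin (v k)) ℂ

/-- The inclusion `∏ U(V_k) → ∏ GL(V_k)`. -/
def toGL (u : UnitaryFamily v) : ∀ k, GL (Fin (v k)) ℂ := fun k => Unitary.toUnits (u k)

theorem toGL_mul (u u' : UnitaryFamily v) : toGL (u * u') = toGL u * toGL u' := by
  funext k
  exact map_mul _ _ _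

theorem toGL_inv (u : UnitaryFamily v) : toGL u⁻¹ = (toGL u)⁻¹ := by
  funext k
  exact map_inv _ _

theorem toGL_val (u : UnitaryFamily v) (k : Fin d) : (toGL u k).1 = (u k).1 := rfl

theorem toGL_inv_val (u : UnitaryFamily v) (k : Fin d) : (toGL u k)⁻¹.1 = star (u k).1 := rfl

theorem exists_eq_toGL_mul_torus_mul_toGL (g : ∀ k, GL (Fin (v k)) ℂ) :
    ∃ (u u' : UnitaryFamily v) (l : ∀ k, Fin (v k) → ℝ), g = toGL u * torus l * toGL u' := by
  choose u u' l h using fun k => exists_eq_unitary_mul_expDiagonal_mul_unitary (g k)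
  exact ⟨u, u', l, funext h⟩

/-- The matrix entries are weight vectors of the torus, and `slope` is their weight. -/
theorem entry_torus (l : ∀ k, Fin (v k) → ℝ) (x : Space m v w) (c : Coord m v w) :
    entry (act (torus l) x) c = Real.exp (slope l c) * entry x c := by
  have hval : ∀ k, (torus l k).1 = Matrix.diagonal fun p => (Real.exp (l k p) : ℂ) :=
    fun k => rfl
  have hinv : ∀ k, (torus l k)⁻¹.1 = Matrix.diagonal fun p => (Real.exp (-l k p) : ℂ) :=
    fun k => rfl
  rcases c with ⟨k, j, a, p, q⟩ | ⟨k, j, a, p, q⟩ | ⟨k, p, f⟩ | ⟨k, f, p⟩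
  · simp only [entry, act, slope, head, tail, weight, hval, hinv, Matrix.mul_diagonal,
      Matrix.diagonal_mul, sub_eq_add_neg, Real.exp_add, Complex.ofReal_mul]
    ring
  · simp only [entry, act, slope, head, tail, weight, hval, hinv, Matrix.mul_diagonal,
      Matrix.diagonal_mul, sub_eq_add_neg, Real.exp_add, Complex.ofReal_mul]
    ring
  · simp only [entry, act, slope, head, tail, weight, hval, Matrix.diagonal_mul, sub_zero]
  · simp only [entry, act, slope, head, tail, weight, hinv, Matrix.mul_diagonal, zero_sub]
    ring

/-- The square of the hermitian norm. -/
def normSq (x : Space m v w) : ℝ := ∑ c, ‖entry x c‖ ^ 2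

theorem normSq_torus (l : ∀ k, Fin (v k) → ℝ) (x : Space m v w) :
    normSq (act (torus l) x) = ∑ c, Real.exp (2 * slope l c) * ‖entry x c‖ ^ 2 := by
  refine Finset.sum_congr rfl fun c _ => ?_
  rw [entry_torus, norm_mul, mul_pow, Complex.norm_real, Real.norm_eq_abs, Real.abs_exp,
    ← Real.exp_nat_mul]
  norm_num

theorem sum_coord (φ : Coord m v w → ℝ) :
    ∑ c, φ c = (∑ k, ∑ l, ∑ a : Fin (m k l), ∑ p, ∑ q, φ (.inl ⟨k, l, a, p, q⟩)) +
      ((∑ k, ∑ l, ∑ a : Fin (m k l), ∑ p, ∑ q, φ (.inr (.inl ⟨k, l, a, p, q⟩))) +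
      ((∑ k, ∑ p, ∑ f, φ (.inr (.inr (.inl ⟨k, p, f⟩)))) +
      ∑ k, ∑ f, ∑ p, φ (.inr (.inr (.inr ⟨k, f, p⟩))))) := by
  simp only [Fintype.sum_sum_type, Fintype.sum_sigma, Fintype.sum_prod_type]

theorem normSq_toGL (u : UnitaryFamily v) (x : Space m v w) :
    normSq (act (toGL u) x) = normSq x := by
  have hinv : ∀ k, (toGL u k)⁻¹.1 = (u⁻¹ k).1 := fun k => rfl
  simp only [normSq, sum_coord, entry, act, toGL_val, hinv, sum_norm_sq_mul_unitary,
    sum_norm_sq_unitary_mul]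

theorem continuous_entry (c : Coord m v w) : Continuous fun x : Space m v w => entry x c := by
  rcases c with ⟨k, j, a, p, q⟩ | ⟨k, j, a, p, q⟩ | ⟨k, p, f⟩ | ⟨k, f, p⟩ <;>
    simp only [entry] <;> fun_prop

theorem continuous_normSq : Continuous fun x : Space m v w => normSq x :=
  continuous_finsetSum _ fun c _ => (continuous_entry c).norm.pow 2

theorem _root_.Continuous.quiverAct {T : Type} [TopologicalSpace T]
    {f : T → ∀ k, GL (Fin (v k)) ℂ} {F : T → Space m v w} (hf : Continuous f)
    (hF : Continuous F) : Continuous fun t => act (f t) (F t) := by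
  have h1 : ∀ k, Continuous fun t => (f t k).1 :=
    fun k => Units.continuous_val.comp ((continuous_apply k).comp hf)
  have h2 : ∀ k, Continuous fun t => (f t k)⁻¹.1 :=
    fun k => Units.continuous_coe_inv.comp ((continuous_apply k).comp hf)
  unfold act
  fun_prop

theorem continuous_toGL : Continuous (toGL : UnitaryFamily v → _) := by
  refine continuous_pi fun k => Units.continuous_iff.2 ⟨?_, ?_⟩
  · exact continuous_subtype_val.comp (continuous_apply k)
  · exact continuous_star.comp (continuous_subtype_val.comp (continuous_apply k))

theorem continuous_torus : Continuous (torus : (∀ k, Fin (v k) → ℝ) → _) := by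
  refine continuous_pi fun k => Units.continuous_iff.2 ⟨?_, ?_⟩
  · change Continuous fun l : ∀ k, Fin (v k) → ℝ =>
      Matrix.diagonal fun p => (Real.exp (l k p) : ℂ)
    fun_prop
  · change Continuous fun l : ∀ k, Fin (v k) → ℝ =>
      Matrix.diagonal fun p => (Real.exp (-l k p) : ℂ)
    fun_prop

end QuiverVariety
end

noncomputable section

/-! ### Moment maps and weights -/

namespace QuiverVariety

variable {d : ℕ} {m : Fin d → Fin d → ℕ} {v w : Fin d → ℕ}

/-- Summation by parts on the graph: each matrix entry of an arrow is counted once at its head and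
once, negatively, at its tail. It serves both moment maps. -/
theorem sum_mul_incoming_sub_outgoing {K : Type} [CommRing K]
    (φ : ∀ k l, Fin (m k l) → Fin (v l) → Fin (v k) → K) (χ : ∀ k, Fin (v k) → K) :
    ∑ k, ∑ p, χ k p * ((∑ l, ∑ a : Fin (m l k), ∑ q, φ l k a p q) -
        ∑ l, ∑ a : Fin (m k l), ∑ q, φ k l a q p) =
      ∑ k, ∑ l, ∑ a : Fin (m k l), ∑ p, ∑ q, (χ l p - χ k q) * φ k l a p q := by
  have h : ∀ (k l : Fin d) (T : Fin (m k l) → Fin (v l) → Fin (v k) → K),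
      ∑ a, ∑ p, ∑ q, T a p q = ∑ q, ∑ a, ∑ p, T a p q := by
    intro k l T
    rw [Finset.sum_comm (s := Finset.univ (α := Fin (v k)))]
    exact Finset.sum_congr rfl fun a _ => Finset.sum_comm
  simp only [mul_sub, sub_mul, Finset.sum_sub_distrib, Finset.mul_sum]
  congr 1
  · rw [Finset.sum_comm (s := Finset.univ (α := Fin d)) (t := Finset.univ (α := Fin d))]
    refine Finset.sum_congr rfl fun k _ => ?_
    rw [Finset.sum_comm]
    refine Finset.sum_congr rfl fun l _ => ?_
    rw [Finset.sum_comm]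
  · refine Finset.sum_congr rfl fun k _ => ?_
    rw [Finset.sum_comm]
    refine Finset.sum_congr rfl fun l _ => ?_
    rw [h]

open Matrix in
/-- The hermitian matrix whose product with `√-1 / 2` is the real moment map. -/
def hermitianMoment (x : Space m v w) (k : Fin d) : Matrix (Fin (v k)) (Fin (v k)) ℂ :=
  (∑ l, ∑ a : Fin (m l k), (x.1 l k a * (x.1 l k a)ᴴ - (x.2.1 l k a)ᴴ * x.2.1 l k a))
      + (∑ l, ∑ a : Fin (m k l), (x.2.1 k l a * (x.2.1 k l a)ᴴ - (x.1 k l a)ᴴ * x.1 k l a))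
      + x.2.2.1 k * (x.2.2.1 k)ᴴ - (x.2.2.2 k)ᴴ * x.2.2.2 k

theorem mem_level_iff {ζC : Fin d → ℂ} {ζR : Fin d → ℝ} {x : Space m v w} :
    x ∈ level m v w ζC ζR ↔ x ∈ levelC m v w ζC ∧
      ∀ k, hermitianMoment x k = ((-(2 * ζR k) : ℝ) : ℂ) • 1 := by
  refine and_congr_right fun _ => forall_congr' fun k => ?_
  change (Complex.I / 2) • hermitianMoment x k = _ ↔ _
  have hI : Complex.I / 2 ≠ 0 := by simp
  rw [← smul_right_injective _ hI |>.eq_iff (b := ((-(2 * ζR k) : ℝ) : ℂ) • 1)]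
  rw [smul_smul, ← neg_smul]
  have : Complex.I / 2 * ((-(2 * ζR k) : ℝ) : ℂ) = -(Complex.I * (ζR k : ℂ)) := by
    push_cast
    ring
  rw [this]

theorem hermitianMoment_apply_re (x : Space m v w) (k : Fin d) (p : Fin (v k)) :
    (hermitianMoment x k p p).re =
      (∑ l, ∑ a : Fin (m l k), ∑ q, (‖x.1 l k a p q‖ ^ 2 - ‖x.2.1 l k a q p‖ ^ 2)) -
      (∑ l, ∑ a : Fin (m k l), ∑ q, (‖x.1 k l a q p‖ ^ 2 - ‖x.2.1 k l a p q‖ ^ 2)) +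
      ((∑ f, ‖x.2.2.1 k p f‖ ^ 2) - ∑ f, ‖x.2.2.2 k f p‖ ^ 2) := by
  have h1 : ∀ z : ℂ, (z * star z).re = ‖z‖ ^ 2 := fun z => by
    rw [← Complex.normSq_eq_norm_sq, RCLike.star_def, Complex.mul_conj, Complex.ofReal_re]
  have h2 : ∀ z : ℂ, (star z * z).re = ‖z‖ ^ 2 := fun z => by rw [mul_comm, h1]
  simp only [hermitianMoment, Matrix.sub_apply, Matrix.add_apply, Matrix.sum_apply,
    Matrix.mul_apply, Matrix.conjTranspose_apply, Complex.sub_re, Complex.add_re, Complex.re_sum,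
    h1, h2, Finset.sum_sub_distrib]
  ring

/-- The defining property of a moment map: the left side is half the derivative at `s = 0` of the
squared norm along `torus (s • l)`. Reversed arrows and outgoing framings have the opposite slope,
which produces the minus signs of the hermitian matrix. -/
theorem sum_slope_mul_norm_sq (l : ∀ k, Fin (v k) → ℝ) (x : Space m v w) :
    ∑ c, slope l c * ‖entry x c‖ ^ 2 = ∑ k, ∑ p, l k p * (hermitianMoment x k p p).re := by
  simp only [hermitianMoment_apply_re, mul_add (l _ _), Finset.sum_add_distrib]
  rw [sum_mul_incoming_sub_outgoing
    (φ := fun k l a p q => ‖x.1 k l a p q‖ ^ 2 - ‖x.2.1 k l a q p‖ ^ 2), sum_coord]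
  have hB : ∑ k, ∑ j, ∑ a : Fin (m k j), ∑ p, ∑ q,
        slope l (.inr (.inl ⟨k, j, a, p, q⟩) : Coord m v w) *
          ‖entry x (.inr (.inl ⟨k, j, a, p, q⟩))‖ ^ 2 =
      -∑ k, ∑ j, ∑ a : Fin (m k j), ∑ p, ∑ q, (l j p - l k q) * ‖x.2.1 k j a q p‖ ^ 2 := by
    simp only [← Finset.sum_neg_distrib]
    refine Finset.sum_congr rfl fun k _ => Finset.sum_congr rfl fun j _ =>
      Finset.sum_congr rfl fun a _ => ?_
    rw [Finset.sum_comm]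
    refine Finset.sum_congr rfl fun q _ => Finset.sum_congr rfl fun p _ => ?_
    simp only [slope, head, tail, weight, entry]
    ring
  have hD : ∑ k, ∑ f, ∑ p, slope l (.inr (.inr (.inr ⟨k, f, p⟩)) : Coord m v w) *
        ‖entry x (.inr (.inr (.inr ⟨k, f, p⟩)))‖ ^ 2 =
      -∑ k, ∑ p, l k p * ∑ f, ‖x.2.2.2 k f p‖ ^ 2 := by
    simp only [← Finset.sum_neg_distrib]
    refine Finset.sum_congr rfl fun k _ => ?_
    rw [Finset.sum_comm]
    refine Finset.sum_congr rfl fun p _ => ?_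
    simp only [slope, head, tail, weight, entry, zero_sub, neg_mul, Finset.sum_neg_distrib,
      Finset.mul_sum]
  rw [hB, hD]
  simp only [slope, head, tail, weight, entry, sub_zero, mul_sub, Finset.sum_sub_distrib,
    Finset.mul_sum]
  ring

/-- The complex counterpart. An arrow contributes only through products of an entry with the
opposite entry of its reverse, weighted by the jump of `χ`; this is what makes the vanishing
argument below work. -/
theorem sum_mul_momentC (χ : ∀ k, Fin (v k) → ℂ) (x : Space m v w) :
    ∑ k, ∑ p, χ k p * momentC x k p p =
      (∑ k, ∑ l, ∑ a : Fin (m k l), ∑ p, ∑ q,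
        (χ l p - χ k q) * (x.1 k l a p q * x.2.1 k l a q p)) +
      ∑ k, ∑ p, χ k p * ∑ f, x.2.2.1 k p f * x.2.2.2 k f p := by
  rw [← sum_mul_incoming_sub_outgoing
    (φ := fun k l a p q => x.1 k l a p q * x.2.1 k l a q p), ← Finset.sum_add_distrib]
  refine Finset.sum_congr rfl fun k _ => ?_
  rw [← Finset.sum_add_distrib]
  refine Finset.sum_congr rfl fun p _ => ?_
  rw [← mul_add]
  simp only [momentC, Matrix.sub_apply, Matrix.add_apply, Matrix.sum_apply, Matrix.mul_apply,
    mul_comm (x.1 _ _ _ _ _)]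

end QuiverVariety
end

noncomputable section

/-! ### The Kempf–Ness theorem for generic complex parameters -/

namespace QuiverVariety

variable {d : ℕ} {m : Fin d → Fin d → ℕ} {v w : Fin d → ℕ}

theorem conj_mul_conj {a b c e : ℕ} {Q' Q : Matrix (Fin c) (Fin c) ℂ} (hQ : Q' * Q = 1)
    (P : Matrix (Fin a) (Fin b) ℂ) (X : Matrix (Fin b) (Fin c) ℂ) (Y : Matrix (Fin c) (Fin b) ℂ)
    (R : Matrix (Fin b) (Fin e) ℂ) : P * X * Q' * (Q * Y * R) = P * (X * Y) * R := by
  rw [Matrix.mul_assoc Q, Matrix.mul_assoc (P * X), ← Matrix.mul_assoc Q', hQ, Matrix.one_mul,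
    ← Matrix.mul_assoc, Matrix.mul_assoc P]

theorem momentC_act (g : ∀ k, GL (Fin (v k)) ℂ) (x : Space m v w) (k : Fin d) :
    momentC (act g x) k = (g k).1 * momentC x k * (g k)⁻¹.1 := by
  have h : ∀ j, (g j)⁻¹.1 * (g j).1 = 1 := fun j => (g j).inv_mul
  have h0 : (g k).1 * x.2.2.1 k * (x.2.2.2 k * (g k)⁻¹.1) =
      (g k).1 * (x.2.2.1 k * x.2.2.2 k) * (g k)⁻¹.1 := by
    simp only [Matrix.mul_assoc]
  simp only [momentC, act, conj_mul_conj (h _), h0, Matrix.mul_add, Matrix.mul_sub, Matrix.add_mul,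
    Matrix.sub_mul, Matrix.mul_sum, Matrix.sum_mul]

theorem act_mem_levelC {ζC : Fin d → ℂ} (g : ∀ k, GL (Fin (v k)) ℂ) {x : Space m v w}
    (hx : x ∈ levelC m v w ζC) : act g x ∈ levelC m v w ζC := by
  intro k
  rw [momentC_act, hx k, Matrix.mul_neg, Matrix.neg_mul, Matrix.mul_smul, Matrix.mul_one,
    Matrix.smul_mul, Units.mul_inv]

theorem hermitianMoment_toGL (u : UnitaryFamily v) (x : Space m v w) (k : Fin d) :
    hermitianMoment (act (toGL u) x) k = (u k).1 * hermitianMoment x k * star (u k).1 := by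
  have h : ∀ j, star (u j).1 * (u j).1 = 1 := fun j => Matrix.mem_unitaryGroup_iff'.1 (u j).2
  have hs : ∀ j, (u j).1.conjTranspose = star (u j).1 := fun j => rfl
  have hs' : ∀ j, (star (u j).1).conjTranspose = (u j).1 := fun j => star_star (u j).1
  have h1 : ∀ {k l : Fin d} (X : Matrix (Fin (v k)) (Fin (v l)) ℂ),
      (u k).1 * X * star (u l).1 * ((u k).1 * X * star (u l).1).conjTranspose =
        (u k).1 * (X * X.conjTranspose) * star (u k).1 := fun {k l} X => by
    rw [Matrix.conjTranspose_mul, Matrix.conjTranspose_mul, hs, hs', ← Matrix.mul_assoc (u l).1,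
      conj_mul_conj (h l)]
  have h2 : ∀ {k l : Fin d} (X : Matrix (Fin (v l)) (Fin (v k)) ℂ),
      ((u l).1 * X * star (u k).1).conjTranspose * ((u l).1 * X * star (u k).1) =
        (u k).1 * (X.conjTranspose * X) * star (u k).1 := fun {k l} X => by
    rw [Matrix.conjTranspose_mul, Matrix.conjTranspose_mul, hs, hs', ← Matrix.mul_assoc (u k).1,
      conj_mul_conj (h l)]
  have h3 : (u k).1 * x.2.2.1 k * ((u k).1 * x.2.2.1 k).conjTranspose =
      (u k).1 * (x.2.2.1 k * (x.2.2.1 k).conjTranspose) * star (u k).1 := by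
    rw [Matrix.conjTranspose_mul, hs]
    simp only [Matrix.mul_assoc]
  have h4 : (x.2.2.2 k * star (u k).1).conjTranspose * (x.2.2.2 k * star (u k).1) =
      (u k).1 * ((x.2.2.2 k).conjTranspose * x.2.2.2 k) * star (u k).1 := by
    rw [Matrix.conjTranspose_mul, hs']
    simp only [Matrix.mul_assoc]
  simp only [hermitianMoment, act, toGL_val, toGL_inv_val, h1, h2, h3, h4, Matrix.mul_add,
    Matrix.mul_sub, Matrix.add_mul, Matrix.sub_mul, Matrix.mul_sum, Matrix.sum_mul]

theorem isHermitian_hermitianMoment (x : Space m v w) (k : Fin d) :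
    (hermitianMoment x k).IsHermitian := by
  simp only [Matrix.IsHermitian, hermitianMoment, Matrix.conjTranspose_add,
    Matrix.conjTranspose_sub, Matrix.conjTranspose_sum, Matrix.conjTranspose_mul,
    Matrix.conjTranspose_conjTranspose]

theorem toGL_mem_level {ζC : Fin d → ℂ} {ζR : Fin d → ℝ} (u : UnitaryFamily v) {x : Space m v w}
    (hx : x ∈ level m v w ζC ζR) : act (toGL u) x ∈ level m v w ζC ζR := by
  rw [mem_level_iff] at hx ⊢
  refine ⟨act_mem_levelC _ hx.1, fun k => ?_⟩
  rw [hermitianMoment_toGL, hx.2 k, Matrix.mul_smul, Matrix.mul_one, Matrix.smul_mul,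
    Matrix.mem_unitaryGroup_iff.1 (u k).2]

/-- A complex parameter is generic if no nonzero dimension vector pairs to zero with it. -/
def IsGeneric (ζC : Fin d → ℂ) : Prop :=
  ∀ s : Fin d → ℕ, ∑ k, (s k : ℂ) * ζC k = 0 → s = 0

/-- Irreducibility forced by genericity. If no nonzero entry led out of `S`, pairing the complex
moment map with the indicator of the basis vectors separated by `S` from the framing would kill
every term, since one of two opposite entries always leaves `S`. The dimension vector of these basis
vectors would pair to zero with `ζC`, so none would exist, and `S` would be everything or nothing.
-/
theorem exists_entry_ne_zero {ζC : Fin d → ℂ} (hζ : IsGeneric ζC) {x : Space m v w}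
    (hx : x ∈ levelC m v w ζC) (S : Set (Index v)) {i j : Index v} (hi : i ∈ S) (hj : j ∉ S) :
    ∃ c : Coord m v w, tail c ∈ S ∧ head c ∉ S ∧ entry x c ≠ 0 := by
  classical
  by_contra! hcon
  -- Comparing with the side of `none` treats at once the cases of the framing inside and outside
  -- `S`.
  let T : ∀ k, Finset (Fin (v k)) := fun k =>
    {p | ¬ ((some ⟨k, p⟩ : Index v) ∈ S ↔ (none : Index v) ∈ S)}
  let χ : ∀ k, Fin (v k) → ℂ := fun k p => if p ∈ T k then 1 else 0
  have hχ : ∀ k p, χ k p = 0 ↔ ((some ⟨k, p⟩ : Index v) ∈ S ↔ (none : Index v) ∈ S) := by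
    intro k p
    simp [χ, T]
  have hsum := sum_mul_momentC χ x
  have h1 : ∀ (k l : Fin d) (a : Fin (m k l)) (p : Fin (v l)) (q : Fin (v k)),
      (χ l p - χ k q) * (x.1 k l a p q * x.2.1 k l a q p) = 0 := by
    intro k l a p q
    have e1 := hcon (.inl ⟨k, l, a, p, q⟩)
    have e2 := hcon (.inr (.inl ⟨k, l, a, q, p⟩))
    simp only [tail, head, entry] at e1 e2
    by_cases hp : (some ⟨l, p⟩ : Index v) ∈ S <;> by_cases hq : (some ⟨k, q⟩ : Index v) ∈ S
    · simp [χ, T, hp, hq]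
    · rw [e2 hp hq, mul_zero, mul_zero]
    · rw [e1 hq hp, zero_mul, mul_zero]
    · simp [χ, T, hp, hq]
  have h2 : ∀ (k : Fin d) (p : Fin (v k)), χ k p * ∑ f, x.2.2.1 k p f * x.2.2.2 k f p = 0 := by
    intro k p
    by_cases hp : χ k p = 0
    · rw [hp, zero_mul]
    · rw [Finset.sum_eq_zero, mul_zero]
      intro f _
      have e1 := hcon (.inr (.inr (.inl ⟨k, p, f⟩)))
      have e2 := hcon (.inr (.inr (.inr ⟨k, f, p⟩)))
      simp only [tail, head, entry] at e1 e2
      rw [hχ] at hp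
      by_cases h0 : (none : Index v) ∈ S
      · rw [e1 h0 fun h => hp (iff_of_true h h0), zero_mul]
      · rw [e2 (by tauto) h0, mul_zero]
  have h3 : ∀ k, ∑ p, χ k p * momentC x k p p = -((T k).card * ζC k) := by
    intro k
    rw [hx k]
    simp [χ, Finset.sum_neg_distrib]
  simp only [h1, h2, h3, Finset.sum_const_zero, add_zero, Finset.sum_neg_distrib,
    neg_eq_zero] at hsum
  have hT := hζ _ hsum
  have hall : ∀ i : Index v, i ∈ S ↔ (none : Index v) ∈ S := by
    rintro (_ | ⟨k, p⟩)
    · rfl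
    · by_contra h
      have : p ∈ T k := by simpa [T] using h
      rw [Finset.card_eq_zero.1 (congrFun hT k)] at this
      exact absurd this (Finset.notMem_empty p)
  exact hj ((hall j).2 ((hall i).1 hi))

/-- The norm is bounded below by a continuous function `h`, homogeneous of degree two under positive
scaling of `l`. It is positive for `l ≠ 0` because some nonzero entry has positive slope, and
compactness of the unit sphere times the unitary group gives a uniform constant. -/
theorem exists_mul_norm_sq_le_normSq {ζC : Fin d → ℂ} (hζ : IsGeneric ζC) {x : Space m v w}
    (hx : x ∈ levelC m v w ζC) :
    ∃ ε : ℝ, 0 < ε ∧ ∀ (l : ∀ k, Fin (v k) → ℝ) (u : UnitaryFamily v),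
      ε * ‖l‖ ^ 2 ≤ normSq (act (torus l) (act (toGL u) x)) := by
  classical
  let h : (∀ k, Fin (v k) → ℝ) × UnitaryFamily v → ℝ := fun y =>
    ∑ c, max (slope y.1 c) 0 ^ 2 * ‖entry (act (toGL y.2) x) c‖ ^ 2
  have hcont : Continuous h := by
    refine continuous_finsetSum _ fun c _ => ?_
    refine ((((continuous_slope c).comp continuous_fst).max continuous_const).pow 2).mul
      (Continuous.pow (Continuous.norm ?_) 2)
    exact (continuous_entry c).comp
      ((continuous_toGL.comp continuous_snd).quiverAct continuous_const)
  have hpos : ∀ y : (∀ k, Fin (v k) → ℝ) × UnitaryFamily v, y.1 ≠ 0 → 0 < h y := by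
    rintro ⟨l, u⟩ hl
    obtain ⟨i, hi⟩ := Finite.exists_max (weight l)
    -- The framing has weight 0, so weights that are all equal would all vanish.
    obtain ⟨j, hj⟩ : ∃ j, weight l j < weight l i := by
      by_contra! hcon
      have heq : ∀ j, weight l j = weight l i := fun j => le_antisymm (hi j) (hcon j)
      refine hl (funext fun k => funext fun p => ?_)
      exact (heq (some ⟨k, p⟩)).trans (heq none).symm
    -- Take `S` to be the indices below the maximal weight: an entry leaving `S` ends at the
    -- maximum, so its slope is positive.
    obtain ⟨c, hc, hc', hc0⟩ := exists_entry_ne_zero hζ (act_mem_levelC (toGL u) hx)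
      {j | weight l j < weight l i} hj (lt_irrefl (weight l i))
    refine Finset.sum_pos' (fun c _ => by positivity) ⟨c, Finset.mem_univ c, ?_⟩
    have hs : 0 < slope l c := sub_pos.2 (lt_of_lt_of_le hc (not_lt.1 hc'))
    have : 0 < max (slope l c) 0 := lt_max_of_lt_left hs
    positivity
  have hle : ∀ (l : ∀ k, Fin (v k) → ℝ) (u : UnitaryFamily v),
      h (l, u) ≤ normSq (act (torus l) (act (toGL u) x)) := by
    intro l u
    rw [normSq_torus]
    refine Finset.sum_le_sum fun c _ => mul_le_mul_of_nonneg_right ?_ (by positivity)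
    rcases le_total (slope l c) 0 with h0 | h0
    · rw [max_eq_right h0, zero_pow two_ne_zero]
      exact (Real.exp_pos _).le
    · rw [max_eq_left h0]
      have := Real.quadratic_le_exp_of_nonneg (x := 2 * slope l c) (by linarith)
      nlinarith [sq_nonneg (slope l c)]
  have hhom : ∀ (s : ℝ) (l : ∀ k, Fin (v k) → ℝ) (u : UnitaryFamily v), 0 ≤ s →
      h (s • l, u) = s ^ 2 * h (l, u) := by
    intro s l u hs
    simp only [h, Finset.mul_sum]
    refine Finset.sum_congr rfl fun c _ => ?_
    rw [slope_smul, ← mul_zero s, ← mul_max_of_nonneg _ _ hs, mul_zero]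
    ring
  have hcpt : IsCompact (Metric.sphere (0 : ∀ k, Fin (v k) → ℝ) 1 ×ˢ
      (Set.univ : Set (UnitaryFamily v))) := (isCompact_sphere _ _).prod isCompact_univ
  have hscale : ∀ ε : ℝ, (∀ y ∈ Metric.sphere (0 : ∀ k, Fin (v k) → ℝ) 1 ×ˢ
      (Set.univ : Set (UnitaryFamily v)), ε ≤ h y) → ∀ (l : ∀ k, Fin (v k) → ℝ)
      (u : UnitaryFamily v), ε * ‖l‖ ^ 2 ≤ h (l, u) := by
    intro ε hε l u
    rcases eq_or_ne l 0 with rfl | hl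
    · have : 0 ≤ h (0, u) := Finset.sum_nonneg fun c _ => by positivity
      simpa using this
    · have hl' : ‖l‖ ≠ 0 := norm_ne_zero_iff.2 hl
      have h1 : ‖l‖⁻¹ • l ∈ Metric.sphere (0 : ∀ k, Fin (v k) → ℝ) 1 := by
        rw [mem_sphere_zero_iff_norm, norm_smul, norm_inv, norm_norm, inv_mul_cancel₀ hl']
      have h2 := hε (‖l‖⁻¹ • l, u) ⟨h1, Set.mem_univ _⟩
      rw [hhom _ _ _ (by positivity)] at h2
      calc ε * ‖l‖ ^ 2 ≤ (‖l‖⁻¹ ^ 2 * h (l, u)) * ‖l‖ ^ 2 := by gcongr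
        _ = h (l, u) := by field_simp
  -- When all the spaces `V_k` vanish the sphere is empty and has no minimum; any constant will do.
  rcases (Metric.sphere (0 : ∀ k, Fin (v k) → ℝ) 1 ×ˢ
      (Set.univ : Set (UnitaryFamily v))).eq_empty_or_nonempty with he | hne
  · refine ⟨1, one_pos, fun l u => (hscale 1 (fun y hy => ?_) l u).trans (hle l u)⟩
    rw [he] at hy
    exact absurd hy (Set.notMem_empty y)
  · obtain ⟨y₀, hy₀, hmin⟩ := hcpt.exists_isMinOn hne hcont.continuousOn
    refine ⟨h y₀, hpos y₀ ?_, fun l u => (hscale _ (fun y hy => hmin hy) l u).trans (hle l u)⟩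
    intro h0
    have := hy₀.1
    rw [h0, mem_sphere_zero_iff_norm, norm_zero] at this
    exact zero_ne_one this

/-- By coercivity the part of the orbit of bounded norm lies in the image of a compact set of group
elements, and that image is contained in the orbit. -/
theorem closure_orbit_eq {ζC : Fin d → ℂ} (hζ : IsGeneric ζC) {x : Space m v w}
    (hx : x ∈ levelC m v w ζC) :
    closure (Set.range fun g => act g x) = Set.range fun g => act g x := by
  obtain ⟨ε, hε, hcoer⟩ := exists_mul_norm_sq_le_normSq hζ hx
  refine Set.Subset.antisymm (fun y hy => ?_) subset_closure
  -- The radius comes from `ε ‖l‖² ≤ normSq z < normSq y + 1`; the outer unitary factor leaves the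
  -- norm unchanged and the inner one is covered by uniformity.
  let K : Set (Space m v w) := (fun z : (∀ k, Fin (v k) → ℝ) × UnitaryFamily v × UnitaryFamily v =>
    act (toGL z.2.1) (act (torus z.1) (act (toGL z.2.2) x))) ''
      (Metric.closedBall 0 (Real.sqrt ((normSq y + 1) / ε)) ×ˢ Set.univ)
  have hK : IsClosed K := by
    refine (IsCompact.image ((isCompact_closedBall _ _).prod isCompact_univ) ?_).isClosed
    exact (continuous_toGL.comp continuous_snd.fst).quiverAct
      ((continuous_torus.comp continuous_fst).quiverAct
        ((continuous_toGL.comp continuous_snd.snd).quiverAct continuous_const))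
  have hO : IsOpen {z : Space m v w | normSq z < normSq y + 1} :=
    isOpen_lt continuous_normSq continuous_const
  have hy' : y ∈ closure ({z : Space m v w | normSq z < normSq y + 1} ∩
      Set.range fun g => act g x) := hO.inter_closure ⟨lt_add_one (normSq y), hy⟩
  have hyK : y ∈ K := by
    refine closure_minimal ?_ hK hy'
    rintro _ ⟨hz, g, rfl⟩
    obtain ⟨u, u', l, rfl⟩ := exists_eq_toGL_mul_torus_mul_toGL g
    refine ⟨(l, u, u'), ⟨?_, Set.mem_univ _⟩, by simp only [act_mul]⟩
    replace hz : normSq (act (toGL u * torus l * toGL u') x) < normSq y + 1 := hz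
    rw [act_mul, act_mul, normSq_toGL] at hz
    rw [mem_closedBall_zero_iff]
    refine Real.le_sqrt_of_sq_le ?_
    rw [le_div_iff₀ hε, mul_comm]
    exact (hcoer l u').trans hz.le
  obtain ⟨z, -, rfl⟩ := hyK
  exact ⟨toGL z.2.1 * torus z.1 * toGL z.2.2, by simp only [act_mul]⟩

/-- Convexity of the norm along the torus. After removing unitary factors, both ends of a torus path
have the same moment map, hence the same derivative. The difference of the derivatives is a sum of
nonnegative terms `s (exp (2 s) - 1) ‖entry‖²`, so entries of nonzero slope vanish and the torus
element fixes the point. -/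
theorem exists_unitary_of_mem_level {ζC : Fin d → ℂ} {ζR : Fin d → ℝ} {x : Space m v w}
    (hx : x ∈ level m v w ζC ζR) {g : ∀ k, GL (Fin (v k)) ℂ}
    (hg : act g x ∈ level m v w ζC ζR) : ∃ u : UnitaryFamily v, act (toGL u) x = act g x := by
  obtain ⟨u, u', l, rfl⟩ := exists_eq_toGL_mul_torus_mul_toGL g
  have hx' := toGL_mem_level u' hx
  have hy := toGL_mem_level u⁻¹ hg
  rw [toGL_inv, act_mul, act_mul, act_inv_act] at hy
  set z := act (toGL u') x with hz
  have h1 := sum_slope_mul_norm_sq l z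
  have h2 := sum_slope_mul_norm_sq l (act (torus l) z)
  simp only [(mem_level_iff.1 hx').2] at h1
  simp only [(mem_level_iff.1 hy).2] at h2
  have h3 : ∑ c, slope l c * (Real.exp (2 * slope l c) - 1) * ‖entry z c‖ ^ 2 = 0 := by
    rw [← sub_self (∑ c, slope l c * ‖entry z c‖ ^ 2)]
    nth_rewrite 1 [h1]
    rw [← h2, ← Finset.sum_sub_distrib]
    refine Finset.sum_congr rfl fun c _ => ?_
    rw [entry_torus, norm_mul, mul_pow, Complex.norm_real, Real.norm_eq_abs, Real.abs_exp,
      ← Real.exp_nat_mul]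
    push_cast
    ring
  have h4 : ∀ s : ℝ, s ≠ 0 → 0 < s * (Real.exp (2 * s) - 1) := by
    intro s hs
    rcases lt_or_gt_of_ne hs with h | h
    · exact mul_pos_of_neg_of_neg h (sub_neg.2 (Real.exp_lt_one_iff.2 (by linarith)))
    · exact mul_pos h (sub_pos.2 (Real.one_lt_exp_iff.2 (by linarith)))
  have h5 : ∀ s : ℝ, 0 ≤ s * (Real.exp (2 * s) - 1) := fun s => by
    rcases eq_or_ne s 0 with rfl | h
    · simp
    · exact (h4 s h).le
  have h6 := (Finset.sum_eq_zero_iff_of_nonneg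
    fun c _ => mul_nonneg (h5 (slope l c)) (sq_nonneg _)).1 h3
  have h7 : act (torus l) z = z := by
    refine ext_entry fun c => ?_
    rw [entry_torus]
    rcases eq_or_ne (slope l c) 0 with h | h
    · rw [h, Real.exp_zero, Complex.ofReal_one, one_mul]
    · have := (mul_eq_zero.1 (h6 c (Finset.mem_univ c))).resolve_left (h4 _ h).ne'
      rw [norm_eq_zero.1 (pow_eq_zero_iff two_ne_zero |>.1 this), mul_zero]
  refine ⟨u * u', ?_⟩
  rw [toGL_mul, act_mul, act_mul, act_mul, ← hz, h7]

/-- The pairing of a real parameter with the weights of a torus element. -/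
def pairing (ζR : Fin d → ℝ) (l : ∀ k, Fin (v k) → ℝ) : ℝ := ∑ k, ζR k * ∑ p, l k p

theorem pairing_add (ζR : Fin d → ℝ) (l l' : ∀ k, Fin (v k) → ℝ) :
    pairing ζR (l + l') = pairing ζR l + pairing ζR l' := by
  simp only [pairing, Pi.add_apply, Finset.sum_add_distrib, mul_add]

theorem pairing_smul (ζR : Fin d → ℝ) (s : ℝ) (l : ∀ k, Fin (v k) → ℝ) :
    pairing ζR (s • l) = s * pairing ζR l := by
  simp only [pairing, Pi.smul_apply, smul_eq_mul, ← Finset.mul_sum, mul_left_comm]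

/-- Absolute values of determinants ignore the unitary factors, so at each vertex the sums of the
logarithms add up. This makes the linear correction term well defined on the group. -/
theorem pairing_eq_add (ζR : Fin d → ℝ) {l l₀ l' : ∀ k, Fin (v k) → ℝ}
    {u u₁ u₂ : UnitaryFamily v}
    (h : torus l * toGL u * torus l₀ = toGL u₁ * torus l' * toGL u₂) :
    pairing ζR l' = pairing ζR l + pairing ζR l₀ := by
  rw [← pairing_add]
  refine Finset.sum_congr rfl fun k _ => ?_
  have hk := congrArg (fun g : GL (Fin (v k)) ℂ => ‖g.1.det‖) (congrFun h k)
  simp only [Pi.mul_apply, Units.val_mul, Matrix.det_mul, norm_mul, toGL_val, norm_det_unitary,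
    one_mul, mul_one, torus, norm_det_expDiagonal, ← Real.exp_add, Real.exp_eq_exp] at hk
  rw [← hk]
  simp only [Pi.add_apply, Finset.sum_add_distrib]

theorem exists_abs_pairing_le (ζR : Fin d → ℝ) :
    ∃ C : ℝ, ∀ l : ∀ k, Fin (v k) → ℝ, |pairing ζR l| ≤ C * ‖l‖ := by
  refine ⟨∑ k, |ζR k| * v k, fun l => ?_⟩
  rw [Finset.sum_mul]
  refine (Finset.abs_sum_le_sum_abs _ _).trans (Finset.sum_le_sum fun k _ => ?_)
  rw [abs_mul, mul_assoc]
  refine mul_le_mul_of_nonneg_left ?_ (abs_nonneg _)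
  refine (Finset.abs_sum_le_sum_abs _ _).trans ?_
  refine (Finset.sum_le_card_nsmul _ _ ‖l‖ fun p _ => ?_).trans_eq (by simp)
  exact (norm_le_pi_norm (l k) p).trans (norm_le_pi_norm l k)

theorem continuous_pairing (ζR : Fin d → ℝ) :
    Continuous fun l : ∀ k, Fin (v k) → ℝ => pairing ζR l := by
  unfold pairing
  fun_prop

/-- First-order condition at a minimum. The derivative of the norm is twice the pairing of `l` with
the diagonal of the hermitian matrix, so the factor 4 yields diagonal entries `-2 ζR k` in every
unitary frame. In a frame of eigenvectors they are the eigenvalues, and the matrix is scalar. -/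
theorem hermitianMoment_eq_of_minimal {ζR : Fin d → ℝ} {x : Space m v w}
    (hmin : ∀ (l : ∀ k, Fin (v k) → ℝ) (u : UnitaryFamily v),
      normSq x ≤ normSq (act (torus l) (act (toGL u) x)) + 4 * pairing ζR l) (k : Fin d) :
    hermitianMoment x k = ((-(2 * ζR k) : ℝ) : ℂ) • 1 := by
  have hdiag : ∀ (u : UnitaryFamily v) (k : Fin d) (p : Fin (v k)),
      (hermitianMoment (act (toGL u) x) k p p).re = -(2 * ζR k) := by
    intro u k p
    let y := act (toGL u) x
    have key : ∀ l : ∀ k, Fin (v k) → ℝ, ∑ c, slope l c * ‖entry y c‖ ^ 2 = -(2 * pairing ζR l) := by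
      intro l
      let φ : ℝ → ℝ := fun s =>
        (∑ c, Real.exp (s * (2 * slope l c)) * ‖entry y c‖ ^ 2) + s * (4 * pairing ζR l)
      have hφ : ∀ s, φ s = normSq (act (torus (s • l)) y) + 4 * pairing ζR (s • l) := by
        intro s
        simp only [φ, normSq_torus, slope_smul, pairing_smul, mul_left_comm]
      have h0 : φ 0 = normSq x := by
        have : φ 0 = normSq y := by simp [φ, normSq]
        rw [this, normSq_toGL]
      have hloc : IsLocalMin φ 0 := Filter.Eventually.of_forall fun s => by
        rw [h0, hφ]
        exact hmin (s • l) u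
      have hder : HasDerivAt φ ((∑ c, Real.exp (0 * (2 * slope l c)) * (1 * (2 * slope l c)) *
          ‖entry y c‖ ^ 2) + 1 * (4 * pairing ζR l)) 0 := by
        refine HasDerivAt.add (HasDerivAt.fun_sum fun c _ => ?_) ((hasDerivAt_id 0).mul_const _)
        exact (((hasDerivAt_id (0 : ℝ)).mul_const (2 * slope l c)).exp).mul_const _
      have hz := hloc.hasDerivAt_eq_zero hder
      simp only [zero_mul, Real.exp_zero, one_mul, mul_assoc, ← Finset.mul_sum] at hz
      linarith
    have h1 := key (Pi.single k (Pi.single p 1))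
    rw [sum_slope_mul_norm_sq] at h1
    have h2 : ∀ f : ∀ j, Fin (v j) → ℝ, ∑ j, ∑ q,
        (Pi.single k (Pi.single p (1 : ℝ)) : ∀ j, Fin (v j) → ℝ) j q * f j q = f k p := by
      intro f
      rw [Finset.sum_eq_single k]
      · simp [Pi.single_apply]
      · intro j _ hj
        simp [Pi.single_eq_of_ne hj]
      · simp
    rw [h2 fun j q => (hermitianMoment y j q q).re] at h1
    have h3 : pairing ζR (Pi.single k (Pi.single p (1 : ℝ)) : ∀ j, Fin (v j) → ℝ) = ζR k := by
      rw [← h2 fun j _ => ζR j]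
      simp only [pairing, Finset.mul_sum, mul_comm]
    rw [h3] at h1
    exact h1
  have hH := isHermitian_hermitianMoment x k
  let U := hH.eigenvectorUnitary
  have hU : U.1 * star U.1 = 1 := Matrix.mem_unitaryGroup_iff.1 U.2
  have hspec : star U.1 * hermitianMoment x k * U.1 =
      Matrix.diagonal fun p => (hH.eigenvalues p : ℂ) := by
    have := hH.conjStarAlgAut_star_eigenvectorUnitary
    rw [Unitary.conjStarAlgAut_apply, Unitary.coe_star, star_star] at this
    exact this
  have heig : ∀ p, hH.eigenvalues p = -(2 * ζR k) := by
    intro p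
    -- Only the frame at the vertex `k` has to be rotated.
    have h1 := hdiag (Function.update 1 k (star U)) k p
    rw [hermitianMoment_toGL, Function.update_self, Unitary.coe_star, star_star, hspec,
      Matrix.diagonal_apply_eq, Complex.ofReal_re] at h1
    exact h1
  have h2 : (Matrix.diagonal fun p => (hH.eigenvalues p : ℂ)) =
      ((-(2 * ζR k) : ℝ) : ℂ) • (1 : Matrix (Fin (v k)) (Fin (v k)) ℂ) := by
    simp only [heig]
    exact (Matrix.smul_one_eq_diagonal _).symm
  rw [h2] at hspec
  calc hermitianMoment x k = U.1 * (star U.1 * hermitianMoment x k * U.1) * star U.1 := by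
        simp only [mul_assoc, hU, mul_one]
        rw [← mul_assoc, hU, one_mul]
    _ = _ := by
        rw [hspec, Matrix.mul_smul, Matrix.mul_one, Matrix.smul_mul, hU]

/-- The norm plus four times the pairing with `ζR` grows quadratically against a linear loss, so it
attains its minimum on torus times unitary group; by the decomposition this is a minimum over the
whole orbit. -/
theorem exists_act_mem_level {ζC : Fin d → ℂ} (hζ : IsGeneric ζC) (ζR : Fin d → ℝ)
    {x : Space m v w} (hx : x ∈ levelC m v w ζC) :
    ∃ g : ∀ k, GL (Fin (v k)) ℂ, act g x ∈ level m v w ζC ζR := by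
  obtain ⟨ε, hε, hcoer⟩ := exists_mul_norm_sq_le_normSq hζ hx
  obtain ⟨C, hC⟩ := exists_abs_pairing_le (v := v) ζR
  let f : (∀ k, Fin (v k) → ℝ) × UnitaryFamily v → ℝ := fun y =>
    normSq (act (torus y.1) (act (toGL y.2) x)) + 4 * pairing ζR y.1
  have hcont : Continuous f := by
    refine (continuous_normSq.comp ?_).add
      (continuous_const.mul ((continuous_pairing ζR).comp continuous_fst))
    exact (continuous_torus.comp continuous_fst).quiverAct
      ((continuous_toGL.comp continuous_snd).quiverAct continuous_const)
  have hlow : ∀ y, ε * ‖y.1‖ ^ 2 - 4 * (C * ‖y.1‖) ≤ f y := by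
    intro y
    have h1 := hcoer y.1 y.2
    have h2 := (abs_le.1 (hC y.1)).1
    simp only [f]
    linarith
  -- Beyond `B` the quadratic lower bound already exceeds the value at the identity.
  obtain ⟨B, hB⟩ : ∃ B : ℝ, ∀ t : ℝ, B < t → f (0, 1) ≤ ε * t ^ 2 - 4 * (C * t) := by
    refine ⟨max 1 ((|f (0, 1)| + 4 * |C|) / ε), fun t ht => ?_⟩
    have ht1 : 1 < t := lt_of_le_of_lt (le_max_left _ _) ht
    have ht2 : |f (0, 1)| + 4 * |C| < t * ε :=
      (div_lt_iff₀ hε).1 (lt_of_le_of_lt (le_max_right _ _) ht)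
    have h1 := le_abs_self (f (0, 1))
    have h2 := le_abs_self C
    have h3 := abs_nonneg (f (0, 1))
    nlinarith
  obtain ⟨⟨l₀, u₀⟩, hmin⟩ := hcont.exists_forall_le' (0, 1) (by
    have hK : IsCompact (Metric.closedBall (0 : ∀ k, Fin (v k) → ℝ) B ×ˢ
        (Set.univ : Set (UnitaryFamily v))) := (isCompact_closedBall _ _).prod isCompact_univ
    filter_upwards [hK.compl_mem_cocompact] with y hy
    refine (hB ‖y.1‖ ?_).trans (hlow y)
    by_contra! h
    exact hy ⟨mem_closedBall_zero_iff.2 h, Set.mem_univ _⟩)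
  refine ⟨torus l₀ * toGL u₀, mem_level_iff.2 ⟨act_mem_levelC _ hx, ?_⟩⟩
  refine hermitianMoment_eq_of_minimal fun l u => ?_
  -- Moving away from the minimiser again gives a product of the same shape: `u₁` does not affect
  -- the norm, and the pairing term is additive.
  obtain ⟨u₁, u₂, l', h⟩ := exists_eq_toGL_mul_torus_mul_toGL (torus l * toGL u * torus l₀)
  have h1 : act (torus l) (act (toGL u) (act (torus l₀ * toGL u₀) x)) =
      act (toGL u₁) (act (torus l') (act (toGL (u₂ * u₀)) x)) := by
    rw [toGL_mul, ← act_mul, ← act_mul, ← act_mul, ← act_mul, ← mul_assoc, h]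
    simp only [mul_assoc]
  have h2 : pairing ζR l' = pairing ζR l + pairing ζR l₀ := pairing_eq_add ζR h
  have h3 := hmin (l', u₂ * u₀)
  simp only [f] at h3
  rw [h1, normSq_toGL, act_mul]
  linarith

theorem semistable_eq_levelC {ζC : Fin d → ℂ} (hζ : IsGeneric ζC) (ζR : Fin d → ℝ) :
    semistable m v w ζC ζR = levelC m v w ζC := by
  refine Set.Subset.antisymm (fun x hx => hx.1) fun x hx => ⟨hx, ?_⟩
  obtain ⟨g, hg⟩ := exists_act_mem_level hζ ζR hx
  exact ⟨⟨_, hg⟩, subset_closure ⟨g, rfl⟩⟩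

theorem exists_act_eq_choose {ζC : Fin d → ℂ} (hζ : IsGeneric ζC) {ζR : Fin d → ℝ}
    (x : semistable m v w ζC ζR) : ∃ g, act g x.1 = x.2.2.choose.1 := by
  exact (closure_orbit_eq hζ x.2.1).subset x.2.2.choose_spec

theorem mk_eq_mk_of_act_eq {ζC : Fin d → ℂ} {ζR : Fin d → ℝ} {y z : level m v w ζC ζR}
    {g : ∀ k, GL (Fin (v k)) ℂ} (h : act g y.1 = z.1) :
    (Quotient.mk (unitarySetoid m v w ζC ζR) y) = Quotient.mk _ z := by
  obtain ⟨u, hu⟩ := exists_unitary_of_mem_level y.2 (g := g) (h ▸ z.2)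
  exact Quotient.sound ⟨toGL u, fun k => (u k).2, hu.trans h⟩

/-- Orbits are closed, so the point chosen by `proj` lies in the orbit itself; two points of one
orbit on the real level are unitarily equivalent. -/
theorem proj_eq_proj_iff {ζC : Fin d → ℂ} (hζ : IsGeneric ζC) {ζR : Fin d → ℝ}
    (x y : semistable m v w ζC ζR) :
    proj m v w ζC ζR x = proj m v w ζC ζR y ↔ ∃ g, act g x.1 = y.1 := by
  obtain ⟨g, hg⟩ := exists_act_eq_choose hζ x
  obtain ⟨h, hh⟩ := exists_act_eq_choose hζ y
  constructor
  · intro hxy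
    obtain ⟨u, -, hu⟩ := Quotient.exact hxy
    refine ⟨h⁻¹ * (u * g), ?_⟩
    rw [act_mul, act_mul, hg, hu, ← hh, act_inv_act]
  · rintro ⟨k, hk⟩
    refine mk_eq_mk_of_act_eq (g := h * (k * g⁻¹)) ?_
    rw [act_mul, act_mul, ← hg, act_inv_act, hk, hh]

theorem proj_surjective {ζC : Fin d → ℂ} (hζ : IsGeneric ζC) {ζR : Fin d → ℝ} :
    Function.Surjective (proj m v w ζC ζR) := by
  intro p
  induction p using Quotient.inductionOn with
  | h y =>
    have hy : y.1 ∈ semistable m v w ζC ζR := by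
      rw [semistable_eq_levelC hζ]
      exact y.2.1
    obtain ⟨g, hg⟩ := exists_act_eq_choose hζ ⟨y.1, hy⟩
    exact ⟨⟨y.1, hy⟩, (mk_eq_mk_of_act_eq hg).symm⟩

/-- The pairing is τ times a sum of natural numbers, so all its summands vanish. -/
theorem isGeneric_graphParameter {deg : Fin d → ℕ} (hdeg : ∀ k, 0 < deg k) {τ : ℂ} (hτ : τ ≠ 0) :
    IsGeneric (graphParameter deg fun _ => τ) := by
  intro s hs
  have h1 : ((∑ k, s k * deg k : ℕ) : ℂ) * τ = 0 := by
    rw [← hs]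
    push_cast
    rw [Finset.sum_mul]
    exact Finset.sum_congr rfl fun k _ => mul_assoc _ _ _
  have h2 := Nat.cast_eq_zero.1 ((mul_eq_zero.1 h1).resolve_right hτ)
  funext k
  have h3 := Finset.sum_eq_zero_iff.1 h2 k (Finset.mem_univ k)
  exact (Nat.mul_eq_zero.1 h3).resolve_right (hdeg k).ne'

end QuiverVariety
end

noncomputable section

/-! ### Decomposition of representations of finite groups -/

namespace IrrepList

open Representation

variable {G : Type} [Group G] {d : ℕ} [NeZero d] (R : IrrepList G d)

instance (k : Fin d) : (R.rep k).IsIrreducible := R.irreducible k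

theorem deg_pos (k : Fin d) : 0 < R.deg k := by
  by_contra! h
  have h0 : R.deg k = 0 := Nat.le_zero.1 h
  have : Subsingleton (Fin (R.deg k) → ℂ) := by
    rw [h0]
    infer_instance
  have hsub : Subsingleton (Subrepresentation (R.rep k)) :=
    ⟨fun a b => Subrepresentation.toSubmodule_injective (Subsingleton.elim _ _)⟩
  exact not_subsingleton (Subrepresentation (R.rep k)) hsub

theorem intertwiningMap_eq_zero {k l : Fin d} (h : k ≠ l)
    (f : IntertwiningMap (R.rep k) (R.rep l)) : f = 0 :=
  (IsIrreducible.bijective_or_eq_zero f).resolve_left fun hb =>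
    h (R.pairwise k l ⟨f.ofBijective hb⟩)

theorem exists_eq_smul {k : Fin d} (f : IntertwiningMap (R.rep k) (R.rep k)) :
    ∃ c : ℂ, ∀ u, f u = c • u := by
  obtain ⟨c, rfl⟩ := (IsIrreducible.algebraMap_intertwiningMap_bijective_of_isAlgClosed
    (ρ := R.rep k)).2 f
  exact ⟨c, fun u => rfl⟩

/-! ### Multiplicities and decomposition into irreducibles. -/

variable {V : Type} [AddCommGroup V] [Module ℂ V]

/-- A nonzero subrepresentation of least dimension inside `σ` is irreducible. It is transported to
coordinates because `complete` speaks of representations on `ℂ^r` only. -/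
theorem exists_intertwiningMap_of_ne_bot [FiniteDimensional ℂ V] {ρ : Representation ℂ G V}
    {σ : Subrepresentation ρ} (hσ : σ ≠ ⊥) :
    ∃ k, ∃ f : IntertwiningMap (R.rep k) ρ, f ≠ 0 ∧ ∀ u, f u ∈ σ := by
  obtain ⟨N, ⟨hN, hNσ⟩, hmin⟩ := (measure fun s : Subrepresentation ρ =>
    Module.finrank ℂ s.toSubmodule).wf.has_min {s | s ≠ ⊥ ∧ s ≤ σ} ⟨σ, hσ, le_rfl⟩
  let r := Module.finrank ℂ N.toSubmodule
  let e : N.toSubmodule ≃ₗ[ℂ] (Fin r → ℂ) := (Module.finBasis ℂ N.toSubmodule).equivFun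
  let j : (Fin r → ℂ) →ₗ[ℂ] V := N.toSubmodule.subtype ∘ₗ e.symm.toLinearMap
  have hj : Function.Injective j := N.toSubmodule.subtype_injective.comp e.symm.injective
  let τ : Representation ℂ G (Fin r → ℂ) :=
    { toFun := fun g => e.toLinearMap ∘ₗ N.toRepresentation g ∘ₗ e.symm.toLinearMap
      map_one' := by
        refine LinearMap.ext fun u => ?_
        simp
      map_mul' := fun g h => by
        refine LinearMap.ext fun u => ?_
        simp [Module.End.mul_apply] }
  have hjτ : ∀ g u, j (τ g u) = ρ g (j u) := fun g u => by
    have : j (τ g u) = (N.toRepresentation g (e.symm u) : V) := by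
      simp [j, τ]
    rw [this]
    rfl
  have hirr : τ.IsIrreducible := by
    have hN0 : N.toSubmodule ≠ ⊥ := fun h => hN (Subrepresentation.toSubmodule_injective h)
    refine { exists_pair_ne := ⟨⊥, ⊤, fun h => hN0 ?_⟩, eq_bot_or_eq_top := fun S => ?_ }
    · have h1 : (⊥ : Submodule ℂ (Fin r → ℂ)) = ⊤ := congrArg Subrepresentation.toSubmodule h
      have h2 : Module.finrank ℂ (Fin r → ℂ) = 0 := by
        rw [← finrank_top, ← h1, finrank_bot]
      rw [Module.finrank_fin_fun] at h2
      exact Submodule.finrank_eq_zero.1 h2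
    · let S' : Subrepresentation ρ :=
        { toSubmodule := S.toSubmodule.map j
          apply_mem_toSubmodule := by
            rintro g _ ⟨u, hu, rfl⟩
            exact ⟨τ g u, S.apply_mem_toSubmodule g hu, hjτ g u⟩ }
      have hS'N : S' ≤ N := by
        rintro _ ⟨u, -, rfl⟩
        exact (e.symm u).2
      have hrank : Module.finrank ℂ S'.toSubmodule = Module.finrank ℂ S.toSubmodule :=
        (LinearEquiv.finrank_eq (Submodule.equivMapOfInjective j hj _)).symm
      by_cases h0 : S' = ⊥
      · left
        refine Subrepresentation.toSubmodule_injective ?_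
        refine (Submodule.eq_bot_iff _).2 fun u hu => ?_
        have h1 : j u ∈ S' := ⟨u, hu, rfl⟩
        rw [h0] at h1
        exact hj (((Submodule.mem_bot ℂ).1 h1).trans (map_zero j).symm)
      · right
        refine Subrepresentation.toSubmodule_injective ?_
        have h1 := hmin S' ⟨h0, hS'N.trans hNσ⟩
        refine Submodule.eq_top_of_finrank_eq (le_antisymm (Submodule.finrank_le _) ?_)
        rw [Module.finrank_fin_fun, ← hrank]
        exact not_lt.1 h1
  obtain ⟨k, ⟨φ⟩⟩ := R.complete r τ hirr
  let J : IntertwiningMap τ ρ := LinearMap.intertwiningMap_of_isIntertwiningMap τ ρ j hjτ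
  refine ⟨k, J.comp φ.symm.toIntertwiningMap, fun h => ?_, fun u => ?_⟩
  · obtain ⟨u, hu⟩ : ∃ u : Fin (R.deg k) → ℂ, u ≠ 0 := by
      have : Nonempty (Fin (R.deg k)) := ⟨⟨0, R.deg_pos k⟩⟩
      exact exists_ne 0
    have h1 : j (φ.symm u) = 0 := congrArg (fun f => f u) h
    have h2 : φ.symm u = 0 := hj (h1.trans (map_zero j).symm)
    have h3 : φ (φ.symm u) = u := φ.apply_symm_apply u
    rw [h2, map_zero] at h3
    exact hu h3.symm
  · exact hNσ (e.symm (φ.symm u)).2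

/-- The representation `⨁ R_k^{v k}`. -/
def sumRep (v : Fin d → ℕ) : Representation ℂ G (∀ k, Fin (v k) → Fin (R.deg k) → ℂ) where
  toFun g := LinearMap.pi fun k => LinearMap.pi fun p =>
    R.rep k g ∘ₗ LinearMap.proj p ∘ₗ LinearMap.proj k
  map_one' := by
    refine LinearMap.ext fun f => funext fun k => funext fun p => ?_
    simp
  map_mul' g h := by
    refine LinearMap.ext fun f => funext fun k => funext fun p => ?_
    simp

theorem sumRep_apply (v : Fin d → ℕ) (g : G) (f : ∀ k, Fin (v k) → Fin (R.deg k) → ℂ) (k : Fin d)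
    (p : Fin (v k)) : R.sumRep v g f k p = R.rep k g (f k p) := rfl

/-- The projection of `⨁ R_k^{v k}` to a summand. -/
def sumRepProj (v : Fin d → ℕ) (k : Fin d) (p : Fin (v k)) :
    IntertwiningMap (R.sumRep v) (R.rep k) :=
  LinearMap.intertwiningMap_of_isIntertwiningMap _ _ (LinearMap.proj p ∘ₗ LinearMap.proj k)
    fun _ _ => rfl

/-- Schur's lemma applied to each component. -/
theorem exists_coeff_of_intertwiningMap (v : Fin d → ℕ) {k : Fin d}
    (f : IntertwiningMap (R.rep k) (R.sumRep v)) :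
    ∃ c : Fin (v k) → ℂ, (∀ u p, f u k p = c p • u) ∧ ∀ u, ∀ l ≠ k, f u l = 0 := by
  choose c hc using fun p => R.exists_eq_smul ((R.sumRepProj v k p).comp f)
  refine ⟨c, fun u p => hc p u, fun u l hl => funext fun p => ?_⟩
  have := R.intertwiningMap_eq_zero (Ne.symm hl) ((R.sumRepProj v l p).comp f)
  exact congrArg (fun f => f u) this

/-- The map `⨁ R_k^{v k} → V` given by intertwining maps `R_k → V`. -/
def sumRepLift {v : Fin d → ℕ} {ρ : Representation ℂ G V}
    (φ : ∀ k, Fin (v k) → IntertwiningMap (R.rep k) ρ) : IntertwiningMap (R.sumRep v) ρ :=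
  LinearMap.intertwiningMap_of_isIntertwiningMap _ _
    (∑ k, ∑ p, (φ k p).toLinearMap ∘ₗ LinearMap.proj p ∘ₗ LinearMap.proj k) fun g f => by
      simp [LinearMap.sum_apply, sumRep_apply, IntertwiningMap.isIntertwining]

theorem sumRepLift_apply {v : Fin d → ℕ} {ρ : Representation ℂ G V}
    (φ : ∀ k, Fin (v k) → IntertwiningMap (R.rep k) ρ) (f : ∀ k, Fin (v k) → Fin (R.deg k) → ℂ) :
    R.sumRepLift φ f = ∑ k, ∑ p, φ k p (f k p) := by
  change (∑ k, ∑ p, (φ k p).toLinearMap ∘ₗ LinearMap.proj p ∘ₗ LinearMap.proj k) f = _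
  simp [LinearMap.sum_apply]

theorem sumRepLift_comp {v : Fin d → ℕ} {ρ : Representation ℂ G V}
    (φ : ∀ k, Fin (v k) → IntertwiningMap (R.rep k) ρ) {k : Fin d}
    {f : IntertwiningMap (R.rep k) (R.sumRep v)} {c : Fin (v k) → ℂ}
    (hc : ∀ u p, f u k p = c p • u) (h0 : ∀ u, ∀ l ≠ k, f u l = 0) (u : Fin (R.deg k) → ℂ) :
    R.sumRepLift φ (f u) = (∑ p, c p • φ k p) u := by
  rw [sumRepLift_apply, Finset.sum_eq_single k]
  · simp [hc, IntertwiningMap.sum_apply]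
  · intro l _ hl
    simp [h0 u l hl]
  · simp

/-- A nonzero kernel would contain the image of some `R_k`, embedded in the sum by scalars `c p`;
these would be a linear relation between the maps `φ k p`. -/
theorem sumRepLift_injective {v : Fin d → ℕ} {ρ : Representation ℂ G V}
    (φ : ∀ k, Fin (v k) → IntertwiningMap (R.rep k) ρ) (hφ : ∀ k, LinearIndependent ℂ (φ k)) :
    Function.Injective (R.sumRepLift φ) := by
  have hker : (R.sumRepLift φ).ker = ⊥ := by
    by_contra h
    obtain ⟨k, f, hf, hfker⟩ := R.exists_intertwiningMap_of_ne_bot h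
    obtain ⟨c, hc, h0⟩ := R.exists_coeff_of_intertwiningMap v f
    have h1 : ∑ p, c p • φ k p = 0 := by
      refine IntertwiningMap.ext (LinearMap.ext fun u => ?_)
      rw [IntertwiningMap.toLinearMap_apply, ← R.sumRepLift_comp φ hc h0 u]
      exact hfker u
    have h2 := Fintype.linearIndependent_iff.1 (hφ k) c h1
    refine hf (IntertwiningMap.ext (LinearMap.ext fun u => funext fun l => ?_))
    rcases eq_or_ne l k with rfl | hl
    · funext p
      change f u l p = 0
      rw [hc, h2, zero_smul]
    · exact h0 u l hl
  have : LinearMap.ker (R.sumRepLift φ).toLinearMap = ⊥ :=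
    congrArg Subrepresentation.toSubmodule hker
  exact LinearMap.ker_eq_bot.1 this

/-- Maschke's theorem gives a complement of the range. A nonzero map from some `R_k` into it would
be a combination of the maps `φ k p`, hence have its image in the range as well. -/
theorem sumRepLift_surjective [Finite G] [FiniteDimensional ℂ V] {v : Fin d → ℕ}
    {ρ : Representation ℂ G V} (φ : ∀ k, Fin (v k) → IntertwiningMap (R.rep k) ρ)
    (hφ : ∀ k, ⊤ ≤ Submodule.span ℂ (Set.range (φ k))) :
    Function.Surjective (R.sumRepLift φ) := by
  obtain ⟨σ, hσ⟩ := exists_isCompl (R.sumRepLift φ).range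
  have h0 : σ = ⊥ := by
    by_contra h
    obtain ⟨k, f, hf, hfσ⟩ := R.exists_intertwiningMap_of_ne_bot h
    obtain ⟨c, hc⟩ := (Submodule.mem_span_range_iff_exists_fun ℂ).1 (hφ k (Submodule.mem_top (x := f)))
    refine hf (IntertwiningMap.ext (LinearMap.ext fun u => ?_))
    have h1 : f u ∈ (R.sumRepLift φ).range := by
      refine (IntertwiningMap.mem_range _ _ _ _).2 ⟨Pi.single k fun p => c p • u, ?_⟩
      rw [sumRepLift_apply, Finset.sum_eq_single k, ← hc]
      · simp [IntertwiningMap.sum_apply]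
      · intro l _ hl
        simp [Pi.single_eq_of_ne hl]
      · simp
    have h2 : f u ∈ (R.sumRepLift φ).range ⊓ σ := ⟨h1, hfσ u⟩
    rw [hσ.inf_eq_bot] at h2
    exact h2
  have h1 : (R.sumRepLift φ).range = ⊤ := by
    rw [← hσ.sup_eq_top, h0, sup_bot_eq]
  intro y
  have : y ∈ (R.sumRepLift φ).range := by
    rw [h1]
    exact Submodule.mem_top
  exact (IntertwiningMap.mem_range _ _ _ _).1 this

/-- A representation is the sum of the irreducible ones with the multiplicities given by the
dimensions of the spaces of intertwining maps. -/
theorem exists_sumRep_equiv [Finite G] [FiniteDimensional ℂ V] (ρ : Representation ℂ G V)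
    (v : Fin d → ℕ) (hv : ∀ k, Module.finrank ℂ (IntertwiningMap (R.rep k) ρ) = v k) :
    Nonempty ((R.sumRep v).Equiv ρ) := by
  let b : ∀ k, Module.Basis (Fin (v k)) ℂ (IntertwiningMap (R.rep k) ρ) := fun k =>
    Module.finBasisOfFinrankEq ℂ _ (hv k)
  exact ⟨(R.sumRepLift fun k => b k).ofBijective
    ⟨R.sumRepLift_injective _ fun k => (b k).linearIndependent,
      R.sumRepLift_surjective _ fun k => (b k).span_eq.ge⟩⟩

theorem finrank_intertwiningMap_sumRep (v : Fin d → ℕ) (k : Fin d) :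
    Module.finrank ℂ (IntertwiningMap (R.rep k) (R.sumRep v)) = v k := by
  let F : (Fin (v k) → ℂ) →ₗ[ℂ] IntertwiningMap (R.rep k) (R.sumRep v) :=
    { toFun := fun c => LinearMap.intertwiningMap_of_isIntertwiningMap _ _
        (LinearMap.single ℂ _ k ∘ₗ LinearMap.pi fun p => c p • LinearMap.id) fun g u => by
          refine funext fun l => funext fun p => ?_
          rw [sumRep_apply]
          rcases eq_or_ne l k with rfl | hl
          · simp
          · simp [Pi.single_eq_of_ne hl]
      map_add' := fun c c' => by
        refine IntertwiningMap.ext (LinearMap.ext fun u => ?_)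
        refine Eq.trans (congrArg (LinearMap.single ℂ (fun l => Fin (v l) → Fin (R.deg l) → ℂ) k)
          (funext fun p => add_smul (c p) (c' p) u)) (map_add _ _ _)
      map_smul' := fun a c => by
        refine IntertwiningMap.ext (LinearMap.ext fun u => ?_)
        refine Eq.trans (congrArg (LinearMap.single ℂ (fun l => Fin (v l) → Fin (R.deg l) → ℂ) k)
          (funext fun p => mul_smul a (c p) u))
          ((LinearMap.single ℂ (fun l => Fin (v l) → Fin (R.deg l) → ℂ) k).map_smul a
            fun p => c p • u) }
  have hF : ∀ c u p, F c u k p = c p • u := fun c u p => by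
    change (Pi.single k (fun p => c p • u) : ∀ k, Fin (v k) → Fin (R.deg k) → ℂ) k p = _
    rw [Pi.single_eq_same]
  have hF0 : ∀ c u, ∀ l ≠ k, F c u l = 0 := fun c u l hl => by
    change (Pi.single k (fun p => c p • u) : ∀ k, Fin (v k) → Fin (R.deg k) → ℂ) l = _
    rw [Pi.single_eq_of_ne hl]
  have hbij : Function.Bijective F := by
    constructor
    · intro c c' h
      funext p
      have h1 := hF c (fun _ => 1) p
      rw [h, hF] at h1
      simpa using (congrFun h1 ⟨0, R.deg_pos k⟩).symm
    · intro f
      obtain ⟨c, hc, h0⟩ := R.exists_coeff_of_intertwiningMap v f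
      refine ⟨c, IntertwiningMap.ext (LinearMap.ext fun u => funext fun l => ?_)⟩
      change F c u l = f u l
      rcases eq_or_ne l k with rfl | hl
      · exact funext fun p => (hF c u p).trans (hc u p).symm
      · rw [hF0 c u l hl, h0 u l hl]
  rw [← (LinearEquiv.ofBijective F hbij).finrank_eq, Module.finrank_fin_fun]

/-- The sum of the squares of the dimensions of the irreducible representations. -/
theorem sum_deg_mul_deg [Finite G] : ∑ k, R.deg k * R.deg k = Nat.card G := by
  have := Fintype.ofFinite G
  let ρ : Representation ℂ G (G → ℂ) :=
    { toFun := fun g => LinearMap.funLeft ℂ ℂ fun x => x * g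
      map_one' := by
        refine LinearMap.ext fun f => funext fun x => ?_
        simp [LinearMap.funLeft_apply]
      map_mul' := fun g h => by
        refine LinearMap.ext fun f => funext fun x => ?_
        simp [LinearMap.funLeft_apply, mul_assoc] }
  have hρ : ∀ g f x, ρ g f x = f (x * g) := fun g f x => rfl
  have hfin : ∀ k, Module.finrank ℂ (IntertwiningMap (R.rep k) ρ) = R.deg k := by
    intro k
    -- Frobenius reciprocity: a map into the regular representation is determined by its value at
    -- the unit, which is an arbitrary linear form. So `R_k` occurs `deg k` times.
    let F : IntertwiningMap (R.rep k) ρ →ₗ[ℂ] Module.Dual ℂ (Fin (R.deg k) → ℂ) :=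
      { toFun := fun f => LinearMap.proj 1 ∘ₗ f.toLinearMap
        map_add' := fun _ _ => rfl
        map_smul' := fun _ _ => rfl }
    have hF : ∀ f u, F f u = f u 1 := fun f u => rfl
    have hf : ∀ (f : IntertwiningMap (R.rep k) ρ) u x, f u x = F f (R.rep k x u) := by
      intro f u x
      rw [hF, IntertwiningMap.isIntertwining, hρ, one_mul]
    have hbij : Function.Bijective F := by
      constructor
      · intro f f' h
        refine IntertwiningMap.ext (LinearMap.ext fun u => funext fun x => ?_)
        change f u x = f' u x
        rw [hf, hf, h]
      · intro φ
        refine ⟨LinearMap.intertwiningMap_of_isIntertwiningMap _ _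
          (LinearMap.pi fun x => φ ∘ₗ R.rep k x) fun g u => ?_, ?_⟩
        · refine funext fun x => ?_
          rw [hρ]
          simp
        · refine LinearMap.ext fun u => ?_
          rw [hF]
          change φ (R.rep k 1 u) = φ u
          simp
    rw [(LinearEquiv.ofBijective F hbij).finrank_eq, Subspace.dual_finrank_eq,
      Module.finrank_fin_fun]
  obtain ⟨φ⟩ := R.exists_sumRep_equiv ρ R.deg hfin
  have h := φ.toLinearEquiv.finrank_eq
  simpa [Module.finrank_pi_fintype, Nat.card_eq_fintype_card] using h

end IrrepList
end

noncomputable section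

/-! ### Dual bases and symplectic bases -/

section Bases

variable {A B : Type} [AddCommGroup A] [Module ℂ A] [AddCommGroup B] [Module ℂ B]

/-- The sign of an edge: `1` for chosen arrows, `-1` for their reverses. -/
def edgeSign {a b : ℕ} : Fin a ⊕ Fin b → ℂ := Sum.elim (fun _ => 1) fun _ => -1

theorem edgeSign_swap {a b : ℕ} (h : Fin a ⊕ Fin b) : edgeSign h.swap = -edgeSign h := by
  rcases h with h | h <;> simp [edgeSign]

theorem edgeSign_mul_self {a b : ℕ} (h : Fin a ⊕ Fin b) : edgeSign h * edgeSign h = 1 := by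
  rcases h with h | h <;> simp [edgeSign]

/-- Nondegeneracy on both sides equates the dimensions and makes the pairing perfect; the coordinate
forms of `e` are then represented by vectors of `B`. -/
theorem exists_dual_family [FiniteDimensional ℂ A] [FiniteDimensional ℂ B]
    (P : B →ₗ[ℂ] A →ₗ[ℂ] ℂ) (hB : ∀ b, (∀ a, P b a = 0) → b = 0)
    (hA : ∀ a, (∀ b, P b a = 0) → a = 0) {ι : Type} [DecidableEq ι] (e : Module.Basis ι ℂ A) :
    ∃ f : ι → B, ∀ i j, P (f i) (e j) = if i = j then 1 else 0 := by
  have h1 : Function.Injective P := by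
    refine (injective_iff_map_eq_zero P).2 fun b hb => hB b fun a => ?_
    rw [hb, LinearMap.zero_apply]
  have h2 : Function.Injective P.flip := by
    refine (injective_iff_map_eq_zero P.flip).2 fun a ha => hA a fun b => ?_
    rw [← P.flip_apply, ha, LinearMap.zero_apply]
  have h3 : Module.finrank ℂ B = Module.finrank ℂ (Module.Dual ℂ A) := by
    refine le_antisymm (LinearMap.finrank_le_finrank_of_injective h1) ?_
    rw [Subspace.dual_finrank_eq]
    refine (LinearMap.finrank_le_finrank_of_injective h2).trans_eq Subspace.dual_finrank_eq
  have h4 : Function.Surjective P :=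
    (LinearMap.injective_iff_surjective_of_finrank_eq_finrank h3).1 h1
  choose f hf using fun i => h4 (e.coord i)
  refine ⟨f, fun i j => ?_⟩
  rw [hf, Module.Basis.coord_apply, Module.Basis.repr_self, Finsupp.single_apply]
  simp only [eq_comm]

/-- Split off a hyperbolic plane spanned by `x` and `y`, and induct on its orthogonal complement.
This serves the loops of the graph, where an arrow space is paired with itself and a mere dual basis
would not suffice. -/
theorem exists_symplectic_basis (m : ℕ) : ∀ (A : Type) [AddCommGroup A] [Module ℂ A]
    [FiniteDimensional ℂ A] (ω : A →ₗ[ℂ] A →ₗ[ℂ] ℂ), (∀ a b, ω a b = -ω b a) →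
    (∀ a, (∀ b, ω a b = 0) → a = 0) → Module.finrank ℂ A = m + m →
    ∃ e : Fin m ⊕ Fin m → A, ∀ i j, ω (e i) (e j) = if i = j.swap then edgeSign i else 0 := by
  induction m with
  | zero =>
    intro A _ _ _ ω _ _ _
    exact ⟨fun i => i.elim Fin.elim0 Fin.elim0, fun i => i.elim (fun i => i.elim0) fun i => i.elim0⟩
  | succ m ih =>
    intro A _ _ _ ω halt hnd hdim
    have hself : ∀ a, ω a a = 0 := fun a => by
      have := halt a a
      linear_combination this / 2
    have : Nontrivial A := Module.nontrivial_of_finrank_pos (R := ℂ) (by omega)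
    obtain ⟨x, hx⟩ := exists_ne (0 : A)
    obtain ⟨y, hxy⟩ : ∃ y, ω x y = 1 := by
      obtain ⟨y, hy⟩ : ∃ y, ω x y ≠ 0 := by
        by_contra! h
        exact hx (hnd x h)
      exact ⟨(ω x y)⁻¹ • y, by rw [map_smul, smul_eq_mul, inv_mul_cancel₀ hy]⟩
    have hyx : ω y x = -1 := by rw [halt, hxy]
    let F : A →ₗ[ℂ] ℂ × ℂ := (ω x).prod (ω y)
    let W := LinearMap.ker F
    have hW : ∀ z : W, ω x z = 0 ∧ ω y z = 0 := fun z => by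
      have : F z = 0 := z.2
      exact ⟨congrArg Prod.fst this, congrArg Prod.snd this⟩
    have hF : Function.Surjective F := by
      rintro ⟨s, t⟩
      refine ⟨s • y - t • x, Prod.ext ?_ ?_⟩
      · simp [F, hxy, hself]
      · simp [F, hyx, hself]
    have hdimW : Module.finrank ℂ W = m + m := by
      have h1 := LinearMap.finrank_range_add_finrank_ker F
      rw [LinearMap.range_eq_top.2 hF, finrank_top, Module.finrank_prod,
        Module.finrank_self] at h1
      change Module.finrank ℂ (LinearMap.ker F) = m + m
      omega
    obtain ⟨e, he⟩ := ih W (ω.compl₁₂ W.subtype W.subtype) (fun a b => halt a b) (fun a ha => by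
      refine Subtype.ext (hnd a fun v => ?_)
      -- The projection to the complement along the plane: a vector of `W` orthogonal to `W` is
      -- orthogonal to everything.
      have hv : v - (-ω y v) • x - (ω x v) • y ∈ W := by
        change F _ = 0
        refine Prod.ext ?_ ?_
        · simp [F, hxy, hself]
        · simp [F, hyx, hself]
      have h1 : ω a (v - (-ω y v) • x - (ω x v) • y) = 0 := ha ⟨_, hv⟩
      have h2 : ω a x = 0 := by rw [halt, (hW a).1, neg_zero]
      have h3 : ω a y = 0 := by rw [halt, (hW a).2, neg_zero]
      simpa [h2, h3] using h1) hdimW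
    have he' : ∀ i j, ω (e i) (e j) = if i = j.swap then edgeSign i else 0 := he
    have hx' : ∀ j, ω x (e j) = 0 := fun j => (hW _).1
    have hy' : ∀ j, ω y (e j) = 0 := fun j => (hW _).2
    have hx'' : ∀ j, ω (e j) x = 0 := fun j => by rw [halt, hx', neg_zero]
    have hy'' : ∀ j, ω (e j) y = 0 := fun j => by rw [halt, hy', neg_zero]
    refine ⟨Sum.elim (Fin.cons x fun i => e (.inl i)) (Fin.cons y fun i => e (.inr i)), ?_⟩
    rintro (i | i) (j | j) <;> refine Fin.cases ?_ (fun i => ?_) i <;>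
      refine Fin.cases ?_ (fun j => ?_) j <;>
      simp [hself, hxy, hyx, hx', hy', hx'', hy'', he', edgeSign, Fin.succ_ne_zero,
        (Fin.succ_ne_zero _).symm]

end Bases

namespace IrrepList

open Representation

/-! ### Matrices of the irreducible representations -/

section Matrices

variable {G : Type} [Group G] {d : ℕ} [NeZero d] (R : IrrepList G d)

/-- The matrices of the representation `R_k`. -/
def mat (k : Fin d) (g : G) : Matrix (Fin (R.deg k)) (Fin (R.deg k)) ℂ :=
  LinearMap.toMatrix' (R.rep k g)

theorem mat_one (k : Fin d) : R.mat k 1 = 1 := by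
  rw [mat, map_one]
  exact LinearMap.toMatrix'_one

theorem mat_mul (k : Fin d) (g h : G) : R.mat k (g * h) = R.mat k g * R.mat k h := by
  rw [mat, map_mul]
  exact LinearMap.toMatrix'_mul _ _

theorem mat_mul_mat_inv (k : Fin d) (g : G) : R.mat k g * R.mat k g⁻¹ = 1 := by
  rw [← mat_mul, mul_inv_cancel, mat_one]

theorem mat_mulVec (k : Fin d) (g : G) (u : Fin (R.deg k) → ℂ) :
    (R.mat k g).mulVec u = R.rep k g u := by
  rw [mat, LinearMap.toMatrix'_mulVec]

/-- The intertwining map given by a matrix. -/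
def intertwiningOfMatrix {k l : Fin d} (M : Matrix (Fin (R.deg l)) (Fin (R.deg k)) ℂ)
    (hM : ∀ g, R.mat l g * M = M * R.mat k g) : IntertwiningMap (R.rep k) (R.rep l) :=
  LinearMap.intertwiningMap_of_isIntertwiningMap _ _ (Matrix.toLin' M) fun g u => by
    rw [Matrix.toLin'_apply, Matrix.toLin'_apply, ← mat_mulVec, ← mat_mulVec,
      Matrix.mulVec_mulVec, Matrix.mulVec_mulVec, hM]

theorem matrix_eq_zero_of_ne {k l : Fin d} (hkl : k ≠ l)
    {M : Matrix (Fin (R.deg l)) (Fin (R.deg k)) ℂ} (hM : ∀ g, R.mat l g * M = M * R.mat k g) :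
    M = 0 := by
  have h := R.intertwiningMap_eq_zero hkl (R.intertwiningOfMatrix M hM)
  have h1 : Matrix.toLin' M = 0 := congrArg IntertwiningMap.toLinearMap h
  exact (LinearEquiv.map_eq_zero_iff _).1 h1

/-- Schur's lemma, with the scalar written as a normalised trace because the pairing of arrows is a
trace. -/
theorem matrix_eq_smul_one {k : Fin d} {M : Matrix (Fin (R.deg k)) (Fin (R.deg k)) ℂ}
    (hM : ∀ g, R.mat k g * M = M * R.mat k g) : M = (M.trace / R.deg k) • 1 := by
  obtain ⟨c, hc⟩ := R.exists_eq_smul (R.intertwiningOfMatrix M hM)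
  have h1 : M = c • 1 := by
    refine (Matrix.toLin').injective (LinearMap.ext fun u => ?_)
    rw [map_smul, Matrix.toLin'_one]
    exact hc u
  have h2 : (R.deg k : ℂ) ≠ 0 := Nat.cast_ne_zero.2 (R.deg_pos k).ne'
  have h3 : M.trace / R.deg k = c := by
    rw [h1, Matrix.trace_smul, Matrix.trace_one, Fintype.card_fin, smul_eq_mul,
      mul_div_cancel_right₀ _ h2]
  rw [h3]
  exact h1

theorem deg_zero : R.deg 0 = 1 := by
  obtain ⟨φ⟩ := R.trivial_zero
  have := φ.toLinearEquiv.finrank_eq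
  simpa using this

theorem mat_zero (g : G) : R.mat 0 g = 1 := by
  obtain ⟨φ⟩ := R.trivial_zero
  have h : R.rep 0 g = LinearMap.id := by
    refine LinearMap.ext fun u => φ.toLinearEquiv.injective ?_
    exact φ.toIntertwiningMap.isIntertwining _ _ g u
  rw [mat, h]
  exact LinearMap.toMatrix'_id

end Matrices

/-! ### The arrows of the McKay graph -/

section Arrows

variable {Γ : Subgroup SL(2, ℂ)} {d : ℕ} [NeZero d] (R : IrrepList Γ d)

/-- The space `Hom_Γ(R_k ⊗ L, R_l)`; its elements are pairs of matrices. -/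
def arrowSpace (k l : Fin d) :
    Submodule ℂ (Fin 2 → Matrix (Fin (R.deg l)) (Fin (R.deg k)) ℂ) where
  carrier := {β | ∀ (g : Γ) (s : Fin 2), R.mat l g * β s = ∑ t, g.1.1 t s • (β t * R.mat k g)}
  zero_mem' := fun g s => by simp
  add_mem' := fun {β β'} h h' g s => by
    simp only [Pi.add_apply, Matrix.mul_add, h g s, h' g s, Matrix.add_mul, smul_add,
      Finset.sum_add_distrib]
  smul_mem' := fun c β h g s => by
    simp only [Pi.smul_apply, Matrix.mul_smul, h g s, Matrix.smul_mul, Finset.smul_sum]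
    exact Finset.sum_congr rfl fun t _ => smul_comm _ _ _

/-- An intertwiner `f` corresponds to the pair of matrices of `f (· ⊗ e_s)`; equivariance on the
basis of `L` is the defining condition. -/
theorem finrank_arrowSpace (k l : Fin d) :
    Module.finrank ℂ (R.arrowSpace k l) = Module.finrank ℂ
      (IntertwiningMap ((R.rep k).tprod (tautologicalRep Γ)) (R.rep l)) := by
  have htaut : ∀ (g : Γ) (s : Fin 2),
      tautologicalRep Γ g (Pi.single s 1) = ∑ t, g.1.1 t s • Pi.single t (1 : ℂ) := by
    intro g s
    change Matrix.toLin' g.1.1 (Pi.single s 1) = _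
    refine funext fun t => ?_
    rw [Matrix.toLin'_apply, Matrix.mulVec_single_one]
    simp [Finset.sum_apply, Pi.single_apply, Matrix.col_apply]
  let F : IntertwiningMap ((R.rep k).tprod (tautologicalRep Γ)) (R.rep l) →ₗ[ℂ]
      (Fin 2 → Matrix (Fin (R.deg l)) (Fin (R.deg k)) ℂ) :=
    { toFun := fun f s => LinearMap.toMatrix'
        (f.toLinearMap ∘ₗ (TensorProduct.mk ℂ _ _).flip (Pi.single s 1))
      map_add' := fun f f' => funext fun s => by
        rw [IntertwiningMap.add_toLinearMap, LinearMap.add_comp, map_add]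
        rfl
      map_smul' := fun c f => funext fun s => by
        rw [IntertwiningMap.toLinearMap_smul, LinearMap.smul_comp, map_smul]
        rfl }
  have hF : ∀ f s u, (F f s).mulVec u = f (u ⊗ₜ Pi.single s 1) := fun f s u =>
    LinearMap.toMatrix'_mulVec _ _
  have hinj : Function.Injective F := by
    intro f f' h
    refine IntertwiningMap.ext (TensorProduct.ext' fun u x => ?_)
    have hx : x = ∑ s, x s • Pi.single s (1 : ℂ) := by
      refine funext fun t => ?_
      simp [Finset.sum_apply, Pi.single_apply]
    rw [hx]
    simp only [TensorProduct.tmul_sum, TensorProduct.tmul_smul, map_sum, map_smul]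
    refine Finset.sum_congr rfl fun s _ => congrArg _ ?_
    exact (hF f s u).symm.trans ((congrFun h s) ▸ hF f' s u)
  have hrange : LinearMap.range F = R.arrowSpace k l := by
    refine le_antisymm ?_ fun β hβ => ?_
    · rintro _ ⟨f, rfl⟩ g s
      refine (Matrix.toLin').injective (LinearMap.ext fun u => ?_)
      rw [Matrix.toLin'_apply, Matrix.toLin'_apply, ← Matrix.mulVec_mulVec, hF, mat_mulVec,
        ← IntertwiningMap.isIntertwining, Representation.tprod_apply, TensorProduct.map_tmul,
        htaut, Matrix.sum_mulVec, TensorProduct.tmul_sum, map_sum]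
      refine Finset.sum_congr rfl fun t _ => ?_
      rw [Matrix.smul_mulVec, ← Matrix.mulVec_mulVec, hF, mat_mulVec, TensorProduct.tmul_smul,
        map_smul]
    · let T : (Fin (R.deg k) → ℂ) →ₗ[ℂ] (Fin 2 → ℂ) →ₗ[ℂ] (Fin (R.deg l) → ℂ) :=
        LinearMap.mk₂ ℂ (fun u x => ∑ s, x s • (β s).mulVec u)
          (fun u u' x => by simp [Matrix.mulVec_add, Finset.sum_add_distrib])
          (fun c u x => by simp [Matrix.mulVec_smul, smul_comm c])
          (fun u x x' => by simp [add_smul, Finset.sum_add_distrib])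
          (fun c u x => by simp [mul_smul])
      have hT : ∀ u s, T u (Pi.single s 1) = (β s).mulVec u := fun u s => by
        change ∑ t, (Pi.single s (1 : ℂ) : Fin 2 → ℂ) t • (β t).mulVec u = _
        simp [Pi.single_apply]
      refine ⟨⟨TensorProduct.lift T, fun g => ?_⟩, ?_⟩
      · refine TensorProduct.ext (LinearMap.ext fun u => ?_)
        refine LinearMap.pi_ext' fun s => LinearMap.ext_ring ?_
        change TensorProduct.lift T ((R.rep k g u) ⊗ₜ tautologicalRep Γ g (Pi.single s 1)) =
          R.rep l g (TensorProduct.lift T (u ⊗ₜ Pi.single s 1))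
        rw [TensorProduct.lift.tmul, TensorProduct.lift.tmul, htaut, map_sum, hT, ← mat_mulVec,
          ← mat_mulVec, Matrix.mulVec_mulVec, hβ g s, Matrix.sum_mulVec]
        refine Finset.sum_congr rfl fun t _ => ?_
        rw [map_smul, hT, Matrix.smul_mulVec, Matrix.mulVec_mulVec]
      · refine funext fun s => (Matrix.toLin').injective (LinearMap.ext fun u => ?_)
        rw [Matrix.toLin'_apply, Matrix.toLin'_apply, hF]
        change TensorProduct.lift T (u ⊗ₜ Pi.single s 1) = _
        rw [TensorProduct.lift.tmul, hT]
  rw [← hrange]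
  exact LinearMap.finrank_range_of_inj hinj

/-- The matrix `β'_1 β_2 - β'_2 β_1`. -/
def bracket {a b c : ℕ} (β' : Fin 2 → Matrix (Fin a) (Fin b) ℂ)
    (β : Fin 2 → Matrix (Fin b) (Fin c) ℂ) : Matrix (Fin a) (Fin c) ℂ :=
  β' 0 * β 1 - β' 1 * β 0

/-- The pairing of pairs of matrices given by the symplectic form on `L`. -/
def arrowPairing (a b : ℕ) : (Fin 2 → Matrix (Fin a) (Fin b) ℂ) →ₗ[ℂ]
    (Fin 2 → Matrix (Fin b) (Fin a) ℂ) →ₗ[ℂ] ℂ :=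
  LinearMap.mk₂ ℂ (fun β' β => (bracket β' β).trace)
    (fun β' β'' β => by simp [bracket, Matrix.add_mul]; ring)
    (fun c β' β => by simp [bracket, mul_sub])
    (fun β' β β'' => by simp [bracket, Matrix.mul_add]; ring)
    (fun c β' β => by simp [bracket, mul_sub])

theorem arrowPairing_apply {a b : ℕ} (β' : Fin 2 → Matrix (Fin a) (Fin b) ℂ)
    (β : Fin 2 → Matrix (Fin b) (Fin a) ℂ) : arrowPairing a b β' β = (bracket β' β).trace := rfl

theorem arrowPairing_swap {a b : ℕ} (β' : Fin 2 → Matrix (Fin a) (Fin b) ℂ)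
    (β : Fin 2 → Matrix (Fin b) (Fin a) ℂ) : arrowPairing b a β β' = -arrowPairing a b β' β := by
  rw [arrowPairing_apply, arrowPairing_apply, bracket, bracket, Matrix.trace_sub, Matrix.trace_sub,
    Matrix.trace_mul_comm (β 0), Matrix.trace_mul_comm (β 1)]
  ring

theorem det_eq (g : Γ) : g.1.1 0 0 * g.1.1 1 1 - g.1.1 0 1 * g.1.1 1 0 = 1 := by
  rw [← Matrix.det_fin_two]
  exact g.1.2

/-- The symplectic form on `L` is Γ-invariant because `det γ = 1`, so contracting two arrows along
it gives an intertwiner from `R_k` to `R_j`. -/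
theorem mat_mul_bracket {k l j : Fin d} {β' : Fin 2 → Matrix (Fin (R.deg j)) (Fin (R.deg l)) ℂ}
    {β : Fin 2 → Matrix (Fin (R.deg l)) (Fin (R.deg k)) ℂ} (hβ' : β' ∈ R.arrowSpace l j)
    (hβ : β ∈ R.arrowSpace k l) (g : Γ) :
    R.mat j g * bracket β' β = bracket β' β * R.mat k g := by
  rw [bracket, Matrix.mul_sub, ← Matrix.mul_assoc, ← Matrix.mul_assoc, hβ' g, hβ' g]
  simp only [Fin.sum_univ_two, Matrix.add_mul, Matrix.smul_mul, Matrix.mul_assoc, hβ g,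
    Matrix.mul_add, Matrix.mul_smul, Matrix.sub_mul]
  have h := det_eq g
  match_scalars <;> first | ring1 | linear_combination h | linear_combination -h

/-- The pairing of all pairs of matrices is clearly nondegenerate. Averaging an arbitrary `X` over Γ
gives an arrow, whose pairing with the equivariant `β` is `|Γ|` times that of `X`. -/
theorem arrowPairing_nondegenerate [Finite Γ] {k l : Fin d}
    {β : Fin 2 → Matrix (Fin (R.deg l)) (Fin (R.deg k)) ℂ} (hβ : β ∈ R.arrowSpace k l)
    (h : ∀ β' ∈ R.arrowSpace l k, arrowPairing _ _ β' β = 0) : β = 0 := by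
  have := Fintype.ofFinite Γ
  have hcard : (Fintype.card Γ : ℂ) ≠ 0 := Nat.cast_ne_zero.2 Fintype.card_ne_zero
  have hall : ∀ X : Fin 2 → Matrix (Fin (R.deg k)) (Fin (R.deg l)) ℂ,
      arrowPairing _ _ X β = 0 := by
    intro X
    let Y : Fin 2 → Matrix (Fin (R.deg k)) (Fin (R.deg l)) ℂ := fun s =>
      ∑ g : Γ, ∑ t, g.1.1 t s • (R.mat k g⁻¹ * X t * R.mat l g)
    have hY : Y ∈ R.arrowSpace l k := by
      intro g s
      have h1 : ∀ h : Γ, (h * g).1.1 = h.1.1 * g.1.1 := fun h => rfl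
      simp only [Y, Matrix.mul_sum, Matrix.sum_mul, Finset.smul_sum]
      rw [Finset.sum_comm (s := Finset.univ (α := Fin 2)) (t := Finset.univ (α := Γ))]
      -- Reindexing the average by `h ↦ h g` proves its equivariance.
      refine (Equiv.sum_comp (Equiv.mulRight g) _).symm.trans ?_
      refine Finset.sum_congr rfl fun h _ => ?_
      rw [Finset.sum_comm]
      refine Finset.sum_congr rfl fun t _ => ?_
      have h2 : R.mat k g * (R.mat k (h * g)⁻¹ * X t * R.mat l (h * g)) =
          R.mat k h⁻¹ * X t * R.mat l h * R.mat l g := by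
        rw [mul_inv_rev, mat_mul, mat_mul]
        simp only [Matrix.mul_assoc]
        rw [← Matrix.mul_assoc (R.mat k g), mat_mul_mat_inv, Matrix.one_mul]
      simp only [Equiv.coe_mulRight, Matrix.mul_smul, h2]
      simp only [h1, Matrix.mul_apply, Finset.sum_smul, Matrix.smul_mul, smul_smul, mul_comm]
    have h1 := h Y hY
    have h2 : ∀ g : Γ, ((∑ t, g.1.1 t 0 • (R.mat k g⁻¹ * X t * R.mat l g)) * β 1 -
        (∑ t, g.1.1 t 1 • (R.mat k g⁻¹ * X t * R.mat l g)) * β 0).trace =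
        (bracket X β).trace := by
      intro g
      have h3 : (∑ t, g.1.1 t 0 • (R.mat k g⁻¹ * X t * R.mat l g)) * β 1 -
          (∑ t, g.1.1 t 1 • (R.mat k g⁻¹ * X t * R.mat l g)) * β 0 =
          R.mat k g⁻¹ * (bracket X β * R.mat k g) := by
        simp only [bracket, Fin.sum_univ_two, Matrix.add_mul, Matrix.smul_mul, Matrix.mul_assoc,
          hβ g, Matrix.mul_add, Matrix.mul_smul, Matrix.sub_mul, Matrix.mul_sub]
        have hdet := det_eq g
        match_scalars <;> first | ring1 | linear_combination hdet | linear_combination -hdet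
      rw [h3, Matrix.trace_mul_comm, Matrix.mul_assoc, mat_mul_mat_inv, Matrix.mul_one]
    have h3 : arrowPairing _ _ Y β = Fintype.card Γ * arrowPairing _ _ X β := by
      rw [arrowPairing_apply, arrowPairing_apply, bracket]
      simp only [Y]
      rw [Matrix.sum_mul, Matrix.sum_mul, ← Finset.sum_sub_distrib, Matrix.trace_sum]
      simp only [h2]
      simp
    rw [h3] at h1
    exact (mul_eq_zero.1 h1).resolve_left hcard
  have hentry : ∀ (s : Fin 2) (p : Fin (R.deg l)) (q : Fin (R.deg k)), β s p q = 0 := by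
    intro s p q
    -- Elementary matrices isolate entries: slot 0 sees `β 1`, and slot 1 sees `-β 0`.
    have h0 := hall (Pi.single 0 (Matrix.single q p 1))
    have h1 := hall (Pi.single 1 (Matrix.single q p 1))
    simp only [arrowPairing_apply, bracket, Pi.single_eq_same, Pi.single_apply, one_ne_zero,
      zero_ne_one, if_false, Matrix.zero_mul, sub_zero, zero_sub, Matrix.trace_neg,
      neg_eq_zero] at h0 h1
    rw [Matrix.trace_mul_comm, Matrix.trace_mul_single] at h0 h1
    fin_cases s
    · simpa using h1
    · simpa using h0
  funext s
  ext p q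
  exact hentry s p q

end Arrows

end IrrepList
end

noncomputable section

/-! ### Bases of the spaces of arrows -/

namespace IrrepList

variable {Γ : Subgroup SL(2, ℂ)} {d : ℕ} [NeZero d] (R : IrrepList Γ d) {m : Fin d → Fin d → ℕ}

/-- Bases of the spaces `Hom_Γ(R_k ⊗ L, R_l)`, indexed by the edges of the McKay graph, such that
reversed edges are dual to each other up to sign. -/
structure ArrowBasis (m : Fin d → Fin d → ℕ) where
  arrow : ∀ k l, Fin (m k l) ⊕ Fin (m l k) →
    Fin 2 → Matrix (Fin (R.deg l)) (Fin (R.deg k)) ℂ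
  mem : ∀ k l h, arrow k l h ∈ R.arrowSpace k l
  pairing : ∀ k l h' h, arrowPairing _ _ (arrow l k h') (arrow k l h) =
    if h' = h.swap then edgeSign h' else 0
  finrank_eq : ∀ k l, Module.finrank ℂ (R.arrowSpace k l) = m k l + m l k

theorem exists_arrowBasis_pair [Finite Γ]
    (hfin : ∀ k l, Module.finrank ℂ (R.arrowSpace k l) = m k l + m l k) (k l : Fin d) :
    ∃ (e : Fin (m k l) ⊕ Fin (m l k) → R.arrowSpace k l)
      (f : Fin (m l k) ⊕ Fin (m k l) → R.arrowSpace l k),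
      (∀ h' h, arrowPairing _ _ (f h').1 (e h).1 = if h' = h.swap then edgeSign h' else 0) ∧
        (k = l → HEq e f) := by
  rcases eq_or_ne k l with rfl | hkl
  · obtain ⟨e, he⟩ := exists_symplectic_basis (m k k) (R.arrowSpace k k)
      ((arrowPairing _ _).compl₁₂ (R.arrowSpace k k).subtype (R.arrowSpace k k).subtype)
      (fun a b => arrowPairing_swap _ _) (fun a ha => by
        refine Subtype.ext (R.arrowPairing_nondegenerate a.2 fun β' hβ' => ?_)
        rw [arrowPairing_swap]
        have h : arrowPairing _ _ a.1 β' = 0 := ha ⟨β', hβ'⟩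
        rw [h, neg_zero]) (hfin k k)
    exact ⟨e, e, he, fun _ => HEq.rfl⟩
  · let e : Module.Basis (Fin (m k l) ⊕ Fin (m l k)) ℂ (R.arrowSpace k l) :=
      (Module.finBasisOfFinrankEq ℂ _ (hfin k l)).reindex finSumFinEquiv.symm
    obtain ⟨f, hf⟩ := exists_dual_family
      ((arrowPairing _ _).compl₁₂ (R.arrowSpace l k).subtype (R.arrowSpace k l).subtype)
      (fun b hb => by
        refine Subtype.ext (R.arrowPairing_nondegenerate b.2 fun β' hβ' => ?_)
        rw [arrowPairing_swap]
        have h : arrowPairing _ _ b.1 β' = 0 := hb ⟨β', hβ'⟩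
        rw [h, neg_zero])
      (fun a ha => Subtype.ext (R.arrowPairing_nondegenerate a.2 fun β' hβ' => ha ⟨β', hβ'⟩)) e
    -- The dual basis is indexed by the same edge; swapping and a sign turn it into one indexed by
    -- the reversed edge.
    refine ⟨e, fun h' => edgeSign h' • f h'.swap, fun h' h => ?_, fun h => absurd h hkl⟩
    have h1 : arrowPairing _ _ (f h'.swap).1 (e h).1 = if h'.swap = h then 1 else 0 :=
      hf h'.swap h
    have h2 : h'.swap = h ↔ h' = h.swap := by
      constructor
      · rintro rfl
        exact h'.swap_swap.symm
      · rintro rfl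
        exact h.swap_swap
    rw [Submodule.coe_smul, map_smul, LinearMap.smul_apply, h1]
    simp only [h2, smul_eq_mul, mul_ite, mul_one, mul_zero]

/-- The order of the vertices decides which member of a pair is used. For `l < k` the antisymmetry
of the pairing and the sign change of a reversed edge cancel. -/
theorem exists_arrowBasis [Finite Γ] (hm : IsMcKayOrientation R m) :
    Nonempty (R.ArrowBasis m) := by
  have hfin : ∀ k l, Module.finrank ℂ (R.arrowSpace k l) = m k l + m l k := fun k l => by
    rw [finrank_arrowSpace, hm k l]
  choose e f hef hdiag using R.exists_arrowBasis_pair hfin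
  refine ⟨⟨fun k l h => if k ≤ l then (e k l h).1 else (f l k h).1, fun k l h => ?_,
    fun k l h' h => ?_, hfin⟩⟩
  · split_ifs
    · exact (e k l h).2
    · exact (f l k h).2
  · rcases lt_trichotomy k l with hkl | rfl | hkl
    · simp only [hkl.le, hkl.not_ge, if_true, if_false]
      exact hef k l h' h
    · simp only [le_refl, if_true]
      have h1 := hef k k h' h
      rwa [← eq_of_heq (hdiag k k rfl)] at h1
    · simp only [hkl.le, hkl.not_ge, if_true, if_false]
      rw [arrowPairing_swap, hef l k h h']
      by_cases hh : h' = h.swap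
      · rw [if_pos hh, if_pos (by rw [hh, Sum.swap_swap]), hh, edgeSign_swap]
      · rw [if_neg hh, if_neg fun h1 => hh (by rw [h1, Sum.swap_swap]), neg_zero]

/-! ### Expansion in a basis of arrows, and contraction of two arrows. -/

namespace ArrowBasis

variable {R} (b : R.ArrowBasis m)

theorem pairing_sum (k l : Fin d) (c : Fin (m k l) ⊕ Fin (m l k) → ℂ)
    (h : Fin (m k l) ⊕ Fin (m l k)) :
    arrowPairing _ _ (b.arrow l k h.swap) (∑ h, c h • b.arrow k l h) = edgeSign h.swap * c h := by
  rw [map_sum, Finset.sum_eq_single h]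
  · rw [map_smul, b.pairing, if_pos rfl, smul_eq_mul, mul_comm]
  · intro h' _ hne
    rw [map_smul, b.pairing, if_neg, smul_zero]
    intro heq
    exact hne (by rw [← h'.swap_swap, ← heq, h.swap_swap])
  · simp

/-- Duality gives linear independence and `finrank_eq` then gives spanning; pairing with the
reversed arrow reads off a coefficient. -/
theorem sum_pairing {k l : Fin d} {β : Fin 2 → Matrix (Fin (R.deg l)) (Fin (R.deg k)) ℂ}
    (hβ : β ∈ R.arrowSpace k l) :
    ∑ h, (edgeSign h.swap * arrowPairing _ _ (b.arrow l k h.swap) β) • b.arrow k l h = β := by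
  let e : Fin (m k l) ⊕ Fin (m l k) → R.arrowSpace k l := fun h => ⟨b.arrow k l h, b.mem k l h⟩
  have hlin : LinearIndependent ℂ e := by
    refine Fintype.linearIndependent_iff.2 fun c hc h => ?_
    have h1 : ∑ h, c h • b.arrow k l h = 0 := by
      have := congrArg Subtype.val hc
      simpa [e] using this
    have h2 := b.pairing_sum k l c h
    rw [h1, map_zero] at h2
    have h3 := edgeSign_mul_self h.swap
    calc c h = edgeSign h.swap * (edgeSign h.swap * c h) := by rw [← mul_assoc, h3, one_mul]
      _ = 0 := by rw [← h2, mul_zero]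
  have hspan : ⊤ ≤ Submodule.span ℂ (Set.range e) :=
    (hlin.span_eq_top_of_card_eq_finrank' (by simp [b.finrank_eq])).ge
  obtain ⟨c, hc⟩ := (Submodule.mem_span_range_iff_exists_fun ℂ).1
    (hspan (Submodule.mem_top (x := (⟨β, hβ⟩ : R.arrowSpace k l))))
  have hc' : ∑ h, c h • b.arrow k l h = β := by
    have := congrArg Subtype.val hc
    simpa [e] using this
  have h1 : ∀ h, edgeSign h.swap * arrowPairing _ _ (b.arrow l k h.swap) β = c h := fun h => by
    rw [← hc', b.pairing_sum, ← mul_assoc, edgeSign_mul_self, one_mul]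
  simp only [h1, hc']

theorem bracket_arrow {k l k' : Fin d} (h' : Fin (m l k') ⊕ Fin (m k' l))
    (h : Fin (m k l) ⊕ Fin (m l k)) (hk : k ≠ k') :
    bracket (b.arrow l k' h') (b.arrow k l h) = 0 :=
  R.matrix_eq_zero_of_ne hk (R.mat_mul_bracket (b.mem _ _ _) (b.mem _ _ _))

/-- The contraction is scalar on `R_k`, and its trace is the prescribed pairing. This is the source
of the factor `1 / dim R_k` in the moment map. -/
theorem bracket_arrow_self {k l : Fin d} (h' : Fin (m l k) ⊕ Fin (m k l))
    (h : Fin (m k l) ⊕ Fin (m l k)) :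
    bracket (b.arrow l k h') (b.arrow k l h) =
      ((if h' = h.swap then edgeSign h' else 0) / R.deg k) • 1 := by
  have := R.matrix_eq_smul_one (R.mat_mul_bracket (b.mem l k h') (b.mem k l h))
  rwa [← arrowPairing_apply, b.pairing] at this

end ArrowBasis

end IrrepList
end

noncomputable section

/-! ### Block matrices for a decomposition of `ℂ^r` -/

section Blocks

open Matrix

variable {d r : ℕ} {v deg : Fin d → ℕ} (ι : (Σ k, Fin (v k) × Fin (deg k)) ≃ Fin r)

/-- The places of the basis vectors of the `p`-th copy of the `k`-th summand. -/
def place (k : Fin d) (p : Fin (v k)) (α : Fin (deg k)) : Fin r := ι ⟨k, p, α⟩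

theorem sum_place {M : Type} [AddCommMonoid M] (f : Fin r → M) :
    ∑ i, f i = ∑ k, ∑ p, ∑ α, f (place ι k p α) := by
  rw [← ι.sum_comp]
  simp only [Fintype.sum_sigma, Fintype.sum_prod_type, place]

theorem exists_eq_place (i : Fin r) : ∃ k p α, i = place ι k p α :=
  ⟨_, _, _, (ι.apply_symm_apply i).symm⟩

theorem submatrix_mul_place {a b a' b' : Type} (A : Matrix a (Fin r) ℂ) (B : Matrix (Fin r) b ℂ)
    (f : a' → a) (g : b' → b) :
    (A * B).submatrix f g =
      ∑ k, ∑ p, A.submatrix f (place ι k p) * B.submatrix (place ι k p) g := by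
  ext i j
  simp only [submatrix_apply, mul_apply, sum_place ι, Matrix.sum_apply]

theorem ext_rows {c : Type} {A B : Matrix (Fin r) c ℂ}
    (h : ∀ k p, A.submatrix (place ι k p) id = B.submatrix (place ι k p) id) : A = B := by
  ext i j
  obtain ⟨k, p, α, rfl⟩ := exists_eq_place ι i
  exact congrFun (congrFun (h k p) α) j

theorem ext_columns {c : Type} {A B : Matrix c (Fin r) ℂ}
    (h : ∀ k p, A.submatrix id (place ι k p) = B.submatrix id (place ι k p)) : A = B := by
  ext i j
  obtain ⟨k, p, α, rfl⟩ := exists_eq_place ι j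
  exact congrFun (congrFun (h k p) i) α

theorem ext_blocks {A B : Matrix (Fin r) (Fin r) ℂ}
    (h : ∀ k l p q, A.submatrix (place ι k p) (place ι l q) =
      B.submatrix (place ι k p) (place ι l q)) : A = B := by
  ext i j
  obtain ⟨k, p, α, rfl⟩ := exists_eq_place ι i
  obtain ⟨l, q, β, rfl⟩ := exists_eq_place ι j
  exact congrFun (congrFun (h k l p q) α) β

/-- The matrix with given blocks. -/
def ofBlocks (F : ∀ k l, Fin (v k) → Fin (v l) → Matrix (Fin (deg k)) (Fin (deg l)) ℂ) :
    Matrix (Fin r) (Fin r) ℂ :=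
  of fun i j => F (ι.symm i).1 (ι.symm j).1 (ι.symm i).2.1 (ι.symm j).2.1 (ι.symm i).2.2
    (ι.symm j).2.2

theorem ofBlocks_submatrix
    (F : ∀ k l, Fin (v k) → Fin (v l) → Matrix (Fin (deg k)) (Fin (deg l)) ℂ) (k l : Fin d)
    (p : Fin (v k)) (q : Fin (v l)) :
    (ofBlocks ι F).submatrix (place ι k p) (place ι l q) = F k l p q := by
  ext α β
  simp only [submatrix_apply, ofBlocks, of_apply, place]
  rw [ι.symm_apply_apply, ι.symm_apply_apply]

/-- The matrix with given blocks within the isotypic components. -/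
def diagBlocks (D : ∀ k, Fin (v k) → Fin (v k) → Matrix (Fin (deg k)) (Fin (deg k)) ℂ) :
    Matrix (Fin r) (Fin r) ℂ :=
  (blockDiagonal' fun k => of fun (a b : Fin (v k) × Fin (deg k)) => D k a.1 b.1 a.2 b.2).submatrix
    ι.symm ι.symm

theorem diagBlocks_submatrix_self
    (D : ∀ k, Fin (v k) → Fin (v k) → Matrix (Fin (deg k)) (Fin (deg k)) ℂ) (k : Fin d)
    (p q : Fin (v k)) :
    (diagBlocks ι D).submatrix (place ι k p) (place ι k q) = D k p q := by
  ext α β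
  simp only [submatrix_apply, diagBlocks, place, ι.symm_apply_apply, blockDiagonal'_apply_eq,
    of_apply]

theorem diagBlocks_submatrix_of_ne
    (D : ∀ k, Fin (v k) → Fin (v k) → Matrix (Fin (deg k)) (Fin (deg k)) ℂ) {k l : Fin d}
    (h : k ≠ l) (p : Fin (v k)) (q : Fin (v l)) :
    (diagBlocks ι D).submatrix (place ι k p) (place ι l q) = 0 := by
  ext α β
  simp only [submatrix_apply, diagBlocks, place, ι.symm_apply_apply, Matrix.zero_apply]
  exact blockDiagonal'_apply_ne _ _ _ h

theorem eq_diagBlocks {A : Matrix (Fin r) (Fin r) ℂ}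
    {D : ∀ k, Fin (v k) → Fin (v k) → Matrix (Fin (deg k)) (Fin (deg k)) ℂ}
    (h0 : ∀ k l p q, k ≠ l → A.submatrix (place ι k p) (place ι l q) = 0)
    (h : ∀ k p q, A.submatrix (place ι k p) (place ι k q) = D k p q) : A = diagBlocks ι D := by
  refine ext_blocks ι fun k l p q => ?_
  rcases eq_or_ne k l with rfl | hkl
  · rw [h, diagBlocks_submatrix_self]
  · rw [h0 k l p q hkl, diagBlocks_submatrix_of_ne ι D hkl]

theorem diagBlocks_mul_submatrix {b b' : Type}
    (D : ∀ k, Fin (v k) → Fin (v k) → Matrix (Fin (deg k)) (Fin (deg k)) ℂ)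
    (B : Matrix (Fin r) b ℂ) (k : Fin d) (p : Fin (v k)) (g : b' → b) :
    (diagBlocks ι D * B).submatrix (place ι k p) g =
      ∑ q, D k p q * B.submatrix (place ι k q) g := by
  rw [submatrix_mul_place ι, Finset.sum_eq_single k]
  · simp only [diagBlocks_submatrix_self]
  · intro l _ hl
    simp only [diagBlocks_submatrix_of_ne ι D hl.symm, Matrix.zero_mul, Finset.sum_const_zero]
  · simp

theorem mul_diagBlocks_submatrix {a a' : Type}
    (D : ∀ k, Fin (v k) → Fin (v k) → Matrix (Fin (deg k)) (Fin (deg k)) ℂ)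
    (A : Matrix a (Fin r) ℂ) (k : Fin d) (q : Fin (v k)) (f : a' → a) :
    (A * diagBlocks ι D).submatrix f (place ι k q) =
      ∑ p, A.submatrix f (place ι k p) * D k p q := by
  rw [submatrix_mul_place ι, Finset.sum_eq_single k]
  · simp only [diagBlocks_submatrix_self]
  · intro l _ hl
    simp only [diagBlocks_submatrix_of_ne ι D hl, Matrix.mul_zero, Finset.sum_const_zero]
  · simp

theorem diagBlocks_mul_diagBlocks
    (D D' : ∀ k, Fin (v k) → Fin (v k) → Matrix (Fin (deg k)) (Fin (deg k)) ℂ) :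
    diagBlocks ι D * diagBlocks ι D' = diagBlocks ι fun k p q => ∑ p', D k p p' * D' k p' q := by
  refine eq_diagBlocks ι (fun k l p q hkl => ?_) fun k p q => ?_
  · simp only [diagBlocks_mul_submatrix, diagBlocks_submatrix_of_ne ι D' hkl, Matrix.mul_zero,
      Finset.sum_const_zero]
  · simp only [diagBlocks_mul_submatrix, diagBlocks_submatrix_self]

theorem diagBlocks_one :
    diagBlocks ι (fun _ p q => if p = q then 1 else 0) = 1 := by
  refine (eq_diagBlocks ι (fun k l p q hkl => ?_) fun k p q => ?_).symm
  · ext α β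
    simp only [submatrix_apply, Matrix.zero_apply]
    refine one_apply_ne fun h => hkl ?_
    exact congrArg Sigma.fst (ι.injective h)
  · ext α β
    simp only [submatrix_apply, place, one_apply, ι.apply_eq_iff_eq, Sigma.mk.injEq, heq_eq_eq,
      true_and, Prod.mk.injEq]
    by_cases h : p = q <;> simp [h, one_apply]

/-- The endomorphism of `⨁ V_k ⊗ R_k` given by endomorphisms of the spaces `V_k`. -/
def spread (A : ∀ k, Matrix (Fin (v k)) (Fin (v k)) ℂ) : Matrix (Fin r) (Fin r) ℂ :=
  diagBlocks ι fun k p q => A k p q • 1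

theorem spread_mul (A B : ∀ k, Matrix (Fin (v k)) (Fin (v k)) ℂ) :
    spread ι (fun k => A k * B k) = spread ι A * spread ι B := by
  rw [spread, spread, spread, diagBlocks_mul_diagBlocks]
  congr 1
  funext k p q
  simp only [Matrix.mul_apply, Finset.sum_smul, Matrix.smul_mul, Matrix.one_mul, smul_smul]

theorem spread_one : spread ι (fun _ => 1) = 1 := by
  rw [← diagBlocks_one ι, spread]
  congr 1
  funext k p q
  rw [Matrix.one_apply]
  split_ifs <;> simp

theorem spread_injective (hdeg : ∀ k, 0 < deg k) : Function.Injective (spread ι) := by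
  intro A B h
  funext k
  ext p q
  have h1 := congrArg (fun M : Matrix (Fin r) (Fin r) ℂ => M.submatrix (place ι k p)
    (place ι k q)) h
  simp only [spread, diagBlocks_submatrix_self] at h1
  simpa using congrFun (congrFun h1 ⟨0, hdeg k⟩) ⟨0, hdeg k⟩

/-- The embedding of `∏ GL(V_k)` into `GL_r`. -/
def spreadGL (g : ∀ k, GL (Fin (v k)) ℂ) : GL (Fin r) ℂ where
  val := spread ι fun k => (g k).1
  inv := spread ι fun k => (g k)⁻¹.1
  val_inv := by
    rw [← spread_mul, ← spread_one ι]
    simp only [Units.mul_inv]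
  inv_val := by
    rw [← spread_mul, ← spread_one ι]
    simp only [Units.inv_mul]

end Blocks

/-! ### The standard representation on `ℂ^r` and its commutant. -/

namespace IrrepList

variable {G : Type} [Group G] {d r : ℕ} [NeZero d] (R : IrrepList G d) {v : Fin d → ℕ}
  (ι : (Σ k, Fin (v k) × Fin (R.deg k)) ≃ Fin r)

/-- The matrices of the representation `⨁ R_k^{v k}`. -/
def sumMat (g : G) : Matrix (Fin r) (Fin r) ℂ :=
  diagBlocks ι fun k p q => if p = q then R.mat k g else 0

theorem sumMat_mul_submatrix {b b' : Type} (g : G) (B : Matrix (Fin r) b ℂ) (k : Fin d)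
    (p : Fin (v k)) (f : b' → b) :
    (R.sumMat ι g * B).submatrix (place ι k p) f = R.mat k g * B.submatrix (place ι k p) f := by
  rw [sumMat, diagBlocks_mul_submatrix, Finset.sum_eq_single p]
  · rw [if_pos rfl]
  · intro q _ hq
    rw [if_neg hq.symm, Matrix.zero_mul]
  · simp

theorem mul_sumMat_submatrix {a a' : Type} (g : G) (A : Matrix a (Fin r) ℂ) (k : Fin d)
    (q : Fin (v k)) (f : a' → a) :
    (A * R.sumMat ι g).submatrix f (place ι k q) = A.submatrix f (place ι k q) * R.mat k g := by
  rw [sumMat, mul_diagBlocks_submatrix, Finset.sum_eq_single q]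
  · rw [if_pos rfl]
  · intro p _ hp
    rw [if_neg hp, Matrix.mul_zero]
  · simp

theorem sumMat_one : R.sumMat ι 1 = 1 := by
  rw [← diagBlocks_one ι, sumMat]
  simp only [mat_one]

theorem sumMat_mul (g h : G) : R.sumMat ι (g * h) = R.sumMat ι g * R.sumMat ι h := by
  refine ext_blocks ι fun k l p q => ?_
  rw [sumMat_mul_submatrix]
  rcases eq_or_ne k l with rfl | hkl
  · simp only [sumMat, diagBlocks_submatrix_self, mat_mul]
    split_ifs <;> simp
  · simp only [sumMat, diagBlocks_submatrix_of_ne ι _ hkl, Matrix.mul_zero]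

/-- The representation `⨁ R_k^{v k}` on `ℂ^r`. -/
def sumGL : G →* GL (Fin r) ℂ where
  toFun g := ⟨R.sumMat ι g, R.sumMat ι g⁻¹, by rw [← sumMat_mul, mul_inv_cancel, sumMat_one],
    by rw [← sumMat_mul, inv_mul_cancel, sumMat_one]⟩
  map_one' := Units.ext (R.sumMat_one ι)
  map_mul' g h := Units.ext (R.sumMat_mul ι g h)

theorem sumGL_val (g : G) : (R.sumGL ι g).1 = R.sumMat ι g := rfl

/-- Each block of `A` intertwines two irreducibles, so it vanishes between different ones and is
scalar otherwise. -/
theorem exists_eq_spread {A : Matrix (Fin r) (Fin r) ℂ}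
    (hA : ∀ g, R.sumMat ι g * A = A * R.sumMat ι g) : ∃ D, A = spread ι D := by
  have hblock : ∀ k l p q g, R.mat k g * A.submatrix (place ι k p) (place ι l q) =
      A.submatrix (place ι k p) (place ι l q) * R.mat l g := fun k l p q g => by
    rw [← sumMat_mul_submatrix, hA, mul_sumMat_submatrix]
  exact ⟨_, eq_diagBlocks ι (fun k l p q hkl => R.matrix_eq_zero_of_ne hkl.symm (hblock k l p q))
    fun k p q => R.matrix_eq_smul_one (hblock k k p q)⟩

theorem exists_eq_spreadGL {A : GL (Fin r) ℂ}
    (hA : ∀ g, R.sumMat ι g * A.1 = A.1 * R.sumMat ι g) : ∃ g, A = spreadGL ι g := by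
  have hA' : ∀ g, R.sumMat ι g * A⁻¹.1 = A⁻¹.1 * R.sumMat ι g := fun g => by
    calc R.sumMat ι g * A⁻¹.1 = A⁻¹.1 * (A.1 * R.sumMat ι g) * A⁻¹.1 := by
          rw [← mul_assoc, Units.inv_mul, one_mul]
      _ = A⁻¹.1 * R.sumMat ι g := by
          rw [← hA, mul_assoc, mul_assoc, Units.mul_inv, mul_one]
  obtain ⟨D, hD⟩ := R.exists_eq_spread ι hA
  obtain ⟨D', hD'⟩ := R.exists_eq_spread ι hA'
  have h1 : (fun k => D k * D' k) = fun k => 1 := spread_injective ι R.deg_pos (by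
    rw [spread_mul, ← hD, ← hD', spread_one, Units.mul_inv])
  have h2 : (fun k => D' k * D k) = fun k => 1 := spread_injective ι R.deg_pos (by
    rw [spread_mul, ← hD, ← hD', spread_one, Units.inv_mul])
  exact ⟨fun k => ⟨D k, D' k, congrFun h1 k, congrFun h2 k⟩, Units.ext hD⟩

/-- The identification of `⨁ R_k^{v k}` with `ℂ^r`. -/
def sumRepEquiv : (R.sumRep v).Equiv (matrixRep (R.sumGL ι)) :=
  Representation.Equiv.mk
    { toFun := fun f i => f (ι.symm i).1 (ι.symm i).2.1 (ι.symm i).2.2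
      map_add' := fun _ _ => rfl
      map_smul' := fun _ _ => rfl
      invFun := fun u k p α => u (place ι k p α)
      left_inv := fun f => by
        funext k p α
        exact congrArg (fun s : Σ k, Fin (v k) × Fin (R.deg k) => f s.1 s.2.1 s.2.2)
          (ι.symm_apply_apply ⟨k, p, α⟩)
      right_inv := fun u => by
        funext i
        exact congrArg u (ι.apply_symm_apply i) } fun g => by
    refine LinearMap.ext fun f => funext fun i => ?_
    obtain ⟨k, p, α, rfl⟩ := exists_eq_place ι i
    change R.sumRep v g f (ι.symm (ι ⟨k, p, α⟩)).1 (ι.symm (ι ⟨k, p, α⟩)).2.1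
      (ι.symm (ι ⟨k, p, α⟩)).2.2 = (R.sumMat ι g).mulVec
        (fun i => f (ι.symm i).1 (ι.symm i).2.1 (ι.symm i).2.2) (place ι k p α)
    rw [ι.symm_apply_apply, sumRep_apply, ← mat_mulVec]
    have h := congrFun (congrFun (R.sumMat_mul_submatrix ι g (Matrix.of fun i (_ : Unit) =>
      f (ι.symm i).1 (ι.symm i).2.1 (ι.symm i).2.2) k p id) α) ()
    refine Eq.trans ?_ h.symm
    rw [Matrix.mul_apply]
    change ∑ β, R.mat k g α β * f k p β = _
    refine Finset.sum_congr rfl fun β _ => congrArg (R.mat k g α β * ·) ?_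
    exact (congrArg (fun s : Σ k, Fin (v k) × Fin (R.deg k) => f s.1 s.2.1 s.2.2)
      (ι.symm_apply_apply ⟨k, p, β⟩)).symm

theorem finrank_intertwiningMap_sumGL (k : Fin d) :
    Module.finrank ℂ (Representation.IntertwiningMap (R.rep k) (matrixRep (R.sumGL ι))) = v k := by
  let φ := R.sumRepEquiv ι
  let F : Representation.IntertwiningMap (R.rep k) (R.sumRep v) →ₗ[ℂ]
      Representation.IntertwiningMap (R.rep k) (matrixRep (R.sumGL ι)) :=
    { toFun := fun f => φ.toIntertwiningMap.comp f
      map_add' := fun f f' => Representation.IntertwiningMap.ext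
        (LinearMap.ext fun u => map_add φ (f u) (f' u))
      map_smul' := fun c f => Representation.IntertwiningMap.ext
        (LinearMap.ext fun u => map_smul φ c (f u)) }
  have hF : Function.Bijective F := by
    constructor
    · intro f f' h
      refine Representation.IntertwiningMap.ext (LinearMap.ext fun u => ?_)
      exact φ.toLinearEquiv.injective (congrArg (fun f => f u) h)
    · intro f
      refine ⟨φ.symm.toIntertwiningMap.comp f, ?_⟩
      refine Representation.IntertwiningMap.ext (LinearMap.ext fun u => ?_)
      exact φ.apply_symm_apply (f u)
  rw [← R.finrank_intertwiningMap_sumRep v k]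
  exact (LinearEquiv.ofBijective F hF).finrank_eq.symm

/-- A representation with the multiplicities `v` is conjugate to the standard one. -/
theorem exists_conj_eq_sumGL [Finite G] (g : G →* GL (Fin r) ℂ)
    (hg : ∀ k, Module.finrank ℂ (Representation.IntertwiningMap (R.rep k) (matrixRep g)) = v k) :
    ∃ h : GL (Fin r) ℂ, ∀ x, h * g x = R.sumGL ι x * h := by
  obtain ⟨φ⟩ := R.exists_sumRep_equiv (matrixRep g) v hg
  let e : (matrixRep g).Equiv (matrixRep (R.sumGL ι)) := φ.symm.trans (R.sumRepEquiv ι)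
  let A : Matrix (Fin r) (Fin r) ℂ := LinearMap.toMatrix' e.toIntertwiningMap.toLinearMap
  let B : Matrix (Fin r) (Fin r) ℂ := LinearMap.toMatrix' e.symm.toIntertwiningMap.toLinearMap
  have hAB : A * B = 1 := by
    rw [← LinearMap.toMatrix'_mul, ← LinearMap.toMatrix'_one]
    exact congrArg _ (LinearMap.ext fun u => e.apply_symm_apply u)
  have hBA : B * A = 1 := by
    rw [← LinearMap.toMatrix'_mul, ← LinearMap.toMatrix'_one]
    exact congrArg _ (LinearMap.ext fun u => e.symm_apply_apply u)
  refine ⟨⟨A, B, hAB, hBA⟩, fun x => Units.ext ?_⟩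
  have h1 : ∀ (f : G →* GL (Fin r) ℂ), (f x).1 = LinearMap.toMatrix' (matrixRep f x) := fun f =>
    (LinearMap.toMatrix'_toLin' _).symm
  change A * (g x).1 = (R.sumGL ι x).1 * A
  rw [h1, h1, ← LinearMap.toMatrix'_mul, ← LinearMap.toMatrix'_mul]
  exact congrArg _ (e.toIntertwiningMap.isIntertwining' x)

end IrrepList
end

noncomputable section

/-! ### From the quiver to the Calogero–Moser space -/

namespace CalogeroMoser

variable {r : ℕ}

/-- The pair `(B_1, B_2)`. -/
def operators (y : Space r) : Fin 2 → Matrix (Fin r) (Fin r) ℂ := ![y.1, y.2.1]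

theorem ext_operators {y z : Space r} (h : ∀ s, operators y s = operators z s)
    (hi : y.2.2.1 = z.2.2.1) (hj : y.2.2.2 = z.2.2.2) : y = z :=
  Prod.ext (h 0) (Prod.ext (h 1) (Prod.ext hi hj))

theorem operators_act (g : GL (Fin r) ℂ) (y : Space r) (s : Fin 2) :
    operators (act g y) s = g.1 * operators y s * g⁻¹.1 := by
  fin_cases s <;> rfl

theorem operators_twist (γ : SL(2, ℂ)) (y : Space r) (s : Fin 2) :
    operators (twist γ y) s = ∑ t, γ.1 t s • operators y t := by
  rw [Fin.sum_univ_two]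
  fin_cases s <;> rfl

theorem act_eq_twist_iff (g : GL (Fin r) ℂ) (γ : SL(2, ℂ)) (y : Space r) :
    act g y = twist γ y ↔
      (∀ s, g.1 * operators y s = ∑ t, γ.1 t s • (operators y t * g.1)) ∧
        g.1 * y.2.2.1 = y.2.2.1 ∧ y.2.2.2 * g.1 = y.2.2.2 := by
  have h1 : ∀ s, g.1 * operators y s * g⁻¹.1 = ∑ t, γ.1 t s • operators y t ↔
      g.1 * operators y s = ∑ t, γ.1 t s • (operators y t * g.1) := by
    intro s
    have h2 : ∑ t, γ.1 t s • (operators y t * g.1) = (∑ t, γ.1 t s • operators y t) * g.1 := by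
      rw [Finset.sum_mul]
      simp only [smul_mul_assoc]
    rw [h2, Units.mul_inv_eq_iff_eq_mul]
  have h3 : y.2.2.2 * g⁻¹.1 = y.2.2.2 ↔ y.2.2.2 * g.1 = y.2.2.2 := by
    constructor <;> intro h
    · rw [← h, Matrix.mul_assoc, Units.inv_mul, Matrix.mul_one, h]
    · rw [← h, Matrix.mul_assoc, Units.mul_inv, Matrix.mul_one, h]
  constructor
  · intro h
    refine ⟨fun s => (h1 s).1 ?_, congrArg (fun z => z.2.2.1) h,
      h3.1 (congrArg (fun z => z.2.2.2) h)⟩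
    rw [← operators_act, h, operators_twist]
  · rintro ⟨ho, hi, hj⟩
    refine ext_operators (fun s => ?_) hi (h3.2 hj)
    rw [operators_act, operators_twist, (h1 s).2 (ho s)]

end CalogeroMoser

/-! ### Comparison of the two moment maps. -/

namespace IrrepList

theorem bracket_sum_smul {a b c : ℕ} {H' H : Type} [Fintype H'] [Fintype H] (x' : H' → ℂ)
    (x : H → ℂ) (β' : H' → Fin 2 → Matrix (Fin a) (Fin b) ℂ)
    (β : H → Fin 2 → Matrix (Fin b) (Fin c) ℂ) :
    bracket (∑ h, x' h • β' h) (∑ h, x h • β h) =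
      ∑ h', ∑ h, (x' h' * x h) • bracket (β' h') (β h) := by
  have h : ∀ s t, (∑ h, x' h • β' h) s * (∑ h, x h • β h) t =
      ∑ h', ∑ h, (x' h' * x h) • (β' h' s * β h t) := fun s t => by
    rw [Finset.sum_apply, Finset.sum_apply, Matrix.sum_mul]
    refine Finset.sum_congr rfl fun h' _ => ?_
    rw [Matrix.mul_sum]
    refine Finset.sum_congr rfl fun h _ => ?_
    rw [Pi.smul_apply, Pi.smul_apply, Matrix.smul_mul, Matrix.mul_smul, smul_smul]
  simp only [bracket, h, smul_sub, Finset.sum_sub_distrib]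

section EdgeMatrices

variable {d : ℕ} {m : Fin d → Fin d → ℕ} {v w : Fin d → ℕ}

/-- The matrices of a point of `𝐌(v, w)` at all edges from `k` to `l`. -/
def edgeMatrix (x : QuiverVariety.Space m v w) (k l : Fin d) :
    Fin (m k l) ⊕ Fin (m l k) → Matrix (Fin (v l)) (Fin (v k)) ℂ :=
  Sum.elim (x.1 k l) (x.2.1 l k)

/-- Paths of length two based at `k` go out along `h` and return along `h.swap`; the sign is that of
the returning edge, which is the one ending at `k`. -/
theorem momentC_eq_sum_edgeMatrix (x : QuiverVariety.Space m v w) (k : Fin d) :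
    QuiverVariety.momentC x k = (∑ l, ∑ h : Fin (m k l) ⊕ Fin (m l k),
      (edgeSign h.swap) • (edgeMatrix x l k h.swap * edgeMatrix x k l h)) +
        x.2.2.1 k * x.2.2.2 k := by
  simp only [Fintype.sum_sum_type, edgeMatrix, edgeSign, Sum.swap_inl, Sum.swap_inr, Sum.elim_inl,
    Sum.elim_inr, Finset.sum_add_distrib, one_smul, neg_smul, Finset.sum_neg_distrib,
    QuiverVariety.momentC]
  abel

theorem edgeMatrix_act (g : ∀ k, GL (Fin (v k)) ℂ)
    (x : QuiverVariety.Space m v w) (k l : Fin d) (h : Fin (m k l) ⊕ Fin (m l k)) :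
    edgeMatrix (QuiverVariety.act g x) k l h = (g l).1 * edgeMatrix x k l h * (g k)⁻¹.1 := by
  rcases h with a | a <;> rfl

end EdgeMatrices

variable {Γ : Subgroup SL(2, ℂ)} {d r : ℕ} [NeZero d] {R : IrrepList Γ d} {m : Fin d → Fin d → ℕ}
  {v : Fin d → ℕ} (b : R.ArrowBasis m) (ι : (Σ k, Fin (v k) × Fin (R.deg k)) ≃ Fin r)

/-- The pairs of blocks of `(B_1, B_2)`. -/
def blockPair (y : CalogeroMoser.Space r) (k l : Fin d) (p : Fin (v k)) (q : Fin (v l)) :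
    Fin 2 → Matrix (Fin (R.deg k)) (Fin (R.deg l)) ℂ :=
  fun s => (CalogeroMoser.operators y s).submatrix (place ι k p) (place ι l q)

theorem commutator_submatrix (y : CalogeroMoser.Space r) (k' k : Fin d) (p : Fin (v k'))
    (q : Fin (v k)) :
    (y.1 * y.2.1 - y.2.1 * y.1).submatrix (place ι k' p) (place ι k q) =
      ∑ l, ∑ p', bracket (blockPair ι y k' l p p') (blockPair ι y l k p' q) := by
  rw [Matrix.submatrix_sub, Pi.sub_apply, Pi.sub_apply, submatrix_mul_place ι,
    submatrix_mul_place ι]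
  simp only [← Finset.sum_sub_distrib]
  rfl

/-- The linear map which sends `(B, i, j)` to the corresponding endomorphisms of
`⨁ V_k ⊗ R_k`. -/
def toCM : QuiverVariety.Space m v (framingZero d) →ₗ[ℂ] CalogeroMoser.Space r where
  toFun x :=
    (ofBlocks ι fun l k p q => ∑ h, edgeMatrix x k l h p q • b.arrow k l h 0,
      ofBlocks ι fun l k p q => ∑ h, edgeMatrix x k l h p q • b.arrow k l h 1,
      Matrix.of fun i _ => ∑ f, x.2.2.1 (ι.symm i).1 (ι.symm i).2.1 f,
      Matrix.of fun _ i => ∑ f, x.2.2.2 (ι.symm i).1 f (ι.symm i).2.1)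
  map_add' x y := by
    have h : ∀ k l (h : Fin (m k l) ⊕ Fin (m l k)),
        edgeMatrix (x + y) k l h = edgeMatrix x k l h + edgeMatrix y k l h := by
      rintro k l (a | a) <;> rfl
    have h1 : ∀ s l k (p : Fin (v l)) (q : Fin (v k)),
        ∑ h, edgeMatrix (x + y) k l h p q • b.arrow k l h s =
          ∑ h, edgeMatrix x k l h p q • b.arrow k l h s +
            ∑ h, edgeMatrix y k l h p q • b.arrow k l h s := fun s l k p q => by
      simp only [h, Matrix.add_apply, add_smul, Finset.sum_add_distrib]
    refine Prod.ext ?_ (Prod.ext ?_ (Prod.ext ?_ ?_))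
    · exact congrArg (ofBlocks ι) (funext₂ fun l k => funext₂ fun p q => h1 0 l k p q)
    · exact congrArg (ofBlocks ι) (funext₂ fun l k => funext₂ fun p q => h1 1 l k p q)
    · refine Matrix.ext fun i j => ?_
      change ∑ f, (x.2.2.1 (ι.symm i).1 (ι.symm i).2.1 f + y.2.2.1 (ι.symm i).1 (ι.symm i).2.1 f) =
        ∑ f, x.2.2.1 (ι.symm i).1 (ι.symm i).2.1 f + ∑ f, y.2.2.1 (ι.symm i).1 (ι.symm i).2.1 f
      exact Finset.sum_add_distrib
    · refine Matrix.ext fun i j => ?_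
      change ∑ f, (x.2.2.2 (ι.symm j).1 f (ι.symm j).2.1 + y.2.2.2 (ι.symm j).1 f (ι.symm j).2.1) =
        ∑ f, x.2.2.2 (ι.symm j).1 f (ι.symm j).2.1 + ∑ f, y.2.2.2 (ι.symm j).1 f (ι.symm j).2.1
      exact Finset.sum_add_distrib
  map_smul' c x := by
    have h : ∀ k l (h : Fin (m k l) ⊕ Fin (m l k)),
        edgeMatrix (c • x) k l h = c • edgeMatrix x k l h := by
      rintro k l (a | a) <;> rfl
    have h1 : ∀ s l k (p : Fin (v l)) (q : Fin (v k)),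
        ∑ h, edgeMatrix (c • x) k l h p q • b.arrow k l h s =
          c • ∑ h, edgeMatrix x k l h p q • b.arrow k l h s := fun s l k p q => by
      simp only [h, Matrix.smul_apply, smul_assoc, Finset.smul_sum]
    refine Prod.ext ?_ (Prod.ext ?_ (Prod.ext ?_ ?_))
    · exact congrArg (ofBlocks ι) (funext₂ fun l k => funext₂ fun p q => h1 0 l k p q)
    · exact congrArg (ofBlocks ι) (funext₂ fun l k => funext₂ fun p q => h1 1 l k p q)
    · refine Matrix.ext fun i j => ?_
      change ∑ f, c * x.2.2.1 (ι.symm i).1 (ι.symm i).2.1 f =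
        c * ∑ f, x.2.2.1 (ι.symm i).1 (ι.symm i).2.1 f
      exact (Finset.mul_sum _ _ _).symm
    · refine Matrix.ext fun i j => ?_
      change ∑ f, c * x.2.2.2 (ι.symm j).1 f (ι.symm j).2.1 =
        c * ∑ f, x.2.2.2 (ι.symm j).1 f (ι.symm j).2.1
      exact (Finset.mul_sum _ _ _).symm

theorem blockPair_toCM (x : QuiverVariety.Space m v (framingZero d)) (l k : Fin d) (p : Fin (v l))
    (q : Fin (v k)) :
    blockPair ι (toCM b ι x) l k p q = ∑ h, edgeMatrix x k l h p q • b.arrow k l h := by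
  funext s
  rw [Finset.sum_apply]
  fin_cases s
  · exact ofBlocks_submatrix ι (fun l k p q => ∑ h, edgeMatrix x k l h p q • b.arrow k l h 0) l k p q
  · exact ofBlocks_submatrix ι (fun l k p q => ∑ h, edgeMatrix x k l h p q • b.arrow k l h 1) l k p q

theorem toCM_framing_in (x : QuiverVariety.Space m v (framingZero d)) (k : Fin d) (p : Fin (v k)) :
    (toCM b ι x).2.2.1.submatrix (place ι k p) id = Matrix.of fun _ _ => ∑ f, x.2.2.1 k p f := by
  ext α j
  exact congrArg (fun s : Σ k, Fin (v k) × Fin (R.deg k) => ∑ f, x.2.2.1 s.1 s.2.1 f)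
    (ι.symm_apply_apply ⟨k, p, α⟩)

theorem toCM_framing_out (x : QuiverVariety.Space m v (framingZero d)) (k : Fin d)
    (p : Fin (v k)) :
    (toCM b ι x).2.2.2.submatrix id (place ι k p) = Matrix.of fun _ _ => ∑ f, x.2.2.2 k f p := by
  ext j α
  exact congrArg (fun s : Σ k, Fin (v k) × Fin (R.deg k) => ∑ f, x.2.2.2 s.1 f s.2.1)
    (ι.symm_apply_apply ⟨k, p, α⟩)

theorem isEmpty_framing {k : Fin d} (hk : k ≠ 0) : IsEmpty (Fin (framingZero d k)) := by
  rw [framingZero, Pi.single_eq_of_ne hk]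
  infer_instance

instance subsingleton_framing (k : Fin d) : Subsingleton (Fin (framingZero d k)) := by
  rcases eq_or_ne k 0 with rfl | hk
  · rw [framingZero, Pi.single_eq_same]
    infer_instance
  · have := isEmpty_framing hk
    infer_instance

theorem sum_framing (k : Fin d) (φ : Fin (framingZero d k) → ℂ) (f : Fin (framingZero d k)) :
    ∑ f, φ f = φ f := by
  refine Finset.sum_eq_single f (fun f' _ h => absurd (Subsingleton.elim f' f) h) fun h => ?_
  exact absurd (Finset.mem_univ f) h

/-- The element of the framing at the vertex `0`. -/
def framingPoint : Fin (framingZero d 0) := ⟨0, by rw [framingZero, Pi.single_eq_same]; exact one_pos⟩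

instance subsingleton_deg_zero : Subsingleton (Fin (R.deg 0)) := by
  rw [R.deg_zero]
  infer_instance

theorem framing_submatrix (x : QuiverVariety.Space m v (framingZero d)) (k' k : Fin d)
    (p : Fin (v k')) (q : Fin (v k)) :
    ((toCM b ι x).2.2.1 * (toCM b ι x).2.2.2).submatrix (place ι k' p) (place ι k q) =
      Matrix.of fun _ _ => (∑ f, x.2.2.1 k' p f) * ∑ f, x.2.2.2 k f q := by
  ext α β
  have h1 := congrFun (congrFun (toCM_framing_in b ι x k' p) α) 0
  have h2 := congrFun (congrFun (toCM_framing_out b ι x k q) 0) β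
  simp only [Matrix.submatrix_apply, id, Matrix.of_apply] at h1 h2
  rw [Matrix.submatrix_apply, Matrix.mul_apply, Fin.sum_univ_one, h1, h2, Matrix.of_apply]

theorem framing_submatrix_of_ne (x : QuiverVariety.Space m v (framingZero d)) {k' k : Fin d}
    (hk : k' ≠ k) (p : Fin (v k')) (q : Fin (v k)) :
    ((toCM b ι x).2.2.1 * (toCM b ι x).2.2.2).submatrix (place ι k' p) (place ι k q) = 0 := by
  rw [framing_submatrix]
  ext α β
  rw [Matrix.of_apply, Matrix.zero_apply]
  rcases eq_or_ne k' 0 with rfl | hk'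
  · have := isEmpty_framing hk.symm
    rw [Finset.univ_eq_empty (α := Fin (framingZero d k)), Finset.sum_empty, mul_zero]
  · have := isEmpty_framing hk'
    rw [Finset.univ_eq_empty (α := Fin (framingZero d k')), Finset.sum_empty, zero_mul]

/-- The framing is nonzero only at the vertex 0, where `R_0` has dimension one, so dividing by the
degree changes nothing there. -/
theorem framing_submatrix_self (x : QuiverVariety.Space m v (framingZero d)) (k : Fin d)
    (p q : Fin (v k)) :
    ((toCM b ι x).2.2.1 * (toCM b ι x).2.2.2).submatrix (place ι k p) (place ι k q) =
      ((x.2.2.1 k * x.2.2.2 k) p q / R.deg k) • 1 := by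
  rw [framing_submatrix, Matrix.mul_apply]
  ext α β
  rw [Matrix.of_apply, Matrix.smul_apply, smul_eq_mul]
  rcases eq_or_ne k 0 with rfl | hk
  · have hdeg : (R.deg 0 : ℂ) = 1 := by rw [R.deg_zero, Nat.cast_one]
    rw [sum_framing 0 _ framingPoint, sum_framing 0 _ framingPoint, sum_framing 0 _ framingPoint,
      hdeg, div_one, Subsingleton.elim α β, Matrix.one_apply_eq, mul_one]
  · have := isEmpty_framing hk
    rw [Finset.univ_eq_empty (α := Fin (framingZero d k)), Finset.sum_empty, Finset.sum_empty,
      zero_mul, Finset.sum_empty, zero_div, zero_mul]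

theorem moment_submatrix_of_ne (x : QuiverVariety.Space m v (framingZero d)) {k' k : Fin d}
    (hk : k' ≠ k) (p : Fin (v k')) (q : Fin (v k)) :
    ((toCM b ι x).1 * (toCM b ι x).2.1 - (toCM b ι x).2.1 * (toCM b ι x).1 +
      (toCM b ι x).2.2.1 * (toCM b ι x).2.2.2).submatrix (place ι k' p) (place ι k q) = 0 := by
  rw [Matrix.submatrix_add, Pi.add_apply, Pi.add_apply, framing_submatrix_of_ne b ι x hk, add_zero,
    commutator_submatrix ι]
  simp only [blockPair_toCM, bracket_sum_smul, b.bracket_arrow _ _ hk.symm, smul_zero,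
    Finset.sum_const_zero]

/-- Expand the commutator in products of two arrows: by duality only an edge followed by its reverse
survives, with the sign of the moment map and the factor `1 / deg k`. -/
theorem moment_submatrix_self (x : QuiverVariety.Space m v (framingZero d)) (k : Fin d)
    (p q : Fin (v k)) :
    ((toCM b ι x).1 * (toCM b ι x).2.1 - (toCM b ι x).2.1 * (toCM b ι x).1 +
      (toCM b ι x).2.2.1 * (toCM b ι x).2.2.2).submatrix (place ι k p) (place ι k q) =
        (QuiverVariety.momentC x k p q / R.deg k) • 1 := by
  rw [Matrix.submatrix_add, Pi.add_apply, Pi.add_apply, framing_submatrix_self b ι x,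
    commutator_submatrix ι, momentC_eq_sum_edgeMatrix, Matrix.add_apply, add_div, add_smul]
  congr 1
  simp only [blockPair_toCM, bracket_sum_smul, b.bracket_arrow_self, Matrix.sum_apply,
    Matrix.smul_apply, Matrix.mul_apply, Finset.sum_div, Finset.sum_smul, smul_eq_mul,
    Finset.mul_sum, smul_smul]
  refine Finset.sum_congr rfl fun l _ => ?_
  rw [Finset.sum_comm (s := Finset.univ (α := Fin (m k l) ⊕ Fin (m l k)))]
  refine Finset.sum_congr rfl fun p' _ => ?_
  rw [Finset.sum_comm]
  refine Finset.sum_congr rfl fun h _ => ?_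
  rw [Finset.sum_eq_single h.swap]
  · rw [if_pos rfl]
    congr 1
    ring
  · intro h' _ hne
    rw [if_neg hne, zero_div, mul_zero, zero_smul]
  · simp

/-- The factor `dim R_k` in `graphParameter` cancels the `1 / deg k` of the diagonal blocks, and
blocks between different irreducibles vanish. -/
theorem toCM_mem_level_iff (τ : ℂ) (x : QuiverVariety.Space m v (framingZero d)) :
    toCM b ι x ∈ CalogeroMoser.level r τ ↔
      x ∈ QuiverVariety.levelC m v (framingZero d) (graphParameter R.deg fun _ => τ) := by
  have hdeg : ∀ k, (R.deg k : ℂ) ≠ 0 := fun k => Nat.cast_ne_zero.2 (R.deg_pos k).ne'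
  have hscalar : -(τ • (1 : Matrix (Fin r) (Fin r) ℂ)) =
      diagBlocks ι fun k p q => if p = q then (-τ) • 1 else 0 := by
    rw [← neg_smul, ← diagBlocks_one ι]
    refine eq_diagBlocks ι (fun k l p q hkl => ?_) fun k p q => ?_
    · rw [Matrix.submatrix_smul, Pi.smul_apply, Pi.smul_apply, diagBlocks_submatrix_of_ne ι _ hkl,
        smul_zero]
    · rw [Matrix.submatrix_smul, Pi.smul_apply, Pi.smul_apply, diagBlocks_submatrix_self]
      split_ifs <;> simp
  have hone : ∀ k p q, QuiverVariety.momentC x k p q =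
      (-(graphParameter R.deg (fun _ => τ) k • (1 : Matrix (Fin (v k)) (Fin (v k)) ℂ))) p q ↔
      QuiverVariety.momentC x k p q / R.deg k = if p = q then -τ else 0 := by
    intro k p q
    rw [div_eq_iff (hdeg k), Matrix.neg_apply, Matrix.smul_apply, Matrix.one_apply]
    split_ifs <;> simp [graphParameter, mul_comm]
  constructor
  · intro h k
    ext p q
    rw [hone]
    have h1 := moment_submatrix_self b ι x k p q
    have h2 : _ = _ := h
    rw [h2, hscalar, diagBlocks_submatrix_self] at h1
    have h3 := congrFun (congrFun h1 ⟨0, R.deg_pos k⟩) ⟨0, R.deg_pos k⟩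
    rw [Matrix.smul_apply, Matrix.one_apply_eq, smul_eq_mul, mul_one] at h3
    rw [← h3]
    split_ifs <;> simp
  · intro h
    change _ = _
    rw [hscalar]
    refine eq_diagBlocks ι (fun k l p q hkl => moment_submatrix_of_ne b ι x hkl p q)
      fun k p q => ?_
    rw [moment_submatrix_self, (hone k p q).1 (by rw [h k])]
    split_ifs <;> simp

end IrrepList
end

noncomputable section

/-! ### Equivariant points of the Calogero–Moser space -/

namespace IrrepList

variable {Γ : Subgroup SL(2, ℂ)} {d r : ℕ} [NeZero d] {R : IrrepList Γ d} {m : Fin d → Fin d → ℕ}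
  {v : Fin d → ℕ} (b : R.ArrowBasis m) (ι : (Σ k, Fin (v k) × Fin (R.deg k)) ≃ Fin r)

theorem ext_blockPair {y z : CalogeroMoser.Space r}
    (h : ∀ l k p q, blockPair ι y l k p q = blockPair ι z l k p q)
    (hi : ∀ k p, y.2.2.1.submatrix (place ι k p) id = z.2.2.1.submatrix (place ι k p) id)
    (hj : ∀ k p, y.2.2.2.submatrix id (place ι k p) = z.2.2.2.submatrix id (place ι k p)) :
    y = z :=
  CalogeroMoser.ext_operators (fun s => ext_blocks ι fun l k p q => congrFun (h l k p q) s)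
    (ext_rows ι hi) (ext_columns ι hj)

theorem toCM_injective : Function.Injective (toCM (r := r) b ι) := by
  intro x y hxy
  have h1 : ∀ k l h, edgeMatrix x k l h = edgeMatrix y k l h := fun k l h => by
    ext p q
    have h2 : edgeSign h.swap * edgeMatrix x k l h p q =
        edgeSign h.swap * edgeMatrix y k l h p q := by
      rw [← b.pairing_sum k l (fun h => edgeMatrix x k l h p q),
        ← b.pairing_sum k l (fun h => edgeMatrix y k l h p q), ← blockPair_toCM b ι x,
        ← blockPair_toCM b ι y, hxy]
    have h3 := congrArg (edgeSign h.swap * ·) h2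
    simpa only [← mul_assoc, edgeSign_mul_self, one_mul] using h3
  refine Prod.ext ?_ (Prod.ext ?_ (Prod.ext ?_ ?_))
  · exact funext₂ fun k l => funext fun a => h1 k l (Sum.inl a)
  · exact funext₂ fun k l => funext fun a => h1 l k (Sum.inr a)
  · refine funext fun k => Matrix.ext fun p f => ?_
    have h2 := toCM_framing_in b ι x k p
    rw [hxy, toCM_framing_in] at h2
    have h3 := congrFun (congrFun h2 ⟨0, R.deg_pos k⟩) 0
    rw [Matrix.of_apply, Matrix.of_apply, sum_framing _ _ f, sum_framing _ _ f] at h3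
    exact h3.symm
  · refine funext fun k => Matrix.ext fun f p => ?_
    have h2 := toCM_framing_out b ι x k p
    rw [hxy, toCM_framing_out] at h2
    have h3 := congrFun (congrFun h2 0) ⟨0, R.deg_pos k⟩
    rw [Matrix.of_apply, Matrix.of_apply, sum_framing _ _ f, sum_framing _ _ f] at h3
    exact h3.symm

/-- The standard action is block diagonal, so the fixed point equations decouple into equations for
single blocks. -/
theorem act_sumGL_eq_twist_iff (y : CalogeroMoser.Space r) :
    (∀ g : Γ, CalogeroMoser.act (R.sumGL ι g) y = CalogeroMoser.twist g.1 y) ↔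
      (∀ l k p q, blockPair ι y l k p q ∈ R.arrowSpace k l) ∧
      (∀ k p g, R.mat k g * y.2.2.1.submatrix (place ι k p) id =
        y.2.2.1.submatrix (place ι k p) id) ∧
      ∀ k p g, y.2.2.2.submatrix id (place ι k p) * R.mat k g =
        y.2.2.2.submatrix id (place ι k p) := by
  have hsum : ∀ (g : Γ) s l k (p : Fin (v l)) (q : Fin (v k)),
      (∑ t, g.1.1 t s • (CalogeroMoser.operators y t * R.sumMat ι g)).submatrix
        (place ι l p) (place ι k q) =
      ∑ t, g.1.1 t s • (blockPair ι y l k p q t * R.mat k g) := fun g s l k p q => by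
    rw [Fin.sum_univ_two, Fin.sum_univ_two, Matrix.submatrix_add, Pi.add_apply, Pi.add_apply,
      Matrix.submatrix_smul, Matrix.submatrix_smul]
    simp only [Pi.smul_apply, mul_sumMat_submatrix]
    rfl
  simp only [CalogeroMoser.act_eq_twist_iff, sumGL_val]
  constructor
  · intro h
    refine ⟨fun l k p q g s => ?_, fun k p g => ?_, fun k p g => ?_⟩
    · rw [← hsum, ← (h g).1 s, sumMat_mul_submatrix]
      rfl
    · rw [← sumMat_mul_submatrix, (h g).2.1]
    · rw [← mul_sumMat_submatrix, (h g).2.2]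
  · rintro ⟨ho, hi, hj⟩ g
    refine ⟨fun s => ext_blocks ι fun l k p q => ?_, ext_rows ι fun k p => ?_,
      ext_columns ι fun k p => ?_⟩
    · rw [hsum, sumMat_mul_submatrix, ← ho l k p q g s]
      rfl
    · rw [sumMat_mul_submatrix, hi]
    · rw [mul_sumMat_submatrix, hj]

theorem act_sumGL_toCM (x : QuiverVariety.Space m v (framingZero d)) (g : Γ) :
    CalogeroMoser.act (R.sumGL ι g) (toCM b ι x) = CalogeroMoser.twist g.1 (toCM b ι x) := by
  refine (act_sumGL_eq_twist_iff ι _).2 ⟨fun l k p q => ?_, fun k p g => ?_, fun k p g => ?_⟩ g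
  · rw [blockPair_toCM]
    exact Submodule.sum_mem _ fun h _ => Submodule.smul_mem _ _ (b.mem k l h)
  · rcases eq_or_ne k 0 with rfl | hk
    · rw [mat_zero, Matrix.one_mul]
    · have := isEmpty_framing hk
      have h0 : (toCM b ι x).2.2.1.submatrix (place ι k p) id = 0 := by
        rw [toCM_framing_in]
        ext α β
        rw [Matrix.of_apply, Finset.univ_eq_empty (α := Fin (framingZero d k)), Finset.sum_empty,
          Matrix.zero_apply]
      rw [h0, Matrix.mul_zero]
  · rcases eq_or_ne k 0 with rfl | hk
    · rw [mat_zero, Matrix.mul_one]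
    · have := isEmpty_framing hk
      have h0 : (toCM b ι x).2.2.2.submatrix id (place ι k p) = 0 := by
        rw [toCM_framing_out]
        ext α β
        rw [Matrix.of_apply, Finset.univ_eq_empty (α := Fin (framingZero d k)), Finset.sum_empty,
          Matrix.zero_apply]
      rw [h0, Matrix.zero_mul]

/-- An invariant vector is an intertwiner from the trivial `R_0`, which vanishes by Schur's lemma.
-/
theorem column_eq_zero_of_invariant {k : Fin d} (hk : k ≠ 0)
    {M : Matrix (Fin (R.deg k)) (Fin 1) ℂ} (hM : ∀ g, R.mat k g * M = M) : M = 0 := by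
  have h := R.matrix_eq_zero_of_ne (k := 0) (l := k) hk.symm
    (M := M.submatrix id fun _ => 0) fun g => by
      rw [mat_zero, Matrix.mul_one]
      exact congrArg (fun M : Matrix (Fin (R.deg k)) (Fin 1) ℂ => M.submatrix id fun _ => 0) (hM g)
  ext α β
  rw [Subsingleton.elim β 0]
  exact congrFun (congrFun h α) ⟨0, R.deg_pos 0⟩

theorem row_eq_zero_of_invariant {k : Fin d} (hk : k ≠ 0)
    {M : Matrix (Fin 1) (Fin (R.deg k)) ℂ} (hM : ∀ g, M * R.mat k g = M) : M = 0 := by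
  have h := R.matrix_eq_zero_of_ne (k := k) (l := 0) hk
    (M := M.submatrix (fun _ => 0) id) fun g => by
      rw [mat_zero, Matrix.one_mul]
      exact (congrArg (fun M : Matrix (Fin 1) (Fin (R.deg k)) ℂ => M.submatrix (fun _ => 0) id)
        (hM g)).symm
  ext β α
  rw [Subsingleton.elim β 0]
  exact congrFun (congrFun h ⟨0, R.deg_pos 0⟩) α

/-- Equivariance puts every block pair into an arrow space, where its coefficients are found by
pairing with reversed arrows; the framing blocks are invariant, hence supported at the vertex 0. -/
theorem exists_toCM_eq {y : CalogeroMoser.Space r}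
    (hy : ∀ g : Γ, CalogeroMoser.act (R.sumGL ι g) y = CalogeroMoser.twist g.1 y) :
    ∃ x, toCM b ι x = y := by
  obtain ⟨ho, hi, hj⟩ := (act_sumGL_eq_twist_iff ι y).1 hy
  let coef : ∀ k l, Fin (m k l) ⊕ Fin (m l k) → Matrix (Fin (v l)) (Fin (v k)) ℂ := fun k l h =>
    Matrix.of fun p q => edgeSign h.swap *
      arrowPairing _ _ (b.arrow l k h.swap) (blockPair ι y l k p q)
  let x : QuiverVariety.Space m v (framingZero d) :=
    (fun k l a => coef k l (Sum.inl a), fun k l a => coef l k (Sum.inr a),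
      fun k => Matrix.of fun p _ => y.2.2.1 (place ι k p ⟨0, R.deg_pos k⟩) 0,
      fun k => Matrix.of fun _ p => y.2.2.2 0 (place ι k p ⟨0, R.deg_pos k⟩))
  have hx : ∀ k l h, edgeMatrix x k l h = coef k l h := by
    rintro k l (a | a) <;> rfl
  refine ⟨x, ext_blockPair ι (fun l k p q => ?_) (fun k p => ?_) fun k p => ?_⟩
  · rw [blockPair_toCM]
    simp only [hx, coef, Matrix.of_apply]
    exact b.sum_pairing (ho l k p q)
  · rw [toCM_framing_in]
    ext α β
    rw [Matrix.of_apply]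
    rcases eq_or_ne k 0 with rfl | hk
    · rw [sum_framing 0 _ framingPoint, Subsingleton.elim β 0]
      exact congrArg (fun α => y.2.2.1 (place ι 0 p α) 0) (Subsingleton.elim _ _)
    · have := isEmpty_framing hk
      rw [column_eq_zero_of_invariant hk (hi k p), Matrix.zero_apply,
        Finset.univ_eq_empty (α := Fin (framingZero d k)), Finset.sum_empty]
  · rw [toCM_framing_out]
    ext β α
    rw [Matrix.of_apply]
    rcases eq_or_ne k 0 with rfl | hk
    · rw [sum_framing 0 _ framingPoint, Subsingleton.elim β 0]
      exact congrArg (fun α => y.2.2.2 0 (place ι 0 p α)) (Subsingleton.elim _ _)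
    · have := isEmpty_framing hk
      rw [row_eq_zero_of_invariant hk (hj k p), Matrix.zero_apply,
        Finset.univ_eq_empty (α := Fin (framingZero d k)), Finset.sum_empty]

/-! ### Compatibility with the action of `∏ GL(V_k)`. -/

theorem spread_mul_submatrix {a a' : Type} (A : ∀ k, Matrix (Fin (v k)) (Fin (v k)) ℂ)
    (B : Matrix (Fin r) a ℂ) (k : Fin d) (p : Fin (v k)) (f : a' → a) :
    (spread ι A * B).submatrix (place ι k p) f =
      ∑ p', A k p p' • B.submatrix (place ι k p') f := by
  rw [spread, diagBlocks_mul_submatrix]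
  simp only [Matrix.smul_mul, Matrix.one_mul]

theorem mul_spread_submatrix {a a' : Type} (A : ∀ k, Matrix (Fin (v k)) (Fin (v k)) ℂ)
    (B : Matrix a (Fin r) ℂ) (k : Fin d) (q : Fin (v k)) (f : a' → a) :
    (B * spread ι A).submatrix f (place ι k q) =
      ∑ q', A k q' q • B.submatrix f (place ι k q') := by
  rw [spread, mul_diagBlocks_submatrix]
  simp only [Matrix.mul_smul, Matrix.mul_one]

theorem toCM_act (g : ∀ k, GL (Fin (v k)) ℂ) (x : QuiverVariety.Space m v (framingZero d)) :
    toCM b ι (QuiverVariety.act g x) = CalogeroMoser.act (spreadGL ι g) (toCM b ι x) := by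
  refine ext_blockPair ι (fun l k p q => ?_) (fun k p => ?_) fun k p => ?_
  · funext s
    have h1 : ∀ p' q', (CalogeroMoser.operators (toCM b ι x) s).submatrix (place ι l p')
        (place ι k q') = ∑ h, edgeMatrix x k l h p' q' • b.arrow k l h s := fun p' q' => by
      have h2 := congrFun (blockPair_toCM b ι x l k p' q') s
      rw [Finset.sum_apply] at h2
      exact h2
    have h3 : blockPair ι (CalogeroMoser.act (spreadGL ι g) (toCM b ι x)) l k p q s =
        ∑ q', (g k)⁻¹.1 q' q • ∑ p', (g l).1 p p' • ∑ h, edgeMatrix x k l h p' q' •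
          b.arrow k l h s := by
      simp only [← h1]
      rw [blockPair, CalogeroMoser.operators_act]
      refine (mul_spread_submatrix ι (fun k => (g k)⁻¹.1) _ k q _).trans ?_
      refine Finset.sum_congr rfl fun q' _ => congrArg _ ?_
      exact spread_mul_submatrix ι (fun k => (g k).1) _ l p _
    rw [h3, blockPair_toCM, Finset.sum_apply]
    simp only [Pi.smul_apply, edgeMatrix_act, Matrix.mul_apply, Finset.smul_sum, smul_smul,
      Finset.sum_mul, Finset.sum_smul]
    rw [Finset.sum_comm]
    refine Finset.sum_congr rfl fun q' _ => ?_
    rw [Finset.sum_comm]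
    refine Finset.sum_congr rfl fun p' _ => Finset.sum_congr rfl fun h _ => ?_
    congr 1
    ring
  · have h1 : (CalogeroMoser.act (spreadGL ι g) (toCM b ι x)).2.2.1.submatrix (place ι k p) id =
        ∑ p', (g k).1 p p' • Matrix.of fun _ _ => ∑ f, x.2.2.1 k p' f := by
      simp only [← toCM_framing_in b ι x]
      exact spread_mul_submatrix ι (fun k => (g k).1) _ k p _
    rw [h1, toCM_framing_in]
    ext α β
    rw [Matrix.sum_apply]
    simp only [Matrix.of_apply, Matrix.smul_apply, QuiverVariety.act, Matrix.mul_apply,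
      smul_eq_mul, Finset.mul_sum]
    exact Finset.sum_comm
  · have h1 : (CalogeroMoser.act (spreadGL ι g) (toCM b ι x)).2.2.2.submatrix id (place ι k p) =
        ∑ q', (g k)⁻¹.1 q' p • Matrix.of fun _ _ => ∑ f, x.2.2.2 k f q' := by
      simp only [← toCM_framing_out b ι x]
      exact mul_spread_submatrix ι (fun k => (g k)⁻¹.1) _ k p _
    rw [h1, toCM_framing_out]
    ext α β
    rw [Matrix.sum_apply]
    simp only [Matrix.of_apply, Matrix.smul_apply, QuiverVariety.act, Matrix.mul_apply,
      smul_eq_mul, Finset.mul_sum]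
    rw [Finset.sum_comm]
    exact Finset.sum_congr rfl fun q' _ => Finset.sum_congr rfl fun f _ => mul_comm _ _

end IrrepList
end

noncomputable section

/-! ### Cyclicity of the framing vector -/

namespace CalogeroMoser

variable {r : ℕ}

theorem act_act (g h : GL (Fin r) ℂ) (x : Space r) : act g (act h x) = act (g * h) x := by
  simp [act, Matrix.mul_assoc]

theorem act_one (x : Space r) : act 1 x = x := by
  simp [act]

theorem act_mem_level {τ : ℂ} (g : GL (Fin r) ℂ) {x : Space r} (hx : x ∈ level r τ) :
    act g x ∈ level r τ := by
  have hx' : _ = _ := hx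
  change g.1 * x.1 * g⁻¹.1 * (g.1 * x.2.1 * g⁻¹.1) - g.1 * x.2.1 * g⁻¹.1 * (g.1 * x.1 * g⁻¹.1) +
    g.1 * x.2.2.1 * (x.2.2.2 * g⁻¹.1) = _
  have h1 : ∀ A B : Matrix (Fin r) (Fin r) ℂ, g.1 * A * g⁻¹.1 * (g.1 * B * g⁻¹.1) =
      g.1 * (A * B) * g⁻¹.1 := fun A B => by
    have h2 : g⁻¹.1 * (g.1 * (B * g⁻¹.1)) = B * g⁻¹.1 := by
      rw [← Matrix.mul_assoc, Units.inv_mul, Matrix.one_mul]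
    simp only [Matrix.mul_assoc, h2]
  calc _ = g.1 * (x.1 * x.2.1 - x.2.1 * x.1 + x.2.2.1 * x.2.2.2) * g⁻¹.1 := by
        rw [h1, h1]
        simp only [Matrix.mul_add, Matrix.mul_sub, Matrix.add_mul, Matrix.sub_mul,
          Matrix.mul_assoc]
    _ = _ := by
        rw [hx', Matrix.mul_neg, Matrix.mul_smul, Matrix.mul_one, Matrix.neg_mul, Matrix.smul_mul,
          Units.mul_inv]

/-- The vectors obtained from the framing vector by words in `B_1` and `B_2`. -/
def word (x : Space r) : List (Fin 2) → Matrix (Fin r) (Fin 1) ℂ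
  | [] => x.2.2.1
  | s :: l => operators x s * word x l

theorem word_act (g : GL (Fin r) ℂ) (x : Space r) (l : List (Fin 2)) :
    word (act g x) l = g.1 * word x l := by
  induction l with
  | nil => rfl
  | cons s l ih =>
    rw [word, word, ih, operators_act, Matrix.mul_assoc, ← Matrix.mul_assoc g⁻¹.1, Units.inv_mul,
      Matrix.one_mul, Matrix.mul_assoc]

/-- The span `W` is stable under `B_1` and `B_2` and contains the image of `ij`, so on the quotient
the commutator equals `-τ`. -/
theorem span_word_eq_top {τ : ℂ} (hτ : τ ≠ 0) {x : Space r} (hx : x ∈ level r τ) :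
    Submodule.span ℂ (Set.range fun l i => word x l i 0) = ⊤ := by
  set W := Submodule.span ℂ (Set.range fun l i => word x l i 0) with hW
  have hinv : ∀ s, W ≤ W.comap (Matrix.toLin' (operators x s)) := fun s => by
    refine Submodule.span_le.2 ?_
    rintro _ ⟨l, rfl⟩
    refine Submodule.subset_span ⟨s :: l, ?_⟩
    funext i
    rfl
  let T : Fin 2 → Module.End ℂ ((Fin r → ℂ) ⧸ W) := fun s =>
    W.mapQ W (Matrix.toLin' (operators x s)) (hinv s)
  have hT : T 0 * T 1 - T 1 * T 0 = (-τ) • 1 := by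
    refine W.linearMap_qext (LinearMap.ext fun u => ?_)
    have h1 : ((Matrix.toLin' x.1) (Matrix.toLin' x.2.1 u) -
        (Matrix.toLin' x.2.1) (Matrix.toLin' x.1 u) + x.2.2.1.mulVec (x.2.2.2.mulVec u)) =
          (-τ) • u := by
      have hx' : _ = _ := hx
      have h2 := congrArg (fun M : Matrix (Fin r) (Fin r) ℂ => M.mulVec u) hx'
      simpa [Matrix.add_mulVec, Matrix.sub_mulVec, Matrix.neg_mulVec, Matrix.smul_mulVec] using h2
    have h2 : x.2.2.1.mulVec (x.2.2.2.mulVec u) ∈ W := by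
      have h3 : x.2.2.1.mulVec (x.2.2.2.mulVec u) =
          (x.2.2.2.mulVec u 0) • fun i => word x [] i 0 := by
        funext i
        rw [Matrix.mulVec, dotProduct, Fin.sum_univ_one, mul_comm]
        rfl
      rw [h3]
      exact W.smul_mem _ (Submodule.subset_span ⟨[], rfl⟩)
    change W.mkQ (Matrix.toLin' x.1 (Matrix.toLin' x.2.1 u)) -
      W.mkQ (Matrix.toLin' x.2.1 (Matrix.toLin' x.1 u)) = (-τ) • W.mkQ u
    rw [← map_smul, ← h1, map_add, map_sub, (W.mkQ_apply _).trans
      ((Submodule.Quotient.mk_eq_zero W).2 h2), add_zero]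
  -- A commutator has trace zero, so `τ` times the dimension of the quotient is zero.
  have htr := congrArg (LinearMap.trace ℂ _) hT
  rw [map_sub, LinearMap.trace_mul_comm, sub_self, map_smul, LinearMap.trace_one, smul_eq_mul,
    eq_comm, mul_eq_zero, neg_eq_zero, Nat.cast_eq_zero] at htr
  have h0 := htr.resolve_left hτ
  exact Submodule.Quotient.subsingleton_iff.1 (Module.finrank_zero_iff.1 h0)

/-- Words span, so a matrix is determined by its products with them. -/
theorem eq_of_mul_word_eq {τ : ℂ} (hτ : τ ≠ 0) {x : Space r} (hx : x ∈ level r τ)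
    {A B : Matrix (Fin r) (Fin r) ℂ} (h : ∀ l, A * word x l = B * word x l) : A = B := by
  refine Matrix.toLin'.injective (LinearMap.ext_on_range (span_word_eq_top hτ hx) fun l => ?_)
  funext i
  exact congrFun (congrFun (h l) i) 0

/-- The action of `GL_r` on the level set is free. -/
theorem act_left_cancel {τ : ℂ} (hτ : τ ≠ 0) {x : Space r} (hx : x ∈ level r τ)
    {g h : GL (Fin r) ℂ} (hgh : act g x = act h x) : g = h :=
  Units.ext (eq_of_mul_word_eq hτ hx fun l => by rw [← word_act, hgh, word_act])

/-- The matrix whose columns are given by words in `B_1` and `B_2`. -/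
def frame (w : Fin r → List (Fin 2)) (x : Space r) : Matrix (Fin r) (Fin r) ℂ :=
  Matrix.of fun i a => word x (w a) i 0

theorem frame_act (w : Fin r → List (Fin 2)) (g : GL (Fin r) ℂ) (x : Space r) :
    frame w (act g x) = g.1 * frame w x := by
  ext i a
  rw [frame, Matrix.of_apply, word_act]
  rfl

/-- A basis of `ℂ^r` can be extracted from the spanning family of words. -/
theorem exists_det_frame_ne_zero {τ : ℂ} (hτ : τ ≠ 0) {x : Space r} (hx : x ∈ level r τ) :
    ∃ w, (frame w x).det ≠ 0 := by
  obtain ⟨f, hf, -, hlin⟩ := Submodule.exists_fun_fin_finrank_span_eq ℂ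
    (Set.range fun l i => word x l i 0)
  have hr : Module.finrank ℂ (Submodule.span ℂ (Set.range fun l i => word x l i 0)) = r := by
    rw [span_word_eq_top hτ hx, finrank_top, Module.finrank_fin_fun]
  choose w hw using hf
  refine ⟨fun a => w (Fin.cast hr.symm a), ?_⟩
  have h1 : LinearIndependent ℂ (frame (fun a => w (Fin.cast hr.symm a)) x).col := by
    have h2 : (frame (fun a => w (Fin.cast hr.symm a)) x).col = f ∘ Fin.cast hr.symm := by
      funext a
      rw [Function.comp_apply, ← hw]
      rfl
    rw [h2]
    exact hlin.comp _ (Fin.cast_injective _)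
  exact ((Matrix.isUnit_iff_isUnit_det _).1
    (Matrix.linearIndependent_cols_iff_isUnit.1 h1)).ne_zero

end CalogeroMoser
end

noncomputable section

/-! ### Matrices of rational functions -/

section RationalMatrices

variable {E : Type} [AddCommGroup E] [Module ℂ E] {a b c : Type}

/-- The entries of the matrix are regular functions on `D`. -/
def RationalMatrixOn (D : Set E) (M : E → Matrix a b ℂ) : Prop :=
  ∀ i j, (fun x => M x i j) ∈ rationalOn D

namespace RationalMatrixOn

variable {D : Set E}

theorem const (M : Matrix a b ℂ) : RationalMatrixOn D fun _ => M := fun i j =>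
  Subalgebra.algebraMap_mem (rationalOn D) (M i j)

theorem add {M N : E → Matrix a b ℂ} (hM : RationalMatrixOn D M) (hN : RationalMatrixOn D N) :
    RationalMatrixOn D fun x => M x + N x := fun i j => add_mem (hM i j) (hN i j)

theorem smul (z : ℂ) {M : E → Matrix a b ℂ} (hM : RationalMatrixOn D M) :
    RationalMatrixOn D fun x => z • M x := fun i j => Subalgebra.smul_mem _ (hM i j) z

theorem sum {s : Type} [Fintype s] {M : s → E → Matrix a b ℂ}
    (hM : ∀ k, RationalMatrixOn D (M k)) : RationalMatrixOn D fun x => ∑ k, M k x := fun i j => by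
  have h : (fun x => (∑ k, M k x) i j) = ∑ k, fun x => M k x i j := by
    funext x
    rw [Matrix.sum_apply, Finset.sum_apply]
  rw [h]
  exact sum_mem fun k _ => hM k i j

theorem mul [Fintype b] {M : E → Matrix a b ℂ} {N : E → Matrix b c ℂ}
    (hM : RationalMatrixOn D M) (hN : RationalMatrixOn D N) :
    RationalMatrixOn D fun x => M x * N x := fun i j => by
  have h : (fun x => (M x * N x) i j) = ∑ k, (fun x => M x i k) * fun x => N x k j := by
    funext x
    rw [Matrix.mul_apply, Finset.sum_apply]
    rfl
  rw [h]
  exact sum_mem fun k _ => mul_mem (hM i k) (hN k j)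

theorem det [Fintype a] [DecidableEq a] {M : E → Matrix a a ℂ} (hM : RationalMatrixOn D M) :
    (fun x => (M x).det) ∈ rationalOn D := by
  have h : (fun x => (M x).det) = ∑ s : Equiv.Perm a,
      algebraMap ℂ (E → ℂ) (Equiv.Perm.sign s : ℤ) * ∏ i, fun x => M x (s i) i := by
    funext x
    rw [Matrix.det_apply', Finset.sum_apply]
    refine Finset.sum_congr rfl fun s _ => ?_
    rw [Pi.mul_apply, Finset.prod_apply]
    rfl
  rw [h]
  exact sum_mem fun s _ => mul_mem (Subalgebra.algebraMap_mem _ _)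
    (prod_mem fun i _ => hM (s i) i)

/-- Cramer's rule: an entry of the adjugate is the determinant with one row replaced by a unit
vector. -/
theorem inv [Fintype a] [DecidableEq a] {M : E → Matrix a a ℂ} (hM : RationalMatrixOn D M)
    (hdet : ∀ x ∈ D, (M x).det ≠ 0) : RationalMatrixOn D fun x => (M x)⁻¹ := fun i j => by
  have hadj : RationalMatrixOn D fun x => (M x).updateRow j (Pi.single i 1) := fun i' j' => by
    rcases eq_or_ne i' j with rfl | h
    · simp only [Matrix.updateRow_self]
      exact Subalgebra.algebraMap_mem (rationalOn D) ((Pi.single i (1 : ℂ) : a → ℂ) j')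
    · simp only [Matrix.updateRow_ne h]
      exact hM i' j'
  have h : (fun x => (M x)⁻¹ i j) =
      (fun x => (M x).det⁻¹) * fun x => ((M x).updateRow j (Pi.single i 1)).det := by
    funext x
    rw [Matrix.inv_def, Matrix.smul_apply, Matrix.adjugate_apply, Ring.inverse_eq_inv']
    rfl
  rw [h]
  exact mul_mem (inv_mem_rationalOn hM.det hdet) hadj.det

theorem rationalMapOn [Finite a] [Finite b] {M : E → Matrix a b ℂ} (hM : RationalMatrixOn D M) :
    RationalMapOn D M := fun φ => by
  classical
  have := Fintype.ofFinite a
  have := Fintype.ofFinite b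
  have h : (fun x => φ (M x)) = ∑ i, ∑ j, φ (Matrix.single i j 1) • fun x => M x i j := by
    funext x
    conv_lhs => rw [Matrix.matrix_eq_sum_single (M x)]
    simp only [map_sum, Finset.sum_apply, Pi.smul_apply]
    refine Finset.sum_congr rfl fun i _ => Finset.sum_congr rfl fun j _ => ?_
    rw [smul_eq_mul, mul_comm, ← smul_eq_mul, ← map_smul, Matrix.smul_single, smul_eq_mul, mul_one]
  rw [h]
  exact sum_mem fun i _ => sum_mem fun j _ => Subalgebra.smul_mem _ (hM i j) _

theorem of_isLinearMap {M : E → Matrix a b ℂ} (hM : IsLinearMap ℂ M) : RationalMatrixOn D M :=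
  fun i j => polynomialFunctionAlgebra_le_rationalOn D
    (dual_mem_polynomialFunctionAlgebra (Matrix.entryLinearMap ℂ ℂ i j ∘ₗ hM.mk'))

end RationalMatrixOn

theorem RationalMapOn.prodMk {E₁ E₂ : Type} [AddCommGroup E₁] [Module ℂ E₁] [AddCommGroup E₂]
    [Module ℂ E₂] {D : Set E} {σ : E → E₁} {ρ : E → E₂} (hσ : RationalMapOn D σ)
    (hρ : RationalMapOn D ρ) : RationalMapOn D fun x => (σ x, ρ x) := fun φ => by
  have h : (fun x => φ (σ x, ρ x)) = (fun x => (φ ∘ₗ LinearMap.inl ℂ E₁ E₂) (σ x)) +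
      fun x => (φ ∘ₗ LinearMap.inr ℂ E₁ E₂) (ρ x) := by
    funext x
    rw [Pi.add_apply, LinearMap.comp_apply, LinearMap.comp_apply, ← map_add]
    simp
  rw [h]
  exact add_mem (hσ _) (hρ _)

end RationalMatrices

/-! ### Normal forms of points of the Calogero–Moser space -/

namespace CalogeroMoser

variable {r : ℕ}

/-- Change of basis by a matrix. -/
def conj (P : Matrix (Fin r) (Fin r) ℂ) (x : Space r) : Space r :=
  (P * x.1 * P⁻¹, P * x.2.1 * P⁻¹, P * x.2.2.1, x.2.2.2 * P⁻¹)

theorem conj_val (g : GL (Fin r) ℂ) (x : Space r) : conj g.1 x = act g x := by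
  rw [conj, act, Matrix.coe_units_inv]

theorem exists_eq_val {P : Matrix (Fin r) (Fin r) ℂ} (hP : P.det ≠ 0) :
    ∃ g : GL (Fin r) ℂ, g.1 = P :=
  (Matrix.isUnit_iff_isUnit_det P).2 hP.isUnit

/-- The entries of the quadruple are regular functions on `D`. -/
structure RationalOn {E : Type} [AddCommGroup E] [Module ℂ E] (D : Set E) (f : E → Space r) :
    Prop where
  fst : RationalMatrixOn D fun x => (f x).1
  snd : RationalMatrixOn D fun x => (f x).2.1
  framingIn : RationalMatrixOn D fun x => (f x).2.2.1
  framingOut : RationalMatrixOn D fun x => (f x).2.2.2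

namespace RationalOn

variable {E : Type} [AddCommGroup E] [Module ℂ E] {D : Set E} {f : E → Space r}

theorem rationalMapOn (hf : RationalOn D f) : RationalMapOn D f :=
  hf.fst.rationalMapOn.prodMk (hf.snd.rationalMapOn.prodMk
    (hf.framingIn.rationalMapOn.prodMk hf.framingOut.rationalMapOn))

theorem conj (hf : RationalOn D f) {P : E → Matrix (Fin r) (Fin r) ℂ}
    (hP : RationalMatrixOn D P) (hdet : ∀ x ∈ D, (P x).det ≠ 0) :
    RationalOn D fun x => conj (P x) (f x) where
  fst := (hP.mul hf.fst).mul (hP.inv hdet)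
  snd := (hP.mul hf.snd).mul (hP.inv hdet)
  framingIn := hP.mul hf.framingIn
  framingOut := hf.framingOut.mul (hP.inv hdet)

theorem twist (hf : RationalOn D f) (γ : SL(2, ℂ)) : RationalOn D fun x => twist γ (f x) where
  fst := (hf.fst.smul _).add (hf.snd.smul _)
  snd := (hf.fst.smul _).add (hf.snd.smul _)
  framingIn := hf.framingIn
  framingOut := hf.framingOut

theorem word (hf : RationalOn D f) (l : List (Fin 2)) : RationalMatrixOn D fun x => word (f x) l := by
  induction l with
  | nil => exact hf.framingIn
  | cons s l ih =>
    have hs : RationalMatrixOn D fun x => operators (f x) s := by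
      fin_cases s
      · exact hf.fst
      · exact hf.snd
    exact hs.mul ih

theorem frame (hf : RationalOn D f) (w : Fin r → List (Fin 2)) :
    RationalMatrixOn D fun x => frame w (f x) := fun i a => hf.word (w a) i 0

theorem id (D : Set (Space r)) : RationalOn D fun x => x where
  fst := .of_isLinearMap ⟨fun _ _ => rfl, fun _ _ => rfl⟩
  snd := .of_isLinearMap ⟨fun _ _ => rfl, fun _ _ => rfl⟩
  framingIn := .of_isLinearMap ⟨fun _ _ => rfl, fun _ _ => rfl⟩
  framingOut := .of_isLinearMap ⟨fun _ _ => rfl, fun _ _ => rfl⟩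

end RationalOn

/-- The representative of the class of a quadruple for which the frame is the identity. -/
def normalize (w : Fin r → List (Fin 2)) (x : Space r) : Space r := conj (frame w x)⁻¹ x

theorem exists_normalize_eq_act {w : Fin r → List (Fin 2)} {x : Space r}
    (hx : (frame w x).det ≠ 0) :
    ∃ c : GL (Fin r) ℂ, c.1 = frame w x ∧ normalize w x = act c⁻¹ x := by
  obtain ⟨c, hc⟩ := exists_eq_val hx
  refine ⟨c, hc, ?_⟩
  rw [normalize, ← hc, ← Matrix.coe_units_inv, conj_val]

theorem frame_normalize {w : Fin r → List (Fin 2)} {x : Space r} (hx : (frame w x).det ≠ 0) :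
    frame w (normalize w x) = 1 := by
  obtain ⟨c, hc, h⟩ := exists_normalize_eq_act hx
  rw [h, frame_act, ← hc, Units.inv_mul]

theorem det_frame_act_ne_zero {w : Fin r → List (Fin 2)} {x : Space r} (g : GL (Fin r) ℂ)
    (hx : (frame w x).det ≠ 0) : (frame w (act g x)).det ≠ 0 := by
  rw [frame_act, Matrix.det_mul]
  exact mul_ne_zero ((Matrix.isUnit_iff_isUnit_det _).1 g.isUnit).ne_zero hx

/-- The frame moves by left multiplication with `g`, which the normalisation undoes. -/
theorem normalize_act {w : Fin r → List (Fin 2)} {x : Space r} (g : GL (Fin r) ℂ)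
    (hx : (frame w x).det ≠ 0) : normalize w (act g x) = normalize w x := by
  obtain ⟨c, hc, h⟩ := exists_normalize_eq_act hx
  obtain ⟨c', hc', h'⟩ := exists_normalize_eq_act (det_frame_act_ne_zero g hx)
  have h1 : c' = g * c := Units.ext (by rw [hc', frame_act, ← hc]; rfl)
  rw [h, h', h1, act_act, mul_inv_rev, inv_mul_cancel_right]

end CalogeroMoser
end

noncomputable section

/-! ### Equivariant normal forms -/

namespace IrrepList

open CalogeroMoser

variable {Γ : Subgroup SL(2, ℂ)} {d r : ℕ} [NeZero d] {R : IrrepList Γ d}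
  {v : Fin d → ℕ} (ι : (Σ k, Fin (v k) × Fin (R.deg k)) ≃ Fin r)

/-- A representation with multiplicities `v` is conjugate to the standard one, so a point of the
stratum has a representative on which Γ acts through `sumGL`. -/
theorem mk_mem_fixedLocusOfClass_iff [Finite Γ] {τ : ℂ} (x : level r τ) :
    CalogeroMoser.mk x ∈ fixedLocusOfClass R r τ v ↔ ∃ h : GL (Fin r) ℂ, ∀ g : Γ,
      CalogeroMoser.act (R.sumGL ι g) (CalogeroMoser.act h x.1) =
        twist g.1 (CalogeroMoser.act h x.1) := by
  constructor
  · rintro ⟨-, x', g, hx', hg, hrank⟩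
    obtain ⟨u, hu⟩ : ∃ u, CalogeroMoser.act u x'.1 = x.1 := Quotient.exact hx'
    obtain ⟨q, hq⟩ := R.exists_conj_eq_sumGL ι g hrank
    refine ⟨q * u⁻¹, fun γ => ?_⟩
    rw [← hu, act_act (q * u⁻¹), inv_mul_cancel_right, act_act, ← hq, ← act_act, hg, twist_act]
  · rintro ⟨h, hh⟩
    let y : level r τ := ⟨CalogeroMoser.act h x.1, act_mem_level h x.2⟩
    have hy : CalogeroMoser.mk y = CalogeroMoser.mk x := Eq.symm (Quotient.sound ⟨h, rfl⟩)
    refine ⟨fun γ hγ => ?_, y, R.sumGL ι, hy, hh, R.finrank_intertwiningMap_sumGL ι⟩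
    rw [← hy]
    exact Eq.symm (Quotient.sound ⟨R.sumGL ι ⟨γ, hγ⟩, hh ⟨γ, hγ⟩⟩)

/-- When the frame is the identity, the frame of the twisted quadruple is the matrix `g_γ` itself.
Thus `g_γ` is a polynomial expression in the normalised point. -/
theorem frame_twist_eq {w : Fin r → List (Fin 2)} {s : CalogeroMoser.Space r}
    (hs : frame w s = 1) {q : GL (Fin r) ℂ}
    (hq : ∀ g : Γ, CalogeroMoser.act (R.sumGL ι g) (CalogeroMoser.act q s) =
      twist g.1 (CalogeroMoser.act q s)) (g : Γ) :
    twist g.1 s = CalogeroMoser.act (q⁻¹ * R.sumGL ι g * q) s ∧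
      frame w (twist g.1 s) = q⁻¹.1 * R.sumMat ι g * q.1 := by
  have h : twist g.1 s = CalogeroMoser.act (q⁻¹ * R.sumGL ι g * q) s := by
    rw [← act_act, ← act_act, hq, twist_act, act_act, inv_mul_cancel, CalogeroMoser.act_one]
  refine ⟨h, ?_⟩
  rw [h, frame_act, hs, Matrix.mul_one]
  rfl

/-- An average over the group which intertwines, at fixed points in normal form, the action of the
group with the standard one. -/
def average [Fintype Γ] (w : Fin r → List (Fin 2)) (C : Matrix (Fin r) (Fin r) ℂ)
    (s : CalogeroMoser.Space r) : Matrix (Fin r) (Fin r) ℂ :=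
  ∑ g : Γ, R.sumMat ι g * C * frame w (twist (g⁻¹).1 s)

/-- The average has the form `∑ ρ(g) C ρ'(g⁻¹)`, where `ρ` is the standard representation and `ρ'(g)
= g_γ` is read off from the frames; it intertwines `ρ'` with `ρ` for every `C`. -/
theorem act_average [Fintype Γ] {w : Fin r → List (Fin 2)} {C : Matrix (Fin r) (Fin r) ℂ}
    {s : CalogeroMoser.Space r} (hs : frame w s = 1) {q : GL (Fin r) ℂ}
    (hq : ∀ g : Γ, CalogeroMoser.act (R.sumGL ι g) (CalogeroMoser.act q s) =
      twist g.1 (CalogeroMoser.act q s)) {u : GL (Fin r) ℂ} (hu : u.1 = average ι w C s) (g : Γ) :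
    CalogeroMoser.act (R.sumGL ι g) (CalogeroMoser.act u s) =
      twist g.1 (CalogeroMoser.act u s) := by
  have hcomm : R.sumGL ι g * u = u * (q⁻¹ * R.sumGL ι g * q) := by
    refine Units.ext ?_
    change R.sumMat ι g * u.1 = u.1 * (q⁻¹.1 * R.sumMat ι g * q.1)
    rw [hu, average, Finset.mul_sum, Finset.sum_mul]
    -- The substitution `x ↦ g x` in the average moves `g` from one side to the other.
    refine Fintype.sum_equiv (Equiv.mulLeft g) _ _ fun x => ?_
    simp only [(frame_twist_eq ι hs hq _).2, Equiv.coe_mulLeft]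
    have h1 : R.sumMat ι (g * x)⁻¹ * R.sumMat ι g = R.sumMat ι x⁻¹ := by
      rw [← sumMat_mul, mul_inv_rev, inv_mul_cancel_right]
    have h2 : q.1 * (q⁻¹.1 * (R.sumMat ι g * q.1)) = R.sumMat ι g * q.1 := by
      rw [← Matrix.mul_assoc, Units.mul_inv, Matrix.one_mul]
    simp only [Matrix.mul_assoc, h2]
    rw [← Matrix.mul_assoc (R.sumMat ι (g * x)⁻¹), h1, sumMat_mul, Matrix.mul_assoc]
  rw [act_act, hcomm, ← act_act, ← (frame_twist_eq ι hs hq g).1, twist_act]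

/-- With `C` the frame of an equivariant point, `C` already intertwines and all terms of the average
are equal. So the average is invertible there, and on a Zariski neighbourhood. -/
theorem average_normalize [Fintype Γ] {w : Fin r → List (Fin 2)} {y : CalogeroMoser.Space r}
    (hy : ∀ g : Γ, CalogeroMoser.act (R.sumGL ι g) y = twist g.1 y)
    (hw : (frame w y).det ≠ 0) :
    average ι w (frame w y) (normalize w y) = (Fintype.card Γ : ℂ) • frame w y := by
  obtain ⟨c, hc, h⟩ := exists_normalize_eq_act hw
  have hcy : CalogeroMoser.act c (normalize w y) = y := by
    rw [h, act_act, mul_inv_cancel, CalogeroMoser.act_one]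
  have hq : ∀ g : Γ, CalogeroMoser.act (R.sumGL ι g) (CalogeroMoser.act c (normalize w y)) =
      twist g.1 (CalogeroMoser.act c (normalize w y)) := by
    rw [hcy]
    exact hy
  have hterm : ∀ g : Γ, R.sumMat ι g * frame w y * frame w (twist (g⁻¹).1 (normalize w y)) =
      frame w y := fun g => by
    have h1 : c.1 * (c⁻¹.1 * (R.sumMat ι g⁻¹ * c.1)) = R.sumMat ι g⁻¹ * c.1 := by
      rw [← Matrix.mul_assoc, Units.mul_inv, Matrix.one_mul]
    rw [(frame_twist_eq ι (frame_normalize hw) hq _).2, ← hc]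
    simp only [Matrix.mul_assoc, h1]
    rw [← Matrix.mul_assoc, ← sumMat_mul, mul_inv_cancel, sumMat_one, Matrix.one_mul]
  rw [average, Finset.sum_congr rfl fun g _ => hterm g, Finset.sum_const, Finset.card_univ,
    Nat.cast_smul_eq_nsmul]

theorem rationalOn_average [Fintype Γ] {E : Type} [AddCommGroup E] [Module ℂ E] {D : Set E}
    {f : E → CalogeroMoser.Space r} (hf : CalogeroMoser.RationalOn D f) (w : Fin r → List (Fin 2))
    (C : Matrix (Fin r) (Fin r) ℂ) : RationalMatrixOn D fun x => average ι w C (f x) :=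
  .sum fun g => (RationalMatrixOn.const (R.sumMat ι g * C)).mul ((hf.twist (g⁻¹).1).frame w)

/-- The equivariant normal form of a quadruple. -/
def equivariantForm [Fintype Γ] (w : Fin r → List (Fin 2)) (C : Matrix (Fin r) (Fin r) ℂ)
    (x : CalogeroMoser.Space r) : CalogeroMoser.Space r :=
  conj (average ι w C (normalize w x)) (normalize w x)

/-- The locus where the equivariant normal form is defined. -/
def formLocus [Fintype Γ] (w : Fin r → List (Fin 2)) (C : Matrix (Fin r) (Fin r) ℂ) :
    Set (CalogeroMoser.Space r) :=
  {x | x ∈ {x | x ∈ Set.univ ∧ (frame w x).det ≠ 0} ∧ (average ι w C (normalize w x)).det ≠ 0}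

theorem rationalOn_normalize {D : Set (CalogeroMoser.Space r)} {w : Fin r → List (Fin 2)}
    (hD : ∀ x ∈ D, (frame w x).det ≠ 0) : CalogeroMoser.RationalOn D (normalize w) := by
  refine (CalogeroMoser.RationalOn.id D).conj
    (((CalogeroMoser.RationalOn.id D).frame w).inv hD) fun x hx => ?_
  rw [Matrix.det_nonsing_inv, Ring.inverse_eq_inv']
  exact inv_ne_zero (hD x hx)

theorem isOpen_formLocus [Fintype Γ] (w : Fin r → List (Fin 2)) (C : Matrix (Fin r) (Fin r) ℂ) :
    IsOpen[zariskiTopology (CalogeroMoser.Space r)] (formLocus ι w C) := by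
  refine isOpen_rationalOn_ne (isOpen_rationalOn_ne (@isOpen_univ _ (zariskiTopology _)) ?_) ?_
  · exact ((CalogeroMoser.RationalOn.id _).frame w).det
  · exact (rationalOn_average ι (rationalOn_normalize fun x hx => hx.2) w C).det

theorem rationalMapOn_equivariantForm [Fintype Γ] (w : Fin r → List (Fin 2))
    (C : Matrix (Fin r) (Fin r) ℂ) :
    RationalMapOn (formLocus ι w C) (equivariantForm ι w C) := by
  have h : CalogeroMoser.RationalOn (formLocus ι w C) (normalize w) :=
    rationalOn_normalize fun x hx => hx.1.2
  exact (h.conj (rationalOn_average ι h w C) fun x hx => hx.2).rationalMapOn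

theorem equivariantForm_act [Fintype Γ] {w : Fin r → List (Fin 2)}
    {C : Matrix (Fin r) (Fin r) ℂ} {x : CalogeroMoser.Space r} (g : GL (Fin r) ℂ)
    (hx : x ∈ formLocus ι w C) : CalogeroMoser.act g x ∈ formLocus ι w C ∧
      equivariantForm ι w C (CalogeroMoser.act g x) = equivariantForm ι w C x := by
  have h := normalize_act g hx.1.2
  refine ⟨⟨⟨trivial, det_frame_act_ne_zero g hx.1.2⟩, ?_⟩, ?_⟩
  · rw [h]
    exact hx.2
  · rw [equivariantForm, h, equivariantForm]

theorem exists_equivariantForm_eq_act [Fintype Γ] {w : Fin r → List (Fin 2)}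
    {C : Matrix (Fin r) (Fin r) ℂ} {x : CalogeroMoser.Space r} (hx : x ∈ formLocus ι w C)
    (hfix : ∃ h : GL (Fin r) ℂ, ∀ g : Γ, CalogeroMoser.act (R.sumGL ι g) (CalogeroMoser.act h x) =
      twist g.1 (CalogeroMoser.act h x)) :
    (∃ u : GL (Fin r) ℂ, equivariantForm ι w C x = CalogeroMoser.act u x) ∧
      ∀ g : Γ, CalogeroMoser.act (R.sumGL ι g) (equivariantForm ι w C x) =
        twist g.1 (equivariantForm ι w C x) := by
  obtain ⟨c, -, hc⟩ := exists_normalize_eq_act hx.1.2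
  obtain ⟨u, hu⟩ := CalogeroMoser.exists_eq_val hx.2
  have hform : equivariantForm ι w C x = CalogeroMoser.act u (normalize w x) := by
    rw [equivariantForm, ← hu, conj_val]
  refine ⟨⟨u * c⁻¹, by rw [hform, hc, act_act]⟩, ?_⟩
  obtain ⟨h, hh⟩ := hfix
  rw [hform]
  refine act_average ι (q := h * c) (frame_normalize hx.1.2) ?_ hu
  rw [hc, act_act, mul_inv_cancel_right]
  exact hh

end IrrepList
end

noncomputable section

/-! ### The isomorphism -/

namespace IrrepList

open CalogeroMoser

variable {Γ : Subgroup SL(2, ℂ)} {d r : ℕ} [NeZero d] {R : IrrepList Γ d} {m : Fin d → Fin d → ℕ}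
  {v : Fin d → ℕ}

theorem isomorphic_mckayQuiverVariety [Finite Γ] (hm : IsMcKayOrientation R m) {τ : ℂ}
    (hτ : τ ≠ 0) (ζR : Fin d → ℝ) (ι : (Σ k, Fin (v k) × Fin (R.deg k)) ≃ Fin r) :
    SpaceWithFunctions.Isomorphic
      ((CalogeroMoser.variety r τ).restrict (fixedLocusOfClass R r τ v))
      (mckayQuiverVariety R m v (framingZero d) (fun _ => τ) ζR) := by
  have := Fintype.ofFinite Γ
  obtain ⟨b⟩ := R.exists_arrowBasis hm
  have hζ := QuiverVariety.isGeneric_graphParameter R.deg_pos hτ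
  have hS : ∀ x, x ∈ QuiverVariety.semistable m v (framingZero d) (graphParameter R.deg fun _ => τ)
      (graphParameter R.deg ζR) ↔ toCM b ι x ∈ level r τ := fun x => by
    rw [QuiverVariety.semistable_eq_levelC hζ, toCM_mem_level_iff]
  -- A linear left inverse of `toCM` suffices, since equivariant quadruples lie in the image; it
  -- keeps the local sections rational.
  obtain ⟨Λ, hΛ⟩ := (toCM b ι).exists_leftInverse_of_injective
    (LinearMap.ker_eq_bot.2 (toCM_injective b ι))
  have hback : ∀ y : CalogeroMoser.Space r, (∀ g : Γ, CalogeroMoser.act (R.sumGL ι g) y =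
      twist g.1 y) → toCM b ι (Λ y) = y := fun y hy => by
    obtain ⟨x, rfl⟩ := exists_toCM_eq b ι hy
    exact congrArg (toCM b ι) (LinearMap.congr_fun hΛ x)
  have hmk : ∀ (x x' : level r τ), CalogeroMoser.mk x = CalogeroMoser.mk x' ↔
      ∃ u, CalogeroMoser.act u x.1 = x'.1 := fun x x' =>
    ⟨fun h => Quotient.exact h, fun h => Quotient.sound h⟩
  refine isomorphic_of_rational_sections _ _ CalogeroMoser.mk (QuiverVariety.proj _ _ _ _ _)
    Quotient.exists_rep (QuiverVariety.proj_surjective hζ) _ (toCM b ι) (fun y hy => (hS y).1 hy)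
    (fun y => ?_) (fun y y' => ?_) (fun x hx => ?_) fun y₀ => ?_
  · refine (mk_mem_fixedLocusOfClass_iff ι _).2 ⟨1, fun g => ?_⟩
    rw [CalogeroMoser.act_one]
    exact act_sumGL_toCM b ι y.1 g
  · rw [hmk, QuiverVariety.proj_eq_proj_iff hζ]
    constructor
    · rintro ⟨u, hu⟩
      have hu' : CalogeroMoser.act u (toCM b ι y.1) = toCM b ι y'.1 := hu
      -- Both orders of `u` and the group element carry the first point to the same twist of the
      -- second, so freeness makes them commute.
      obtain ⟨g, rfl⟩ := R.exists_eq_spreadGL ι (A := u) fun γ => by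
        refine congrArg Units.val (act_left_cancel (g := R.sumGL ι γ * u)
          (h := u * R.sumGL ι γ) hτ ((hS y).1 y.2) ?_)
        rw [← act_act, ← act_act, hu', act_sumGL_toCM, act_sumGL_toCM, ← twist_act, hu']
      exact ⟨g, toCM_injective b ι (by rw [toCM_act, hu'])⟩
    · rintro ⟨g, hg⟩
      exact ⟨spreadGL ι g, by rw [← toCM_act, hg]⟩
  · obtain ⟨h, hh⟩ := (mk_mem_fixedLocusOfClass_iff ι x).1 hx
    have h1 := hback _ hh
    refine ⟨⟨Λ (CalogeroMoser.act h x.1), (hS _).2 ?_⟩, (hmk _ _).2 ⟨h⁻¹, ?_⟩⟩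
    · rw [h1]
      exact act_mem_level h x.2
    · refine (congrArg (CalogeroMoser.act h⁻¹) h1).trans ?_
      rw [act_act, inv_mul_cancel, CalogeroMoser.act_one]
  · have hy₀ := act_sumGL_toCM b ι y₀.1
    obtain ⟨w, hw⟩ := exists_det_frame_ne_zero hτ ((hS y₀).1 y₀.2)
    -- Freezing `C` at the frame of the base point makes the section defined there; away from it
    -- only the nonvanishing of the two determinants is needed.
    refine ⟨formLocus ι w (frame w (toCM b ι y₀.1)),
      fun x => Λ (equivariantForm ι w (frame w (toCM b ι y₀.1)) x), isOpen_formLocus ι w _,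
      ⟨⟨trivial, hw⟩, ?_⟩, fun φ => ?_, fun x x' hxx' hx => ?_,
      fun x hx hxY => ?_⟩
    · rw [average_normalize ι hy₀ hw, Matrix.det_smul]
      exact mul_ne_zero (pow_ne_zero _ (Nat.cast_ne_zero.2 Fintype.card_ne_zero)) hw
    · exact rationalMapOn_equivariantForm ι w _ (φ ∘ₗ Λ)
    · obtain ⟨u, hu⟩ := (hmk x x').1 hxx'
      have h := equivariantForm_act ι u hx
      rw [hu] at h
      exact ⟨h.1, congrArg Λ h.2.symm⟩
    · obtain ⟨⟨u, hu⟩, hform⟩ := exists_equivariantForm_eq_act ι hx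
        ((mk_mem_fixedLocusOfClass_iff ι x).1 hxY)
      have h1 := hback _ hform
      refine ⟨(hS _).2 ?_, (hmk _ _).2 ⟨u⁻¹, ?_⟩⟩
      · rw [h1, hu]
        exact act_mem_level u x.2
      · refine (congrArg (CalogeroMoser.act u⁻¹) (h1.trans hu)).trans ?_
        rw [act_act, inv_mul_cancel, CalogeroMoser.act_one]

end IrrepList

end

theorem mainTheorem8 (Γ : Subgroup (Matrix.SpecialLinearGroup (Fin 2) ℂ)) [Finite Γ]
    (d : ℕ) [NeZero d] (R : IrrepList Γ d)
    (m : Fin d → Fin d → ℕ) (hm : IsMcKayOrientation R m)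
    (τ : ℂ) (hτ : τ ≠ 0) (n : ℕ) (ζR : Fin d → ℝ) :
    SpaceWithFunctions.Isomorphic
      ((CalogeroMoser.variety (n * Nat.card Γ) τ).restrict
        (CalogeroMoser.fixedLocusOfClass R (n * Nat.card Γ) τ (fun k => n * R.deg k)))
      (mckayQuiverVariety R m (fun k => n * R.deg k) (framingZero d) (fun _ => τ) ζR) := by
  refine IrrepList.isomorphic_mckayQuiverVariety hm hτ ζR (Fintype.equivOfCardEq ?_)
  -- The dimensions match because the squares of the `dim R_k` add up to `|Γ|`.
  rw [Fintype.card_sigma, Fintype.card_fin, ← R.sum_deg_mul_deg, Finset.mul_sum]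
  refine Finset.sum_congr rfl fun k _ => ?_
  rw [Fintype.card_prod, Fintype.card_fin, Fintype.card_fin, mul_assoc]
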